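/- For $(a,b)\in\mathbb C^2$ let $V(\lambda;a,b)=4\lambda^3-2a\lambda-28b$. A turning point is a zero of $V$; a Stokes line is a curve along which the real part of the action $\int\sqrt V\,d\lambda$ is constant and which has a turning point on its boundary. We say that $(a,b)$ is of type "320" if $V(\cdot;a,b)$ has three distinct turning points $\lambda_0,\lambda_1,\lambda_{-1}$ such that $\lambda_0$ is joined by one (internal) Stokes line to $\lambda_1$ and by one to $\lambda_{-1}$, while the other Stokes lines go to infinity: that of $\lambda_0$ in the direction $\arg\lambda=\pi$, those of $\lambda_1$ in the directions $\arg\lambda=\frac{\pi}{5},\frac{3\pi}{5}$, and those of $\lambda_{-1}$ in the directions $\arg\lambda=-\frac{\pi}{5},-\frac{3\pi}{5}$ (so that, counterclockwise around $\lambda_0$, the lines are the external one, the one to $\lambda_{-1}$, the one to $\lambda_1$). Let $(a^*,b^*)$ be of type "320". Cut the $\lambda$-plane from the three turning points to infinity along the external Stokes lines of directions $\pi,\frac{3\pi}{5},-\frac{3\pi}{5}$, and choose the branch of $\sqrt V$ on the cut plane such that $\operatorname{Re}\sqrt{V(\lambda)}\to+\infty$ as $\lambda\to\infty$ along the positive semi-axis.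 Let $c_{\pm1}$ be the closed curve on the Riemann surface $\mu^2=V(\lambda;a^*,b^*)$ which runs from $\lambda_0$ to $\lambda_{\pm1}$ along the internal Stokes line on the sheet $\mu=\sqrt V$ and back from $\lambda_{\pm1}$ to $\lambda_0$ on the sheet $\mu=-\sqrt V$. For $(a,b)$ near $(a^*,b^*)$, move these cycles continuously with the turning points and put $$\chi_{\pm2}(a,b)=\oint_{c_{\mp1}}\sqrt{V(\lambda;a,b)}\,d\lambda,\qquad \tilde u_{\pm2}=-e^{\chi_{\pm2}},\qquad \tilde U(a,b)=\begin{pmatrix}\tilde u_2(a,b)-1\\ \tilde u_{-2}(a,b)-1\end{pmatrix}.$$ Then there is an open neighbourhood $N$ of $(a^*,b^*)$ on which $\chi_{2}$ and $\chi_{-2}$ are holomorphic, and at every $(a,b)\in N$ $$\frac{\partial\chi_2}{\partial a}\frac{\partial\chi_{-2}}{\partial b}-\frac{\partial\chi_{-2}}{\partial a}\frac{\partial\chi_2}{\partial b}=-28\pi i .$$ Moreover $\tilde U$ is locally invertible (locally biholomorphic) at every point of $N$, and every zero of $\tilde U$ in $N$ is simple, i.e. the Jacobian determinant of $\tilde U$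 does not vanish there. -/

import Mathlib

open Set Filter Topology

noncomputable section

/-- The cubic potential `V(z; a, b) = 4 z³ - 2 a z - 28 b`, with `p = (a, b)`.
A turning point is a zero of `V( · ; a, b)`. -/
def cubicPotential (p : ℂ × ℂ) (z : ℂ) : ℂ := 4 * z ^ 3 - 2 * p.1 * z - 28 * p.2

/-- `γ` runs on the time interval `J` along a Stokes line of `V( · ; p)`: it is a `C¹` curve along
which the differential `√V dz` of the action is purely imaginary, i.e. along which the real part of
the action is constant. The curve is parametrised by the arc length of the metric `|√V| |dz|`, so
that `√V(γ) γ' = ± i`. -/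
structure IsStokesCurveOn (p : ℂ × ℂ) (J : Set ℝ) (γ : ℝ → ℂ) : Prop where
  differentiableAt : ∀ t ∈ J, DifferentiableAt ℝ γ t
  continuousOn_deriv : ContinuousOn (deriv γ) J
  potential_mul_sq : ∀ t ∈ J, cubicPotential p (γ t) * deriv γ t ^ 2 = -1

/-- `γ : [0, T] → ℂ` is an internal Stokes line, joining the turning point `z` to the turning
point `w`. -/
structure IsInternalStokesLine (p : ℂ × ℂ) (z w : ℂ) (T : ℝ) (γ : ℝ → ℂ) : Prop where
  length_pos : 0 < T
  continuousOn : ContinuousOn γ (Icc 0 T)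
  source : γ 0 = z
  target : γ T = w
  stokes : IsStokesCurveOn p (Ioo 0 T) γ

/-- `γ : [0, ∞) → ℂ` is an external Stokes line, which starts at the turning point `z` and goes to
infinity in the asymptotic direction `arg = θ`. -/
structure IsExternalStokesLine (p : ℂ × ℂ) (z : ℂ) (θ : ℝ) (γ : ℝ → ℂ) : Prop where
  continuousOn : ContinuousOn γ (Ici 0)
  source : γ 0 = z
  stokes : IsStokesCurveOn p (Ioi 0) γ
  tendsto_norm : Tendsto (fun t => ‖γ t‖) atTop atTop
  tendsto_direction : Tendsto (fun t => γ t / (‖γ t‖ : ℂ)) atTop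
    (𝓝 (Complex.exp (θ * Complex.I)))

/-- The Stokes complex of `V( · ; p)` is of type "320". There are three distinct turning
points `z₀, z₁, zm` (`m` stands for the index `-1`) and two internal Stokes lines, joining `z₀`
to `z₁` and `z₀` to `zm`. The remaining Stokes line of `z₀` goes to infinity in the direction `π`,
those of `z₁` in the directions `3π/5` and `π/5`, those of `zm` in the directions `-3π/5`
and `-π/5`. The last two fields record how the graph is embedded in the plane at the vertex `z₀`: in
the counterclockwise order the lines issuing from `z₀` are the external one, the one to `zm`, the
one to `z₁` (three Stokes lines issue from a simple turning point, at angles `2π/3`). -/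
structure StokesGraph320 (p : ℂ × ℂ) where
  z₀ : ℂ
  z₁ : ℂ
  zm : ℂ
  z₀_ne_z₁ : z₀ ≠ z₁
  z₀_ne_zm : z₀ ≠ zm
  z₁_ne_zm : z₁ ≠ zm
  turning_z₀ : cubicPotential p z₀ = 0
  turning_z₁ : cubicPotential p z₁ = 0
  turning_zm : cubicPotential p zm = 0
  T₁ : ℝ
  Tm : ℝ
  line₁ : ℝ → ℂ
  linem : ℝ → ℂ
  internal₁ : IsInternalStokesLine p z₀ z₁ T₁ line₁
  internalm : IsInternalStokesLine p z₀ zm Tm linem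
  ray₀ : ℝ → ℂ
  ray₁ : ℝ → ℂ
  ray₁' : ℝ → ℂ
  raym : ℝ → ℂ
  raym' : ℝ → ℂ
  external₀ : IsExternalStokesLine p z₀ Real.pi ray₀
  external₁ : IsExternalStokesLine p z₁ (3 * Real.pi / 5) ray₁
  external₁' : IsExternalStokesLine p z₁ (Real.pi / 5) ray₁'
  externalm : IsExternalStokesLine p zm (-(3 * Real.pi / 5)) raym
  externalm' : IsExternalStokesLine p zm (-(Real.pi / 5)) raym'
  cyclic₀m : Tendsto (fun t => (linem t - z₀) / (ray₀ t - z₀)) (𝓝[>] 0)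
    (𝓝 (Complex.exp (2 * Real.pi / 3 * Complex.I)))
  cyclicm₁ : Tendsto (fun t => (line₁ t - z₀) / (linem t - z₀)) (𝓝[>] 0)
    (𝓝 (Complex.exp (2 * Real.pi / 3 * Complex.I)))

/-- The cut plane: the complement of three disjoint cuts, which go from the three turning points to
infinity along the external Stokes lines of directions `π`, `3π/5` and `-3π/5`. It contains the
interior of the two internal Stokes lines, and the far part of the positive semi-axis. -/
def StokesGraph320.cutPlane {p : ℂ × ℂ} (G : StokesGraph320 p) : Set ℂ :=
  (G.ray₀ '' Ici 0 ∪ G.ray₁ '' Ici 0 ∪ G.raym '' Ici 0)ᶜ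

/-- `f` is the branch of `√V` on the cut plane whose real part tends to `+∞` along the positive
semi-axis. -/
structure IsSqrtBranch (p : ℂ × ℂ) (G : StokesGraph320 p) (f : ℂ → ℂ) : Prop where
  continuousOn : ContinuousOn f G.cutPlane
  sq_eq : ∀ z ∈ G.cutPlane, f z ^ 2 = cubicPotential p z
  tendsto_re : Tendsto (fun x : ℝ => (f (x : ℂ)).re) atTop atTop

/-- `ζ` is, near `p₀`, the continuous branch of turning points of `V( · ; p)` which takes the
value `z` at `p₀`. -/
structure IsTurningPointBranch (p₀ : ℂ × ℂ) (z : ℂ) (ζ : ℂ × ℂ → ℂ) : Prop where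
  continuousAt : ContinuousAt ζ p₀
  value : ζ p₀ = z
  turning : ∀ᶠ p in 𝓝 p₀, cubicPotential p (ζ p) = 0

/-- The affine map of the plane taking `z` to `z'` and `w` to `w'` (for `z ≠ w`). -/
def affineMove (z w z' w' x : ℂ) : ℂ := z' + (x - z) * ((w' - z') / (w - z))

/-- The value of `√V( · ; p)` at the transported point `φ x`, continued in `p` from the value `f x`
of `√V( · ; p₀)` at `x`. For `p` close to `p₀` the quotient `V(φ x; p) / V(x; p₀)` is close to `1`
along the arc that is transported, and the power is its principal square root. -/
def continuedSqrt (p₀ p : ℂ × ℂ) (f φ : ℂ → ℂ) (x : ℂ) : ℂ :=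
  f x * (cubicPotential p (φ x) / cubicPotential p₀ x) ^ (1 / 2 : ℂ)

theorem continuedSqrt_sq {p₀ p : ℂ × ℂ} {f φ : ℂ → ℂ} {x : ℂ}
    (hf : f x ^ 2 = cubicPotential p₀ x) (hx : cubicPotential p₀ x ≠ 0) :
    continuedSqrt p₀ p f φ x ^ 2 = cubicPotential p (φ x) := by
  have h : ∀ w : ℂ, (w ^ (1 / 2 : ℂ)) ^ 2 = w := by
    intro w
    rw [← Complex.cpow_nat_mul]
    norm_num
  rw [continuedSqrt, mul_pow, h, hf]
  field_simp

/-- The projection to the `λ`-plane of a closed curve on the Riemann surface `μ² = V(λ; p)`: it runs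
along the arc `φ ∘ γ`, `γ : [0, T] → ℂ`, from one turning point to another, and then back. -/
def cyclePoint (T : ℝ) (γ : ℝ → ℂ) (φ : ℂ → ℂ) (t : ℝ) : ℂ :=
  if t ≤ T then φ (γ t) else φ (γ (2 * T - t))

/-- The coordinate `μ` along that closed curve: it runs forth on the sheet `μ = √V`, and back on the
sheet `μ = -√V`. The two sheets meet at the turning points. -/
def cycleSheet (p₀ p : ℂ × ℂ) (f : ℂ → ℂ) (T : ℝ) (γ : ℝ → ℂ) (φ : ℂ → ℂ) (t : ℝ) : ℂ :=
  if t ≤ T then continuedSqrt p₀ p f φ (γ t) else -continuedSqrt p₀ p f φ (γ (2 * T - t))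

/-- The period `∮ μ dλ` of `√V` over that closed curve of the Riemann surface `μ² = V(λ; p)`. -/
def sqrtPeriod (p₀ p : ℂ × ℂ) (f : ℂ → ℂ) (T : ℝ) (γ : ℝ → ℂ) (φ : ℂ → ℂ) : ℂ :=
  ∫ t in (0 : ℝ)..(2 * T), cycleSheet p₀ p f T γ φ t * deriv (cyclePoint T γ φ) t

/-- `χ₂(p) = ∮_{c₋₁} √V(λ; p) dλ` for `p` near `p₀`. At `p = p₀` the cycle `c₋₁` runs from `z₀`
to `zm` along the internal Stokes line on the sheet `f`, and back on the other sheet. For `p`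
near `p₀` it is moved along with its two branch points `ζ₀ p` and `ζm p`. -/
def chi₂ (p₀ : ℂ × ℂ) (G : StokesGraph320 p₀) (f : ℂ → ℂ) (ζ₀ ζm : ℂ × ℂ → ℂ) (p : ℂ × ℂ) : ℂ :=
  sqrtPeriod p₀ p f G.Tm G.linem (affineMove G.z₀ G.zm (ζ₀ p) (ζm p))

/-- `χ₋₂(p) = ∮_{c₁} √V(λ; p) dλ` for `p` near `p₀`. At `p = p₀` the cycle `c₁` runs from `z₀`
to `z₁` along the internal Stokes line on the sheet `f`, and back on the other sheet. For `p`
near `p₀` it is moved along with its two branch points `ζ₀ p` and `ζ₁ p`. -/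
def chim₂ (p₀ : ℂ × ℂ) (G : StokesGraph320 p₀) (f : ℂ → ℂ) (ζ₀ ζ₁ : ℂ × ℂ → ℂ) (p : ℂ × ℂ) : ℂ :=
  sqrtPeriod p₀ p f G.T₁ G.line₁ (affineMove G.z₀ G.z₁ (ζ₀ p) (ζ₁ p))

/-- The map `Ũ = (ũ₂ - 1, ũ₋₂ - 1)`, `ũ_{±2} = -exp χ_{±2}`, built from the functions `χ_{±2}`. -/
def bsbMap (χ χ' : ℂ × ℂ → ℂ) (p : ℂ × ℂ) : ℂ × ℂ :=
  (-Complex.exp (χ p) - 1, -Complex.exp (χ' p) - 1)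

/-- `F` is locally invertible at `p`, as a holomorphic map: near `p` it is a biholomorphism between
open sets. -/
def IsLocallyBiholomorphicAt (F : ℂ × ℂ → ℂ × ℂ) (p : ℂ × ℂ) : Prop :=
  ∃ e : OpenPartialHomeomorph (ℂ × ℂ) (ℂ × ℂ), p ∈ e.source ∧ EqOn e F e.source ∧
    AnalyticOnNhd ℂ e e.source ∧ AnalyticOnNhd ℂ e.symm e.target

/-- `p` is a simple zero of `F`: a zero at which the Jacobian determinant does not vanish. -/
def IsSimpleZero (F : ℂ × ℂ → ℂ × ℂ) (p : ℂ × ℂ) : Prop :=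
  F p = 0 ∧ DifferentiableAt ℂ F p ∧ (fderiv ℂ F p).det ≠ 0

end

/-! Write `ω` and `η` for the integrals of `dλ / √V` and `λ dλ / √V` along an internal line.
Differentiating `χ = 2 ∫ √V dλ` under the integral sign gives `∂χ/∂a = -2 η` and `∂χ/∂b = -28 ω`;
the motion of the end points adds nothing, because `√V` vanishes there. The Jacobian of the two
periods is therefore `56` times a determinant of `ω`'s and `η`'s, and the claim becomes Legendre's
relation `2 (η₁ ωₘ - ω₁ ηₘ) = π i`.

For Legendre's relation (`IsRootArc.legendre`), let `C(x)` be the Cauchy integral of `dλ / (√V (x -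
λ))` over the second arc. Since `V` is a cubic with leading coefficient `4`, `V'/2 · C + V C' = 2 (x
ωₘ - ηₘ)` (`cauchy_ode`). So `√V · C` is a primitive along the first arc of a combination of the two
basic differentials. It tends to `0` at the far end. At the common end `z₀`, substituting square
roots of `λ - z₀` turns the singular part into `log ((1 + q) / (1 - q))` with `q → ∞`, whose limit
is `± π i` (`tendsto_root_mul_cauchy`).

The sign comes from the embedding of the graph. Seen from `z₀`, the internal lines leave at angles
`∓ π/3` to the axis opposite the external line, in a half disc free of cuts where `√V` behaves like
a constant times `(λ - z₀)^{1/2}`. The root on the line to `zm`, divided by that on the line to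
`z₁`, thus has argument near `-π/3`, so `q` lies in the lower half plane (`exists_sector`). Only
this relative sign matters, since the Jacobian is bilinear in the two periods.

Two facts make this rigorous for all nearby parameters. Stokes lines solve an ordinary differential
equation away from turning points, so they do not cross, and they approach a turning point like
`t^{2/3}`, so `1/V` is integrable in the arc length. Moreover, after an affine motion of the arc,
`√V dλ` has a density continuous up to the end points and explicit in the turning points
(`potential_move`, `factor_mul_deriv`); this yields holomorphy of the periods and their derivatives.

The Jacobian determinant of `Ũ` is `exp (χ₂ + χ₋₂)` times that of the periods, hence nonzero, and
the inverse function theorem finishes the proof. -/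

noncomputable section

/-! ### Stokes curves as solutions of an ordinary differential equation. -/

/-- The derivative of the cubic potential. -/
def cubicDeriv (p : ℂ × ℂ) (z : ℂ) : ℂ := 12 * z ^ 2 - 2 * p.1

theorem hasDerivAt_cubicPotential (p : ℂ × ℂ) (z : ℂ) :
    HasDerivAt (cubicPotential p) (cubicDeriv p z) z := by
  unfold cubicPotential cubicDeriv
  refine (((((hasDerivAt_id' z).fun_pow 3).const_mul 4).fun_sub
    ((hasDerivAt_id' z).const_mul (2 * p.1))).sub_const (28 * p.2)).congr_deriv ?_
  push_cast
  ring

theorem continuous_cubicPotential (p : ℂ × ℂ) : Continuous (cubicPotential p) := by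
  unfold cubicPotential; fun_prop

theorem continuous_cubicDeriv (p : ℂ × ℂ) : Continuous (cubicDeriv p) := by
  unfold cubicDeriv; fun_prop

namespace IsStokesCurveOn

variable {p : ℂ × ℂ} {J : Set ℝ} {γ : ℝ → ℂ}

theorem potential_ne_zero (h : IsStokesCurveOn p J γ) {t : ℝ} (ht : t ∈ J) :
    cubicPotential p (γ t) ≠ 0 := fun h0 => by
  have := h.potential_mul_sq t ht
  simp [h0] at this

theorem deriv_ne_zero (h : IsStokesCurveOn p J γ) {t : ℝ} (ht : t ∈ J) : deriv γ t ≠ 0 :=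
  fun h0 => by
  have := h.potential_mul_sq t ht
  simp [h0] at this

theorem mono {J' : Set ℝ} (h : IsStokesCurveOn p J γ) (hJ : J' ⊆ J) : IsStokesCurveOn p J' γ :=
  ⟨fun t ht => h.1 t (hJ ht), h.2.mono hJ, fun t ht => h.3 t (hJ ht)⟩

theorem deriv_comp_affine (h : IsStokesCurveOn p J γ) (c ε : ℝ) {t : ℝ} (ht : c + ε * t ∈ J) :
    HasDerivAt (fun t => γ (c + ε * t)) (ε * deriv γ (c + ε * t)) t := by
  have h1 : HasDerivAt (fun t : ℝ => c + ε * t) ε t := by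
    simpa using ((hasDerivAt_id t).const_mul ε).const_add c
  exact ((h.differentiableAt _ ht).hasDerivAt.scomp t h1).congr_deriv (by simp)

theorem comp_affine (h : IsStokesCurveOn p J γ) (c : ℝ) {ε : ℝ} (hε : ε ^ 2 = 1) {J' : Set ℝ}
    (hJ : ∀ t ∈ J', c + ε * t ∈ J) : IsStokesCurveOn p J' (fun t => γ (c + ε * t)) where
  differentiableAt t ht := (h.deriv_comp_affine c ε (hJ t ht)).differentiableAt
  continuousOn_deriv := by
    have : ContinuousOn (fun t => (ε : ℂ) * deriv γ (c + ε * t)) J' :=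
      continuousOn_const.mul (h.continuousOn_deriv.comp (by fun_prop) hJ)
    exact this.congr fun t ht => (h.deriv_comp_affine c ε (hJ t ht)).deriv
  potential_mul_sq t ht := by
    rw [(h.deriv_comp_affine c ε (hJ t ht)).deriv, mul_pow, mul_left_comm,
      h.potential_mul_sq _ (hJ t ht)]
    have : (ε : ℂ) ^ 2 = 1 := by exact_mod_cast hε
    simp [this]

/-- In the arc length parametrisation the velocity itself supplies a continuous root of `V` along
the curve, with no choice of branch in the plane. -/
theorem root_sq (h : IsStokesCurveOn p J γ) {t : ℝ} (ht : t ∈ J) :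
    (Complex.I / deriv γ t) ^ 2 = cubicPotential p (γ t) := by
  have h1 := h.potential_mul_sq t ht
  have h2 := h.deriv_ne_zero ht
  rw [div_pow, div_eq_iff (pow_ne_zero 2 h2), h1, Complex.I_sq]

theorem root_continuousOn (h : IsStokesCurveOn p J γ) :
    ContinuousOn (fun t => Complex.I / deriv γ t) J :=
  continuousOn_const.div h.continuousOn_deriv fun _ ht => h.deriv_ne_zero ht

end IsStokesCurveOn

/-- A continuous square root of a differentiable function which does not vanish is
differentiable. -/
theorem HasDerivWithinAt.of_sq {F : ℝ → ℂ} {W : ℝ → ℂ} {W' : ℂ} {J : Set ℝ} {t : ℝ}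
    (ht : t ∈ J) (hF : ContinuousWithinAt F J t) (hsq : ∀ x ∈ J, F x ^ 2 = W x)
    (hne : F t ≠ 0) (hW : HasDerivWithinAt W W' J t) :
    HasDerivWithinAt F (W' / (2 * F t)) J t := by
  rw [hasDerivWithinAt_iff_tendsto_slope] at hW ⊢
  have hF' : Tendsto F (𝓝[J \ {t}] t) (𝓝 (F t)) := hF.mono_left (nhdsWithin_mono _ sdiff_subset)
  have h1 : Tendsto (fun x => slope W t x / (F x + F t)) (𝓝[J \ {t}] t)
      (𝓝 (W' / (2 * F t))) := by
    refine hW.div ?_ (by simpa using hne)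
    simpa [two_mul] using hF'.add_const (F t)
  have h2 : ∀ᶠ x in 𝓝[J \ {t}] t, F x + F t ≠ 0 := by
    have : Tendsto (fun x => F x + F t) (𝓝[J \ {t}] t) (𝓝 (2 * F t)) := by
      simpa [two_mul] using hF'.add_const (F t)
    exact this.eventually_ne (by simpa using hne)
  refine h1.congr' ?_
  filter_upwards [h2, self_mem_nhdsWithin] with x hx hxJ
  rw [slope_def_module, slope_def_module, ← hsq x hxJ.1, ← hsq t ht, smul_div_assoc]
  congr 1
  field_simp
  ring

/-- The velocity is only assumed continuous; its differentiability is gained because the square of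
`i / γ'` is `V(γ)`, which is differentiable. -/
theorem IsStokesCurveOn.root_hasDerivWithinAt {p : ℂ × ℂ} {J : Set ℝ} {γ : ℝ → ℂ}
    (h : IsStokesCurveOn p J γ) {t : ℝ} (ht : t ∈ J) :
    HasDerivWithinAt (fun t => Complex.I / deriv γ t)
      (cubicDeriv p (γ t) * deriv γ t / (2 * (Complex.I / deriv γ t))) J t := by
  refine HasDerivWithinAt.of_sq ht (h.root_continuousOn t ht) (fun x hx => h.root_sq hx)
    (div_ne_zero Complex.I_ne_zero (h.deriv_ne_zero ht)) ?_
  have := (hasDerivAt_cubicPotential p (γ t)).scomp t (h.differentiableAt t ht).hasDerivAt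
  exact (this.congr_deriv (by simp [mul_comm])).hasDerivWithinAt

/-- The vector field on the pairs `(γ, √V(γ))` whose integral curves are the Stokes curves. -/
def stokesField (p : ℂ × ℂ) (q : ℂ × ℂ) : ℂ × ℂ :=
  (Complex.I / q.2, cubicDeriv p q.1 * Complex.I / (2 * q.2 ^ 2))

theorem stokesField_locallyLipschitzOn (p : ℂ × ℂ) {s : Set (ℂ × ℂ)} (hs : ∀ q ∈ s, q.2 ≠ 0) :
    LocallyLipschitzOn s (stokesField p) := by
  intro q hq
  have : ContDiffAt ℂ 1 (stokesField p) q := by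
    unfold stokesField cubicDeriv
    have hq2 := hs q hq
    apply ContDiffAt.prodMk
    · exact contDiffAt_const.div contDiffAt_snd hq2
    · refine ContDiffAt.div ?_ ?_ (by simpa using hq2) <;> fun_prop
  obtain ⟨K, t, ht, hK⟩ := this.exists_lipschitzOnWith
  exact ⟨K, t, mem_nhdsWithin_of_mem_nhds ht, hK⟩

theorem IsStokesCurveOn.hasDerivWithinAt_field {p : ℂ × ℂ} {H : ℝ} {γ : ℝ → ℂ}
    (h : IsStokesCurveOn p (Icc 0 H) γ) {t : ℝ} (ht : t ∈ Ico 0 H) :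
    HasDerivWithinAt (fun t => (γ t, Complex.I / deriv γ t))
      (stokesField p (γ t, Complex.I / deriv γ t)) (Ici t) t := by
  have ht' := Ico_subset_Icc_self ht
  have hne := h.deriv_ne_zero ht'
  have h1 : HasDerivWithinAt γ (deriv γ t) (Icc 0 H) t :=
    (h.differentiableAt t ht').hasDerivAt.hasDerivWithinAt
  have h2 := h1.prodMk (h.root_hasDerivWithinAt ht')
  have h3 : HasDerivWithinAt (fun t => (γ t, Complex.I / deriv γ t))
      (deriv γ t, cubicDeriv p (γ t) * deriv γ t / (2 * (Complex.I / deriv γ t))) (Ici t) t := by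
    refine (h2.mono_of_mem_nhdsWithin ?_)
    exact mem_of_superset (Icc_mem_nhdsGE ht.2) (Icc_subset_Icc_left ht.1)
  convert h3 using 1
  unfold stokesField
  have hI := Complex.I_ne_zero
  ext1
  · simp
  · simp only
    field_simp

/-- Stokes curves are determined by their initial point and velocity. -/
theorem IsStokesCurveOn.eqOn_Icc {p : ℂ × ℂ} {H : ℝ} {α β : ℝ → ℂ}
    (hα : IsStokesCurveOn p (Icc 0 H) α) (hβ : IsStokesCurveOn p (Icc 0 H) β)
    (h0 : α 0 = β 0) (h1 : deriv α 0 = deriv β 0) : EqOn α β (Icc 0 H) := by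
  set A : ℝ → ℂ × ℂ := fun t => (α t, Complex.I / deriv α t) with hA
  set B : ℝ → ℂ × ℂ := fun t => (β t, Complex.I / deriv β t) with hB
  have cA : ContinuousOn A (Icc 0 H) := ContinuousOn.prodMk
    (fun t ht => (hα.differentiableAt t ht).continuousAt.continuousWithinAt) hα.root_continuousOn
  have cB : ContinuousOn B (Icc 0 H) := ContinuousOn.prodMk
    (fun t ht => (hβ.differentiableAt t ht).continuousAt.continuousWithinAt) hβ.root_continuousOn
  -- The two trajectories form a compact set on which the root does not vanish, so the locally
  -- Lipschitz field has a single Lipschitz constant there.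
  set s := A '' Icc 0 H ∪ B '' Icc 0 H with hs
  have hsc : IsCompact s := (isCompact_Icc.image_of_continuousOn cA).union
    (isCompact_Icc.image_of_continuousOn cB)
  have hs0 : ∀ q ∈ s, q.2 ≠ 0 := by
    rintro q (⟨t, ht, rfl⟩ | ⟨t, ht, rfl⟩)
    · exact div_ne_zero Complex.I_ne_zero (hα.deriv_ne_zero ht)
    · exact div_ne_zero Complex.I_ne_zero (hβ.deriv_ne_zero ht)
  obtain ⟨K, hK⟩ := (stokesField_locallyLipschitzOn p hs0).exists_lipschitzOnWith_of_compact hsc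
  have := ODE_solution_unique_of_mem_Icc_right (v := fun _ => stokesField p) (s := fun _ => s)
    (K := K) (f := A) (g := B) (a := 0) (b := H) (fun _ _ => hK) cA
    (fun t ht => hα.hasDerivWithinAt_field ht)
    (fun t ht => Or.inl (mem_image_of_mem _ (Ico_subset_Icc_self ht))) cB
    (fun t ht => hβ.hasDerivWithinAt_field ht)
    (fun t ht => Or.inr (mem_image_of_mem _ (Ico_subset_Icc_self ht)))
    (by simp [hA, hB, h0, h1])
  exact fun t ht => congrArg Prod.fst (this ht)

/-- Two Stokes curves with the same initial point and velocity have the same end point, even if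
that is a turning point. -/
theorem IsStokesCurveOn.eq_right {p : ℂ × ℂ} {H : ℝ} {α β : ℝ → ℂ} (hH : 0 < H)
    (hα : IsStokesCurveOn p (Ico 0 H) α) (hβ : IsStokesCurveOn p (Ico 0 H) β)
    (cα : ContinuousWithinAt α (Icc 0 H) H) (cβ : ContinuousWithinAt β (Icc 0 H) H)
    (h0 : α 0 = β 0) (h1 : deriv α 0 = deriv β 0) : α H = β H := by
  have hsub : Ico 0 H ⊆ Icc 0 H := Ico_subset_Icc_self
  have heq : EqOn α β (Ico 0 H) := fun t ht => by
    have hs : Icc 0 t ⊆ Ico 0 H := fun x hx => ⟨hx.1, hx.2.trans_lt ht.2⟩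
    exact (hα.mono hs).eqOn_Icc (hβ.mono hs) h0 h1 ⟨ht.1, le_rfl⟩
  have hne : (𝓝[Ico 0 H] H).NeBot := by
    rw [← mem_closure_iff_nhdsWithin_neBot, closure_Ico hH.ne]
    exact ⟨hH.le, le_rfl⟩
  refine tendsto_nhds_unique (cα.mono hsub) ((cβ.mono hsub).congr' ?_)
  filter_upwards [self_mem_nhdsWithin] with t ht using (heq ht).symm

/-- If two Stokes curves meet, then they coincide up to a shift and a reversal of time, up to
and including the first turning point. -/
theorem IsStokesCurveOn.exists_sign_of_meet {p : ℂ × ℂ} {J K : Set ℝ} {α β : ℝ → ℂ}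
    (hα : IsStokesCurveOn p J α) (hβ : IsStokesCurveOn p K β) {t s : ℝ} (ht : t ∈ J) (hs : s ∈ K)
    (hts : α t = β s) : ∃ ε : ℝ, (ε = 1 ∨ ε = -1) ∧ ∀ H : ℝ, 0 < H →
      (∀ h ∈ Ico 0 H, t + ε * h ∈ J) → (∀ h ∈ Ico 0 H, s + 1 * h ∈ K) →
      ContinuousWithinAt (fun h => α (t + ε * h)) (Icc 0 H) H →
      ContinuousWithinAt (fun h => β (s + 1 * h)) (Icc 0 H) H →
      α (t + ε * H) = β (s + H) := by
  -- At a common point both velocities are square roots of `-1 / V`, so they agree up to the sign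
  -- `ε`.
  have hsq : deriv α t ^ 2 = deriv β s ^ 2 := by
    have h1 := hα.potential_mul_sq t ht
    have h2 := hβ.potential_mul_sq s hs
    rw [← hts] at h2
    exact mul_left_cancel₀ (hα.potential_ne_zero ht) (h1.trans h2.symm)
  obtain ⟨ε, hε, hd⟩ : ∃ ε : ℝ, (ε = 1 ∨ ε = -1) ∧ ε * deriv α t = deriv β s := by
    rcases sq_eq_sq_iff_eq_or_eq_neg.1 hsq with h | h
    · exact ⟨1, Or.inl rfl, by simp [h]⟩
    · exact ⟨-1, Or.inr rfl, by simp [h]⟩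
  refine ⟨ε, hε, fun H hH hJ hK cα cβ => ?_⟩
  have hε2 : ε ^ 2 = 1 := by rcases hε with rfl | rfl <;> norm_num
  have ht0 : t + ε * 0 ∈ J := by simpa using ht
  have hs0 : s + 1 * 0 ∈ K := by simpa using hs
  have := (hα.comp_affine t hε2 hJ).eq_right hH (hβ.comp_affine s (by norm_num) hK) cα cβ
    (by simpa using hts)
    (by rw [(hα.deriv_comp_affine t ε ht0).deriv, (hβ.deriv_comp_affine s 1 hs0).deriv]
        simpa using hd)
  simpa using this

/-! ### Stokes lines do not cross. -/

/-- An internal Stokes line does not meet an external one, except perhaps at its end points. -/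
theorem IsInternalStokesLine.ne_external {p : ℂ × ℂ} {z w z' : ℂ} {T θ : ℝ} {γ ρ : ℝ → ℂ}
    (hγ : IsInternalStokesLine p z w T γ) (hρ : IsExternalStokesLine p z' θ ρ)
    (hz : cubicPotential p z = 0) (hw : cubicPotential p w = 0) (hz' : cubicPotential p z' = 0)
    {t s : ℝ} (ht : t ∈ Ioo 0 T) (hs : s ∈ Ici 0) : γ t ≠ ρ s := by
  intro hts
  have hs0 : 0 < s := by
    refine lt_of_le_of_ne hs fun h => ?_
    apply hγ.stokes.potential_ne_zero ht
    rw [hts, ← h, hρ.source, hz']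
  obtain ⟨ε, hε, h⟩ := hγ.stokes.exists_sign_of_meet hρ.stokes ht (mem_Ioi.2 hs0) hts
  have cρ : ∀ H : ℝ, 0 < H → ContinuousWithinAt (fun h => ρ (s + 1 * h)) (Icc 0 H) H := by
    intro H hH
    have h1 : ContinuousAt ρ (s + 1 * H) :=
      (hρ.stokes.differentiableAt _ (mem_Ioi.2 (by linarith))).continuousAt
    exact (ContinuousAt.comp (f := fun h => s + 1 * h) h1 (by fun_prop)).continuousWithinAt
  have cγ : ∀ H : ℝ, (∀ x ∈ Icc 0 H, t + ε * x ∈ Icc 0 T) → 0 < H →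
      ContinuousWithinAt (fun h => γ (t + ε * h)) (Icc 0 H) H := by
    intro H hH h0
    exact (hγ.continuousOn.comp (by fun_prop) hH) H ⟨h0.le, le_rfl⟩
  have key : ∀ H : ℝ, 0 < H → cubicPotential p (ρ (s + H)) ≠ 0 := fun H hH =>
    hρ.stokes.potential_ne_zero (mem_Ioi.2 (by linarith))
  obtain ⟨t0, tT⟩ := ht
  rcases hε with rfl | rfl
  -- Follow the external line outwards, where it meets no turning point; the internal one, run in
  -- either direction, reaches a turning point in finite time.
  · have := h (T - t) (by linarith) (fun x hx => ⟨by linarith [hx.1], by linarith [hx.2]⟩)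
      (fun x hx => mem_Ioi.2 (by linarith [hx.1]))
      (cγ _ (fun x hx => ⟨by linarith [hx.1], by linarith [hx.2]⟩) (by linarith))
      (cρ _ (by linarith))
    rw [show t + 1 * (T - t) = T by ring, hγ.target] at this
    exact key (T - t) (by linarith) (this ▸ hw)
  · have := h t (by linarith) (fun x hx => ⟨by linarith [hx.2], by linarith [hx.1]⟩)
      (fun x hx => mem_Ioi.2 (by linarith [hx.1]))
      (cγ _ (fun x hx => ⟨by linarith [hx.2], by linarith [hx.1]⟩) (by linarith))
      (cρ _ (by linarith))
    rw [show t + -1 * t = 0 by ring, hγ.source] at this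
    exact key t (by linarith) (this ▸ hz)

/-- Two internal Stokes lines which join a turning point to two others do not cross. -/
theorem IsInternalStokesLine.ne_internal {p : ℂ × ℂ} {z w w' : ℂ} {T T' : ℝ} {γ ρ : ℝ → ℂ}
    (hγ : IsInternalStokesLine p z w T γ) (hρ : IsInternalStokesLine p z w' T' ρ)
    (hz : cubicPotential p z = 0) (hw : cubicPotential p w = 0) (hw' : cubicPotential p w' = 0)
    (hzw' : z ≠ w') (hww' : w ≠ w') {t s : ℝ} (ht : t ∈ Ioo 0 T) (hs : s ∈ Ioo 0 T') :
    γ t ≠ ρ s := by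
  intro hts
  obtain ⟨ε, hε, h⟩ := hγ.stokes.exists_sign_of_meet hρ.stokes ht hs hts
  have cρ : ∀ H : ℝ, (∀ x ∈ Icc 0 H, s + 1 * x ∈ Icc 0 T') → 0 < H →
      ContinuousWithinAt (fun h => ρ (s + 1 * h)) (Icc 0 H) H := by
    intro H hH h0
    exact (hρ.continuousOn.comp (by fun_prop) hH) H ⟨h0.le, le_rfl⟩
  have cγ : ∀ H : ℝ, (∀ x ∈ Icc 0 H, t + ε * x ∈ Icc 0 T) → 0 < H →
      ContinuousWithinAt (fun h => γ (t + ε * h)) (Icc 0 H) H := by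
    intro H hH h0
    exact (hγ.continuousOn.comp (by fun_prop) hH) H ⟨h0.le, le_rfl⟩
  have nγ : ∀ t ∈ Ioo 0 T, cubicPotential p (γ t) ≠ 0 := fun t => hγ.stokes.potential_ne_zero
  have nρ : ∀ t ∈ Ioo 0 T', cubicPotential p (ρ t) ≠ 0 := fun t => hρ.stokes.potential_ne_zero
  obtain ⟨t0, tT⟩ := ht
  obtain ⟨s0, sT⟩ := hs
  rcases hε with rfl | rfl
  -- `H` is the first time at which one of the curves ends. Both must end then, since an interior
  -- point is never a turning point; their ends would coincide.
  · set H := min (T - t) (T' - s) with hH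
    have hH0 : 0 < H := lt_min (by linarith) (by linarith)
    have h1 : H ≤ T - t := min_le_left _ _
    have h2 : H ≤ T' - s := min_le_right _ _
    have := h H hH0 (fun x hx => ⟨by linarith [hx.1], by linarith [hx.2]⟩)
      (fun x hx => ⟨by linarith [hx.1], by linarith [hx.2]⟩)
      (cγ _ (fun x hx => ⟨by linarith [hx.1], by linarith [hx.2]⟩) hH0)
      (cρ _ (fun x hx => ⟨by linarith [hx.1], by linarith [hx.2]⟩) hH0)
    rcases h1.lt_or_eq with h3 | h3 <;> rcases h2.lt_or_eq with h4 | h4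
    · rcases min_choice (T - t) (T' - s) with h5 | h5 <;> linarith
    · refine nγ (t + 1 * H) ⟨by linarith, by linarith⟩ ?_
      rw [this, h4, show s + (T' - s) = T' by ring, hρ.target, hw']
    · refine nρ (s + H) ⟨by linarith, by linarith⟩ ?_
      rw [← this, h3, show t + 1 * (T - t) = T by ring, hγ.target, hw]
    · rw [h4, show s + (T' - s) = T' by ring, hρ.target, ← h4, h3,
        show t + 1 * (T - t) = T by ring, hγ.target] at this
      exact hww' this
  · set H := min t (T' - s) with hH
    have hH0 : 0 < H := lt_min (by linarith) (by linarith)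
    have h1 : H ≤ t := min_le_left _ _
    have h2 : H ≤ T' - s := min_le_right _ _
    have := h H hH0 (fun x hx => ⟨by linarith [hx.2], by linarith [hx.1]⟩)
      (fun x hx => ⟨by linarith [hx.1], by linarith [hx.2]⟩)
      (cγ _ (fun x hx => ⟨by linarith [hx.2], by linarith [hx.1]⟩) hH0)
      (cρ _ (fun x hx => ⟨by linarith [hx.1], by linarith [hx.2]⟩) hH0)
    rcases h1.lt_or_eq with h3 | h3 <;> rcases h2.lt_or_eq with h4 | h4
    · rcases min_choice t (T' - s) with h5 | h5 <;> linarith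
    · refine nγ (t + -1 * H) ⟨by linarith, by linarith⟩ ?_
      rw [this, h4, show s + (T' - s) = T' by ring, hρ.target, hw']
    · refine nρ (s + H) ⟨by linarith, by linarith⟩ ?_
      rw [← this, h3, show t + -1 * t = 0 by ring, hγ.source, hz]
    · rw [h4, show s + (T' - s) = T' by ring, hρ.target, ← h4, h3,
        show t + -1 * t = 0 by ring, hγ.source] at this
      exact hzw' this

/-! ### Stokes lines near a simple turning point. -/

/-- The quotient `(V(x) - V(z)) / (x - z)`. -/
def cubicQuot (p : ℂ × ℂ) (z x : ℂ) : ℂ := 4 * (x ^ 2 + x * z + z ^ 2) - 2 * p.1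

theorem cubicPotential_eq_mul_quot {p : ℂ × ℂ} {z : ℂ} (hz : cubicPotential p z = 0) (x : ℂ) :
    cubicPotential p x = (x - z) * cubicQuot p z x := by
  unfold cubicPotential cubicQuot at *
  linear_combination hz

theorem cubicQuot_self (p : ℂ × ℂ) (z : ℂ) : cubicQuot p z z = cubicDeriv p z := by
  unfold cubicQuot cubicDeriv; ring

theorem continuous_cubicQuot (p : ℂ × ℂ) (z : ℂ) : Continuous (cubicQuot p z) := by
  unfold cubicQuot; fun_prop

section Asymptotics

variable {p : ℂ × ℂ} {z : ℂ} {T : ℝ} {γ : ℝ → ℂ}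

/-- The derivative of `(γ - z) √V(γ)` is `i (1 + V'(γ) / (2 Q(γ)))` with `Q = V / (x - z)`, and
`Q(z) = V'(z)`; so it tends to `3i/2` and the product is asymptotic to `3it/2`. -/
theorem IsStokesCurveOn.tendsto_sub_mul_root (hT : 0 < T) (h : IsStokesCurveOn p (Ioo 0 T) γ)
    (h0 : γ 0 = z) (hc : Tendsto γ (𝓝[>] 0) (𝓝 z)) (hz : cubicPotential p z = 0)
    (hz' : cubicDeriv p z ≠ 0) :
    Tendsto (fun t : ℝ => (γ t - z) * (Complex.I / deriv γ t) / t) (𝓝[>] 0)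
      (𝓝 (3 / 2 * Complex.I)) := by
  have hI := Complex.I_ne_zero
  set ρ : ℝ → ℂ := fun t => (γ t - z) * (Complex.I / deriv γ t) with hρ
  have hmem : Ioo 0 T ∈ 𝓝[>] (0 : ℝ) := Ioo_mem_nhdsGT hT
  have hder : ∀ t ∈ Ioo 0 T, HasDerivAt ρ
      (Complex.I * (1 + cubicDeriv p (γ t) / (2 * cubicQuot p z (γ t)))) t := by
    intro t ht
    have h1 := (h.differentiableAt t ht).hasDerivAt.sub_const z
    have h2 := (h.root_hasDerivWithinAt ht).hasDerivAt (Ioo_mem_nhds ht.1 ht.2)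
    have hd := h.deriv_ne_zero ht
    have hV := h.potential_ne_zero ht
    have hsq := h.potential_mul_sq t ht
    rw [cubicPotential_eq_mul_quot hz] at hV hsq
    refine (h1.mul h2).congr_deriv ?_
    have hq := right_ne_zero_of_mul hV
    field_simp
    linear_combination (cubicDeriv p (γ t)) * hsq - (cubicDeriv p (γ t)) * Complex.I_sq
  have hq : Tendsto (fun t => cubicQuot p z (γ t)) (𝓝[>] 0) (𝓝 (cubicDeriv p z)) := by
    rw [← cubicQuot_self]
    exact ((continuous_cubicQuot p z).tendsto z).comp hc
  have hlim : Tendsto (deriv ρ) (𝓝[>] 0) (𝓝 (3 / 2 * Complex.I)) := by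
    have h1 : Tendsto (fun t => Complex.I * (1 + cubicDeriv p (γ t) / (2 * cubicQuot p z (γ t))))
        (𝓝[>] 0) (𝓝 (Complex.I * (1 + cubicDeriv p z / (2 * cubicDeriv p z)))) := by
      refine (((((continuous_cubicDeriv p).tendsto z).comp hc).div (hq.const_mul 2)
        (by simpa using hz')).const_add 1).const_mul _
    have h2 : Complex.I * (1 + cubicDeriv p z / (2 * cubicDeriv p z)) = 3 / 2 * Complex.I := by
      field_simp; ring
    rw [h2] at h1
    refine h1.congr' ?_
    filter_upwards [hmem] with t ht using (hder t ht).deriv.symm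
  have hρ0 : ρ 0 = 0 := by simp [hρ, h0]
  -- The root has no prescribed value at `0`; continuity follows from `ρ² = (γ - z)² V(γ) → 0`.
  have hcont : ContinuousWithinAt ρ (Ioo 0 T) 0 := by
    have hle : 𝓝[Ioo 0 T] (0 : ℝ) ≤ 𝓝[>] 0 := nhdsWithin_mono _ Ioo_subset_Ioi_self
    have h1 : Tendsto (fun t => ρ t ^ 2) (𝓝[>] 0) (𝓝 0) := by
      have : Tendsto (fun t => (γ t - z) ^ 2 * cubicPotential p (γ t)) (𝓝[>] 0)
          (𝓝 ((z - z) ^ 2 * cubicPotential p z)) :=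
        ((hc.sub_const z).pow 2).mul (((continuous_cubicPotential p).tendsto z).comp hc)
      rw [hz, mul_zero] at this
      refine this.congr' ?_
      filter_upwards [hmem] with t ht
      rw [hρ]
      simp only
      rw [mul_pow, h.root_sq ht]
    have h2 : Tendsto (fun t => ‖ρ t‖) (𝓝[>] 0) (𝓝 0) := by
      have := (h1.norm).sqrt
      simpa using this
    rw [ContinuousWithinAt, hρ0]
    exact (tendsto_zero_iff_norm_tendsto_zero.2 h2).mono_left hle
  have := hasDerivWithinAt_Ici_of_tendsto_deriv
    (fun t ht => (hder t ht).differentiableAt.differentiableWithinAt) hcont hmem hlim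
  have h3 := (hasDerivWithinAt_iff_tendsto_slope.1 this)
  rw [Ici_sdiff_left] at h3
  refine h3.congr fun t => ?_
  rw [slope_def_module, hρ0]
  simp [hρ, div_eq_inv_mul]

/-- Square the preceding asymptotics: `((γ - z) √V)² = (γ - z)³ Q`, and `Q → V'(z)`. Hence `γ - z`
has size `t^{2/3}`. -/
theorem IsStokesCurveOn.tendsto_cube (hT : 0 < T) (h : IsStokesCurveOn p (Ioo 0 T) γ)
    (h0 : γ 0 = z) (hc : Tendsto γ (𝓝[>] 0) (𝓝 z)) (hz : cubicPotential p z = 0)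
    (hz' : cubicDeriv p z ≠ 0) :
    Tendsto (fun t : ℝ => (γ t - z) ^ 3 / (t : ℂ) ^ 2) (𝓝[>] 0)
      (𝓝 (-9 / (4 * cubicDeriv p z))) := by
  have h1 := (h.tendsto_sub_mul_root hT h0 hc hz hz').pow 2
  have hq : Tendsto (fun t => cubicQuot p z (γ t)) (𝓝[>] 0) (𝓝 (cubicDeriv p z)) := by
    rw [← cubicQuot_self]
    exact ((continuous_cubicQuot p z).tendsto z).comp hc
  have h2 := h1.div hq hz'
  have h3 : (3 / 2 * Complex.I) ^ 2 / cubicDeriv p z = -9 / (4 * cubicDeriv p z) := by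
    rw [mul_pow, Complex.I_sq]; field_simp; norm_num
  rw [h3] at h2
  refine h2.congr' ?_
  filter_upwards [Ioo_mem_nhdsGT hT] with t ht
  have hV := h.potential_ne_zero ht
  have hsq := h.root_sq ht
  simp only [Pi.div_apply, div_pow, mul_pow] at hsq ⊢
  rw [hsq]
  rw [cubicPotential_eq_mul_quot hz] at hV ⊢
  have hq := right_ne_zero_of_mul hV
  field_simp

/-- Near the turning point `|V(γ)|` is bounded below by a multiple of `|γ - z|`, which has size
`t^{2/3}`, and `t^{-2/3}` is integrable at `0`. -/
theorem IsStokesCurveOn.intervalIntegrable_inv_left (h : IsStokesCurveOn p (Ioo 0 T) γ)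
    (h0 : γ 0 = z) (hc : Tendsto γ (𝓝[>] 0) (𝓝 z)) (hz : cubicPotential p z = 0)
    (hz' : cubicDeriv p z ≠ 0) {δ : ℝ} (hδ : δ ∈ Ioo 0 T) :
    IntervalIntegrable (fun t => (cubicPotential p (γ t))⁻¹) MeasureTheory.volume 0 δ := by
  have hT := hδ.1.trans hδ.2
  have hcont : ContinuousOn (fun t => (cubicPotential p (γ t))⁻¹) (Ioo 0 T) := by
    refine ContinuousOn.inv₀ ?_ fun t ht => h.potential_ne_zero ht
    exact (continuous_cubicPotential p).comp_continuousOn fun t ht =>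
      (h.differentiableAt t ht).continuousAt.continuousWithinAt
  have hlim := (h.tendsto_cube hT h0 hc hz hz').norm
  have hq : Tendsto (fun t => ‖cubicQuot p z (γ t)‖) (𝓝[>] 0) (𝓝 ‖cubicDeriv p z‖) := by
    rw [← cubicQuot_self]
    exact (((continuous_cubicQuot p z).tendsto z).comp hc).norm
  set A := ‖-9 / (4 * cubicDeriv p z)‖ with hA
  have hA0 : 0 < A := by
    rw [hA, norm_pos_iff]; exact div_ne_zero (by norm_num) (by simpa using hz')
  have hB0 : 0 < ‖cubicDeriv p z‖ := norm_pos_iff.2 hz'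
  -- Halving the limit `A` leaves room for the eventual bound `|γ - z|³ ≥ (A/2) t²`; `c` is its cube
  -- root.
  set c := (A / 2) ^ (1 / 3 : ℝ) with hc'
  have hc0 : 0 < c := Real.rpow_pos_of_pos (by positivity) _
  have hev : ∀ᶠ t : ℝ in 𝓝[>] 0, ‖(cubicPotential p (γ t))⁻¹‖ ≤
      (c * (‖cubicDeriv p z‖ / 2))⁻¹ * t ^ (-(2 / 3) : ℝ) := by
    filter_upwards [hlim.eventually (lt_mem_nhds (half_lt_self hA0)),
      hq.eventually (lt_mem_nhds (half_lt_self hB0)), Ioo_mem_nhdsGT hT] with t h1 h2 ht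
    have ht0 := ht.1
    have h3 : A / 2 * t ^ 2 ≤ ‖γ t - z‖ ^ 3 := by
      rw [norm_div, norm_pow, norm_pow, Complex.norm_real, Real.norm_of_nonneg ht0.le,
        lt_div_iff₀ (by positivity)] at h1
      exact h1.le
    have h4 : c * t ^ (2 / 3 : ℝ) ≤ ‖γ t - z‖ := by
      have h5 := Real.rpow_le_rpow (by positivity) h3 (show (0 : ℝ) ≤ 1 / 3 by norm_num)
      rw [Real.mul_rpow (by positivity) (by positivity), ← Real.rpow_natCast, ← Real.rpow_natCast,
        ← Real.rpow_mul ht0.le, ← Real.rpow_mul (norm_nonneg _)] at h5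
      norm_num at h5
      simpa [hc'] using h5
    rw [norm_inv, Real.rpow_neg ht0.le, ← mul_inv, cubicPotential_eq_mul_quot hz, norm_mul]
    have h6 : 0 < t ^ (2 / 3 : ℝ) := Real.rpow_pos_of_pos ht0 _
    apply inv_anti₀ (by positivity)
    calc c * (‖cubicDeriv p z‖ / 2) * t ^ (2 / 3 : ℝ)
        = (c * t ^ (2 / 3 : ℝ)) * (‖cubicDeriv p z‖ / 2) := by ring
      _ ≤ ‖γ t - z‖ * ‖cubicQuot p z (γ t)‖ := by gcongr
  obtain ⟨ε, hε, hb⟩ := mem_nhdsGT_iff_exists_Ioo_subset.1 hev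
  set η := min (ε / 2) δ with hη
  have hε' : 0 < ε := hε
  have hη0 : 0 < η := lt_min (by linarith) hδ.1
  have hηε : η < ε := (min_le_left _ _).trans_lt (by linarith)
  have hηδ : η ≤ δ := min_le_right _ _
  have i1 : IntervalIntegrable (fun t => (cubicPotential p (γ t))⁻¹) MeasureTheory.volume 0 η := by
    have hg := (intervalIntegral.intervalIntegrable_rpow' (a := 0) (b := η)
      (r := -(2 / 3)) (by norm_num)).const_mul (c * (‖cubicDeriv p z‖ / 2))⁻¹
    refine hg.mono_fun' ?_ ?_
    · rw [uIoc_of_le hη0.le]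
      exact (hcont.mono fun t ht => ⟨ht.1, by linarith [ht.2, hδ.2]⟩).aestronglyMeasurable
        measurableSet_Ioc
    · rw [uIoc_of_le hη0.le]
      refine (MeasureTheory.ae_restrict_iff' measurableSet_Ioc).2 (Eventually.of_forall ?_)
      intro t ht
      exact hb ⟨ht.1, by linarith [ht.2]⟩
  refine i1.trans (ContinuousOn.intervalIntegrable ?_)
  rw [uIcc_of_le hηδ]
  exact hcont.mono fun t ht => ⟨by linarith [ht.1], by linarith [ht.2, hδ.2]⟩

/-- The estimate at the initial point, applied to the line and to its reversal, covers the two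
halves of the interval. -/
theorem IsInternalStokesLine.intervalIntegrable_inv {w : ℂ}
    (h : IsInternalStokesLine p z w T γ) (hz : cubicPotential p z = 0)
    (hz' : cubicDeriv p z ≠ 0) (hw : cubicPotential p w = 0) (hw' : cubicDeriv p w ≠ 0) :
    IntervalIntegrable (fun t => (cubicPotential p (γ t))⁻¹) MeasureTheory.volume 0 T := by
  have hT := h.length_pos
  have hmid : T / 2 ∈ Ioo 0 T := ⟨by linarith, by linarith⟩
  have h1 : Tendsto γ (𝓝[>] 0) (𝓝 z) := by
    have := (h.continuousOn 0 ⟨le_rfl, hT.le⟩)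
    rw [← h.source, ← nhdsWithin_Ioo_eq_nhdsGT hT]
    exact this.mono Ioo_subset_Icc_self
  have h2 : Tendsto (fun t => γ (T + (-1) * t)) (𝓝[>] 0) (𝓝 w) := by
    have := (h.continuousOn.comp (f := fun t => T + (-1) * t) (s := Icc 0 T) (by fun_prop)
      (fun t ht => ⟨by linarith [ht.2], by linarith [ht.1]⟩)) 0 ⟨le_rfl, hT.le⟩
    rw [ContinuousWithinAt] at this
    simp only [Function.comp_apply, mul_zero, add_zero, h.target] at this
    rw [← nhdsWithin_Ioo_eq_nhdsGT hT]
    exact this.mono_left (nhdsWithin_mono _ Ioo_subset_Icc_self)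
  have i1 := h.stokes.intervalIntegrable_inv_left h.source h1 hz hz' hmid
  have i2 := (h.stokes.comp_affine T (ε := -1) (by norm_num) (J' := Ioo 0 T)
    (fun t ht => ⟨by linarith [ht.2], by linarith [ht.1]⟩)).intervalIntegrable_inv_left
    (by simp [h.target]) h2 hw hw' hmid
  have i3 := i2.comp_sub_left T
  refine i1.trans (IntervalIntegrable.symm ?_)
  convert! i3 using 1
  · ext t; simp
  · ring
  · ring

end Asymptotics

/-! ### Square roots, cube roots and sector estimates. -/

theorem Complex.sqrt_sq (w : ℂ) : (w ^ (1 / 2 : ℂ)) ^ 2 = w := by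
  rw [← Complex.cpow_nat_mul]
  norm_num

theorem Complex.re_sqrt_pos {v : ℂ} (hv : v ∈ Complex.slitPlane) : 0 < (v ^ (1 / 2 : ℂ)).re := by
  have h := Complex.mem_slitPlane_iff_arg.1 hv
  rw [Complex.cpow_def_of_ne_zero h.2, Complex.exp_re]
  refine mul_pos (Real.exp_pos _) (Real.cos_pos_of_mem_Ioo ?_)
  have h1 : (Complex.log v * (1 / 2 : ℂ)).im = Complex.arg v / 2 := by
    rw [show (1 / 2 : ℂ) = ((1 / 2 : ℝ) : ℂ) by push_cast; rfl, Complex.im_mul_ofReal,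
      Complex.log_im]
    ring
  rw [h1]
  have h2 := Complex.neg_pi_lt_arg v
  have h3 := lt_of_le_of_ne (Complex.arg_le_pi v) h.1
  constructor <;> linarith

theorem Complex.sqrt_eq_of_sq_eq {v w : ℂ} (hw : w ^ 2 = v) (hre : 0 < w.re) :
    v ^ (1 / 2 : ℂ) = w := by
  have hv : v ∈ Complex.slitPlane := by
    rw [← hw, Complex.mem_slitPlane_iff, sq, Complex.mul_re, Complex.mul_im]
    by_cases h : w.im = 0
    · left; rw [h]; nlinarith
    · right
      have := mul_ne_zero hre.ne' h
      intro h0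
      apply this
      linarith
  rcases sq_eq_sq_iff_eq_or_eq_neg.1 ((Complex.sqrt_sq v).trans hw.symm) with h | h
  · exact h
  · have := Complex.re_sqrt_pos hv
    rw [h, Complex.neg_re] at this
    linarith

/-- A continuous function whose cube converges to a nonzero number converges. -/
theorem exists_tendsto_of_tendsto_cube {u : ℝ → ℂ} {c : ℂ} {T : ℝ} (hT : 0 < T)
    (hu : ContinuousOn u (Ioo 0 T)) (hc : c ≠ 0)
    (h : Tendsto (fun t => u t ^ 3) (𝓝[>] 0) (𝓝 c)) :
    ∃ d, d ≠ 0 ∧ Tendsto u (𝓝[>] 0) (𝓝 d) := by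
  obtain ⟨d, hd⟩ : ∃ d : ℂ, d ^ 3 = c := IsAlgClosed.exists_pow_nat_eq c (by norm_num)
  have hd0 : d ≠ 0 := by rintro rfl; simp at hd; exact hc hd.symm
  have hcube : ∀ w : ℂ, (w ^ (1 / 3 : ℂ)) ^ 3 = w := fun w => by
    rw [← Complex.cpow_nat_mul]; norm_num
  have h1 : Tendsto (fun t => u t ^ 3 / c) (𝓝[>] 0) (𝓝 1) := by
    simpa [hc] using h.div_const c
  have hone : (1 : ℂ) ∈ Complex.slitPlane := by simp
  have hev := h1.eventually (Complex.isOpen_slitPlane.mem_nhds hone)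
  obtain ⟨δ, hδ, hb⟩ := mem_nhdsGT_iff_exists_Ioo_subset.1 (inter_mem hev (Ioo_mem_nhdsGT hT))
  have hδ' : (0 : ℝ) < δ := hδ
  set v : ℝ → ℂ := fun t => (u t ^ 3 / c) ^ (1 / 3 : ℂ) with hv
  have hv1 : Tendsto v (𝓝[>] 0) (𝓝 1) := by
    have := (continuousAt_cpow_const (b := 1 / 3) hone).tendsto.comp h1
    rw [Complex.one_cpow] at this
    exact this
  have hv0 : ∀ t ∈ Ioo 0 δ, v t ≠ 0 := fun t ht h0 => by
    have h2 := hcube (u t ^ 3 / c)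
    have h3 : v t = 0 := h0
    rw [hv] at h3
    simp only at h3
    rw [h3] at h2
    exact Complex.slitPlane_ne_zero (hb ht).1 (by rw [← h2]; simp)
  have hvc : ContinuousOn v (Ioo 0 δ) := by
    refine ContinuousOn.cpow_const (((hu.mono fun t ht => (hb ht).2).pow 3).div_const c)
      fun t ht => (hb ht).1
  have hq3 : ∀ t ∈ Ioo 0 δ, (u t / (d * v t)) ^ 3 = 1 := fun t ht => by
    have h0 := hv0 t ht
    rw [div_pow, mul_pow, hd, hcube, mul_div_cancel₀ _ hc, div_self]
    intro h3
    have := Complex.slitPlane_ne_zero (hb ht).1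
    simp [h3] at this
  have hfin : {x : ℂ | x ^ 3 = 1}.Finite := by
    have : {x : ℂ | x ^ 3 = 1} ⊆ ((Polynomial.nthRoots 3 (1 : ℂ)).toFinset : Set ℂ) := by
      intro x hx
      simpa [Polynomial.mem_nthRoots] using hx
    exact (Finset.finite_toSet _).subset this
  -- The quotient of `u` by an explicit continuous cube root takes values in the finite set of cube
  -- roots of unity, so it is constant on the interval.
  have hconst : ∀ t ∈ Ioo 0 δ, u t / (d * v t) = u (δ / 2) / (d * v (δ / 2)) := fun t ht =>
    isPreconnected_Ioo.constant_of_mapsTo (T := {x : ℂ | x ^ 3 = 1}) hfin.isDiscrete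
      ((hu.mono fun t ht => (hb ht).2).div (continuousOn_const.mul hvc)
        fun t ht => mul_ne_zero hd0 (hv0 t ht))
      (fun t ht => hq3 t ht) ht ⟨by linarith, by linarith⟩
  set q := u (δ / 2) / (d * v (δ / 2)) with hq
  have hq0 : q ≠ 0 := by
    have := hq3 (δ / 2) ⟨by linarith, by linarith⟩
    rw [← hq] at this
    rintro h0
    simp [h0] at this
  refine ⟨q * d, mul_ne_zero hq0 hd0, ?_⟩
  have := (hv1.const_mul (q * d))
  rw [mul_one] at this
  refine this.congr' ?_
  filter_upwards [Ioo_mem_nhdsGT hδ'] with t ht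
  rw [← hconst t ht]
  have := hv0 t ht
  field_simp

/-- A curve starting at a turning point along a Stokes line has a tangent there. -/
theorem IsStokesCurveOn.exists_direction {p : ℂ × ℂ} {z : ℂ} {T : ℝ} {γ : ℝ → ℂ} (hT : 0 < T)
    (h : IsStokesCurveOn p (Ioo 0 T) γ)
    (h0 : γ 0 = z) (hc : Tendsto γ (𝓝[>] 0) (𝓝 z)) (hz : cubicPotential p z = 0)
    (hz' : cubicDeriv p z ≠ 0) :
    ∃ d, d ≠ 0 ∧ Tendsto (fun t : ℝ => (γ t - z) / ((t ^ (2 / 3 : ℝ) : ℝ) : ℂ)) (𝓝[>] 0)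
      (𝓝 d) := by
  refine exists_tendsto_of_tendsto_cube hT ?_ (c := -9 / (4 * cubicDeriv p z))
    (div_ne_zero (by norm_num) (by simpa using hz')) ?_
  · refine ContinuousOn.div ?_ ?_ ?_
    · exact fun t ht =>
        ((h.differentiableAt t ht).continuousAt.sub continuousAt_const).continuousWithinAt
    · refine Complex.continuous_ofReal.comp_continuousOn fun t ht => ?_
      exact (Real.continuousAt_rpow_const t _ (Or.inl ht.1.ne')).continuousWithinAt
    · intro t ht
      exact_mod_cast (Real.rpow_pos_of_pos ht.1 _).ne'
  · refine (h.tendsto_cube hT h0 hc hz hz').congr' ?_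
    filter_upwards [self_mem_nhdsWithin] with t ht
    have ht' : (0 : ℝ) < t := ht
    rw [div_pow, ← Complex.ofReal_pow, ← Complex.ofReal_pow, ← Real.rpow_natCast,
      ← Real.rpow_natCast, ← Real.rpow_mul ht'.le]
    norm_num

theorem exists_le_norm_sub {γ : ℝ → ℂ} {a : ℝ} (hγ : ContinuousOn γ (Ici a))
    (hinf : Tendsto (fun t => ‖γ t‖) atTop atTop) {c : ℂ} (hc : ∀ t ∈ Ici a, γ t ≠ c) :
    ∃ ε > 0, ∀ t ∈ Ici a, ε ≤ ‖γ t - c‖ := by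
  obtain ⟨M, hM⟩ := eventually_atTop.1 (hinf.eventually_ge_atTop (‖c‖ + 1))
  have hcont : ContinuousOn (fun t => ‖γ t - c‖) (Icc a (max a M)) :=
    ((hγ.mono Icc_subset_Ici_self).sub continuousOn_const).norm
  obtain ⟨x, hx, hmin⟩ := isCompact_Icc.exists_isMinOn (nonempty_Icc.2 (le_max_left a M)) hcont
  refine ⟨min ‖γ x - c‖ 1, lt_min (norm_pos_iff.2 (sub_ne_zero.2 (hc x hx.1))) one_pos, ?_⟩
  intro t ht
  rcases le_or_gt t (max a M) with h | h
  · exact (min_le_left _ _).trans (hmin ⟨ht, h⟩)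
  · have h1 := hM t ((le_max_right a M).trans h.le)
    have h2 := norm_sub_norm_le (γ t) c
    exact (min_le_right _ _).trans (by linarith)

/-- If `q` stays in a sector of the lower half plane, so does its product with a number close
to `1`. -/
theorem im_mul_le_of_norm_sub_one_le {q ρ : ℂ} {c : ℝ} (hc : 0 < c) (hc1 : c ≤ 1)
    (hq : q.im ≤ -c * ‖q‖) (hρ : ‖ρ - 1‖ ≤ c / 2) : (ρ * q).im ≤ -(c / 4) * ‖ρ * q‖ := by
  have h1 : (ρ * q).im = q.im + ((ρ - 1) * q).im := by
    rw [← Complex.add_im]; congr 1; ring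
  have h2 : ((ρ - 1) * q).im ≤ c / 2 * ‖q‖ := by
    refine (Complex.abs_im_le_norm _).trans' (le_abs_self _) |>.trans ?_
    rw [norm_mul]
    gcongr
  have h3 : ‖ρ‖ ≤ 2 := by
    have := norm_add_le (ρ - 1) 1
    simp only [sub_add_cancel, norm_one] at this
    linarith
  have h4 : ‖ρ * q‖ ≤ 2 * ‖q‖ := by
    rw [norm_mul]; gcongr
  rw [h1]
  nlinarith [norm_nonneg q]

theorem norm_div_sub_one_le {a b : ℂ} {η : ℝ} (hη : η ≤ 1 / 2) (ha : ‖a - 1‖ ≤ η)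
    (hb : ‖b - 1‖ ≤ η) : ‖a / b - 1‖ ≤ 4 * η := by
  have h1 : 1 / 2 ≤ ‖b‖ := by
    have := norm_sub_norm_le (1 : ℂ) (1 - b)
    rw [norm_one, sub_sub_cancel, norm_sub_rev] at this
    linarith
  have hb0 : b ≠ 0 := norm_pos_iff.1 (by linarith)
  have h2 : a / b - 1 = ((a - 1) - (b - 1)) / b := by field_simp; ring
  rw [h2, norm_div, div_le_iff₀ (by linarith)]
  have h3 := norm_sub_le (a - 1) (b - 1)
  have h4 : 0 ≤ η := (norm_nonneg _).trans ha
  nlinarith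

/-! ### The potential factored through its turning points. -/

/-- A holomorphic square root of `(V(x) - V(z)) / (x - z)` near a simple zero `z`, normalised
at `z`. -/
def cubicRoot (p : ℂ × ℂ) (z x : ℂ) : ℂ := (cubicQuot p z x / cubicDeriv p z) ^ (1 / 2 : ℂ)

theorem cubicRoot_sq {p : ℂ × ℂ} {z : ℂ} (hz' : cubicDeriv p z ≠ 0) (x : ℂ) :
    cubicRoot p z x ^ 2 * cubicDeriv p z = cubicQuot p z x := by
  rw [cubicRoot, Complex.sqrt_sq]; field_simp

theorem eventually_mem_slitPlane {p : ℂ × ℂ} {z : ℂ} (hz' : cubicDeriv p z ≠ 0) :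
    ∀ᶠ x in 𝓝 z, cubicQuot p z x / cubicDeriv p z ∈ Complex.slitPlane := by
  have : Tendsto (fun x => cubicQuot p z x / cubicDeriv p z) (𝓝 z) (𝓝 1) := by
    have := ((continuous_cubicQuot p z).tendsto z).div_const (cubicDeriv p z)
    rwa [cubicQuot_self, div_self hz'] at this
  exact this.eventually (Complex.isOpen_slitPlane.mem_nhds (by simp))

theorem contDiffAt_cubicRoot {p : ℂ × ℂ} {z : ℂ} (hz' : cubicDeriv p z ≠ 0) :
    ∀ᶠ x in 𝓝 z, ContDiffAt ℂ 1 (cubicRoot p z) x := by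
  filter_upwards [eventually_mem_slitPlane hz'] with x hx
  have h1 : ContDiffAt ℂ 1 (fun x => cubicQuot p z x / cubicDeriv p z) x := by
    unfold cubicQuot; fun_prop
  have h2 : AnalyticAt ℂ (fun w : ℂ => w ^ (1 / 2 : ℂ)) (cubicQuot p z x / cubicDeriv p z) :=
    analyticAt_id.cpow analyticAt_const hx
  exact h2.contDiffAt.comp x h1

theorem cubicRoot_self {p : ℂ × ℂ} {z : ℂ} (hz' : cubicDeriv p z ≠ 0) :
    cubicRoot p z z = 1 := by
  simp [cubicRoot, cubicQuot_self, hz']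

/-- Without a quadratic term the roots sum to zero, so two distinct roots determine the third and
hence both coefficients. -/
theorem cubic_coeff_of_roots {p : ℂ × ℂ} {z w : ℂ} (hz : cubicPotential p z = 0)
    (hw : cubicPotential p w = 0) (hzw : z ≠ w) :
    p.1 = 2 * (z ^ 2 + z * w + w ^ 2) ∧ p.2 = -(z * w * (z + w)) / 7 := by
  unfold cubicPotential at hz hw
  have h1 : p.1 = 2 * (z ^ 2 + z * w + w ^ 2) := by
    have : (z - w) * (2 * (z ^ 2 + z * w + w ^ 2) - p.1) = 0 := by
      linear_combination hz / 2 - hw / 2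
    rcases mul_eq_zero.1 this with h | h
    · exact absurd (sub_eq_zero.1 h) hzw
    · linear_combination -h
  refine ⟨h1, ?_⟩
  rw [h1] at hz
  linear_combination (-1 / 28) * hz

theorem cubicPotential_eq_of_coeff {p : ℂ × ℂ} {z w : ℂ}
    (h : p.1 = 2 * (z ^ 2 + z * w + w ^ 2) ∧ p.2 = -(z * w * (z + w)) / 7) (x : ℂ) :
    cubicPotential p x = 4 * (x - z) * (x - w) * (x + z + w) := by
  unfold cubicPotential; rw [h.1, h.2]; ring

theorem cubicDeriv_eq_of_coeff {p : ℂ × ℂ} {z w : ℂ}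
    (h : p.1 = 2 * (z ^ 2 + z * w + w ^ 2)) (x : ℂ) :
    cubicDeriv p x = 12 * x ^ 2 - 4 * (z ^ 2 + z * w + w ^ 2) := by
  unfold cubicDeriv; rw [h]; ring

/-- With three distinct roots, `V'(z) = 4 (z - w) (z - u)`. -/
theorem cubicDeriv_ne_zero {p : ℂ × ℂ} {z w u : ℂ} (hz : cubicPotential p z = 0)
    (hw : cubicPotential p w = 0) (hu : cubicPotential p u = 0) (hzw : z ≠ w) (hzu : z ≠ u)
    (hwu : w ≠ u) : u = -z - w ∧ cubicDeriv p z ≠ 0 := by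
  have hc := cubic_coeff_of_roots hz hw hzw
  have h1 : u = -z - w := by
    rw [cubicPotential_eq_of_coeff hc] at hu
    simp only [mul_eq_zero, sub_eq_zero, hzu.symm, hwu.symm] at hu
    norm_num at hu
    linear_combination hu
  refine ⟨h1, ?_⟩
  rw [cubicDeriv_eq_of_coeff hc.1]
  have : 12 * z ^ 2 - 4 * (z ^ 2 + z * w + w ^ 2) = 4 * (z - w) * (z - u) := by rw [h1]; ring
  rw [this]
  exact mul_ne_zero (mul_ne_zero (by norm_num) (sub_ne_zero.2 hzw)) (sub_ne_zero.2 hzu)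

theorem IsInternalStokesLine.tendsto_source {p : ℂ × ℂ} {z w : ℂ} {T : ℝ} {γ : ℝ → ℂ}
    (h : IsInternalStokesLine p z w T γ) : Tendsto γ (𝓝[>] 0) (𝓝 z) := by
  have := h.continuousOn 0 ⟨le_rfl, h.length_pos.le⟩
  rw [← h.source, ← nhdsWithin_Ioo_eq_nhdsGT h.length_pos]
  exact this.mono Ioo_subset_Icc_self

theorem IsExternalStokesLine.tendsto_source {p : ℂ × ℂ} {z : ℂ} {θ : ℝ} {γ : ℝ → ℂ}
    (h : IsExternalStokesLine p z θ γ) : Tendsto γ (𝓝[>] 0) (𝓝 z) := by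
  have := h.continuousOn 0 (mem_Ici.2 le_rfl)
  rw [← h.source]
  exact this.mono Ioi_subset_Ici_self

theorem IsExternalStokesLine.exists_le_norm_sub {p : ℂ × ℂ} {z c : ℂ} {θ : ℝ} {γ : ℝ → ℂ}
    (h : IsExternalStokesLine p z θ γ) (hc : cubicPotential p c = 0) {a : ℝ} (ha : 0 ≤ a)
    (hac : a ≠ 0 ∨ z ≠ c) : ∃ ε > 0, ∀ t ∈ Ici a, ε ≤ ‖γ t - c‖ := by
  refine _root_.exists_le_norm_sub (h.continuousOn.mono (Ici_subset_Ici.2 ha)) h.tendsto_norm ?_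
  intro t ht heq
  have hat : a ≤ t := ht
  rcases (ha.trans hat).eq_or_lt with h0 | h0
  · rcases hac with h1 | h1
    · exact h1 (le_antisymm (hat.trans h0.symm.le) ha)
    · exact h1 (by rw [← h.source, h0, heq])
  · exact h.stokes.potential_ne_zero h0 (by rw [heq, hc])

theorem exp_two_pi_div_three : Complex.exp (2 * Real.pi / 3 * Complex.I) =
    ⟨-1 / 2, Real.sqrt 3 / 2⟩ := by
  have h1 : (2 * Real.pi / 3 * Complex.I : ℂ) = ((Real.pi - Real.pi / 3 : ℝ) : ℂ) * Complex.I := by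
    push_cast; ring
  rw [h1]
  apply Complex.ext
  · rw [Complex.exp_ofReal_mul_I_re, Real.cos_pi_sub, Real.cos_pi_div_three]; norm_num
  · rw [Complex.exp_ofReal_mul_I_im, Real.sin_pi_sub, Real.sin_pi_div_three]

/-! ### The geometry of the graph at its central vertex. -/

namespace StokesGraph320

variable {p : ℂ × ℂ} (G : StokesGraph320 p)

theorem deriv_z₀ : cubicDeriv p G.z₀ ≠ 0 :=
  (cubicDeriv_ne_zero G.turning_z₀ G.turning_z₁ G.turning_zm G.z₀_ne_z₁ G.z₀_ne_zm G.z₁_ne_zm).2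

theorem deriv_z₁ : cubicDeriv p G.z₁ ≠ 0 :=
  (cubicDeriv_ne_zero G.turning_z₁ G.turning_z₀ G.turning_zm G.z₀_ne_z₁.symm G.z₁_ne_zm
    G.z₀_ne_zm).2

theorem deriv_zm : cubicDeriv p G.zm ≠ 0 :=
  (cubicDeriv_ne_zero G.turning_zm G.turning_z₁ G.turning_z₀ G.z₁_ne_zm.symm G.z₀_ne_zm.symm
    G.z₀_ne_z₁.symm).2

/-- This makes the branch of `√V` available, and continuous, along the interior of each internal
line. -/
theorem mem_cutPlane_of_isInternalStokesLine {z w : ℂ} {T : ℝ} {γ : ℝ → ℂ}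
    (h : IsInternalStokesLine p z w T γ)
    (hz : cubicPotential p z = 0) (hw : cubicPotential p w = 0) {t : ℝ} (ht : t ∈ Ioo 0 T) :
    γ t ∈ G.cutPlane := by
  rintro ((⟨s, hs, hst⟩ | ⟨s, hs, hst⟩) | ⟨s, hs, hst⟩)
  · exact h.ne_external G.external₀ hz hw G.turning_z₀ ht hs hst.symm
  · exact h.ne_external G.external₁ hz hw G.turning_z₁ ht hs hst.symm
  · exact h.ne_external G.externalm hz hw G.turning_zm ht hs hst.symm

/-- Near `z₀`, in a coordinate `v` in which the external line leaves in the direction `-1`, the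
internal lines leave inside the right half plane. -/
theorem exists_coordinate : ∃ d : ℂ, d ≠ 0 ∧ ∀ᶠ t in 𝓝[>] (0 : ℝ),
    ((G.ray₀ t - G.z₀) / d).re < 0 ∧
    (0 < ((G.linem t - G.z₀) / d).re ∧
      ((G.linem t - G.z₀) / d).im < -(1 / 2) * ‖(G.linem t - G.z₀) / d‖) ∧
    (0 < ((G.line₁ t - G.z₀) / d).re ∧
      1 / 2 * ‖(G.line₁ t - G.z₀) / d‖ < ((G.line₁ t - G.z₀) / d).im) := by
  obtain ⟨d, hd, hlim⟩ :=
    (G.external₀.stokes.mono (J' := Ioo 0 1) fun t ht => ht.1).exists_direction one_pos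
    G.external₀.source G.external₀.tendsto_source G.turning_z₀ G.deriv_z₀
  have h3 : (1 : ℝ) < Real.sqrt 3 := by
    rw [Real.lt_sqrt] <;> norm_num
  have h3' : Real.sqrt 3 ^ 2 = 3 := Real.sq_sqrt (by norm_num)
  -- In the coordinate `(x - z₀) / (-d)`, rescaled by `t^{2/3}`, the external line tends to `-1`;
  -- the cyclic order then sends the internal ones to `exp (∓ π i / 3)`. The inequality `√3 / 2 > 1
  -- / 2` leaves the required slack.
  refine ⟨-d, neg_ne_zero.2 hd, ?_⟩
  set τ : ℝ → ℝ := fun t => t ^ (2 / 3 : ℝ) with hτ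
  have r0 : Tendsto (fun t => (G.ray₀ t - G.z₀) / (-d) / (τ t : ℂ)) (𝓝[>] 0) (𝓝 (-1)) := by
    have := hlim.div_const (-d)
    rw [div_neg, div_self hd] at this
    exact this.congr fun t => by rw [div_right_comm]
  have rne : ∀ᶠ t in 𝓝[>] (0 : ℝ), G.ray₀ t - G.z₀ ≠ 0 := by
    filter_upwards [self_mem_nhdsWithin] with t ht h0
    apply G.external₀.stokes.potential_ne_zero ht
    rw [sub_eq_zero.1 h0, G.turning_z₀]
  have rm : Tendsto (fun t => (G.linem t - G.z₀) / (-d) / (τ t : ℂ)) (𝓝[>] 0)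
      (𝓝 ⟨1 / 2, -(Real.sqrt 3 / 2)⟩) := by
    have := G.cyclic₀m.mul r0
    rw [exp_two_pi_div_three] at this
    have he : (⟨-1 / 2, Real.sqrt 3 / 2⟩ : ℂ) * (-1) = ⟨1 / 2, -(Real.sqrt 3 / 2)⟩ := by
      apply Complex.ext <;> simp; norm_num
    rw [he] at this
    refine this.congr' ?_
    filter_upwards [rne] with t h0
    field_simp
  have lne : ∀ᶠ t in 𝓝[>] (0 : ℝ), G.linem t - G.z₀ ≠ 0 := by
    filter_upwards [Ioo_mem_nhdsGT G.internalm.length_pos] with t ht h0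
    apply G.internalm.stokes.potential_ne_zero ht
    rw [sub_eq_zero.1 h0, G.turning_z₀]
  have r1 : Tendsto (fun t => (G.line₁ t - G.z₀) / (-d) / (τ t : ℂ)) (𝓝[>] 0)
      (𝓝 ⟨1 / 2, Real.sqrt 3 / 2⟩) := by
    have := G.cyclicm₁.mul rm
    rw [exp_two_pi_div_three] at this
    have he : (⟨-1 / 2, Real.sqrt 3 / 2⟩ : ℂ) * ⟨1 / 2, -(Real.sqrt 3 / 2)⟩
        = ⟨1 / 2, Real.sqrt 3 / 2⟩ := by
      apply Complex.ext <;> simp <;> nlinarith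
    rw [he] at this
    refine this.congr' ?_
    filter_upwards [lne] with t h0
    field_simp
  have scale : ∀ (x : ℂ) (s : ℝ), 0 < s → ∃ y, y = x / s ∧ x.re = s * y.re ∧ x.im = s * y.im ∧
      ‖x‖ = s * ‖y‖ := by
    intro x s hs
    have hx : x = s * (x / s) := by
      have : (s : ℂ) ≠ 0 := by exact_mod_cast hs.ne'
      field_simp
    refine ⟨x / s, rfl, ?_, ?_, ?_⟩
    · conv_lhs => rw [hx]
      simp
    · conv_lhs => rw [hx]
      simp
    · conv_lhs => rw [hx]
      rw [norm_mul, Complex.norm_real, Real.norm_of_nonneg hs.le]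
  have n1 : ‖(⟨1 / 2, Real.sqrt 3 / 2⟩ : ℂ)‖ = 1 := by
    rw [Complex.norm_def, Complex.normSq_mk, Real.sqrt_eq_one]; nlinarith
  have n2 : ‖(⟨1 / 2, -(Real.sqrt 3 / 2)⟩ : ℂ)‖ = 1 := by
    rw [Complex.norm_def, Complex.normSq_mk, Real.sqrt_eq_one]; nlinarith
  have e0 := (Complex.continuous_re.tendsto _).comp r0 |>.eventually
    (gt_mem_nhds (show (-1 : ℂ).re < 0 by norm_num))
  have em1 := (Complex.continuous_re.tendsto _).comp rm |>.eventually
    (lt_mem_nhds (show (0 : ℝ) < 1 / 2 by norm_num))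
  have e11 := (Complex.continuous_re.tendsto _).comp r1 |>.eventually
    (lt_mem_nhds (show (0 : ℝ) < 1 / 2 by norm_num))
  have em2 := (((Complex.continuous_im.tendsto _).comp rm).add
    ((rm.norm).const_mul (1 / 2))).eventually_lt_const (u := 0) (by rw [n2]; simp only; linarith)
  have e12 := (((Complex.continuous_im.tendsto _).comp r1).sub
    ((r1.norm).const_mul (1 / 2))).eventually_const_lt (u := 0) (by rw [n1]; simp only; linarith)
  filter_upwards [e0, em1, e11, em2, e12, self_mem_nhdsWithin] with t a0 am1 a11 am2 a12 ht
  have hs : 0 < τ t := Real.rpow_pos_of_pos ht _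
  simp only [Function.comp_apply] at a0 am1 a11 am2 a12
  obtain ⟨y0, hy0, b0, -, -⟩ := scale ((G.ray₀ t - G.z₀) / (-d)) _ hs
  obtain ⟨ym, hym, bm, cm, dm⟩ := scale ((G.linem t - G.z₀) / (-d)) _ hs
  obtain ⟨y1, hy1, b1, c1, d1⟩ := scale ((G.line₁ t - G.z₀) / (-d)) _ hs
  rw [← hy0] at a0
  rw [← hym] at am1 am2
  rw [← hy1] at a11 a12
  rw [b0, bm, cm, dm, b1, c1, d1]
  refine ⟨mul_neg_of_pos_of_neg hs a0, ⟨mul_pos hs am1, ?_⟩, mul_pos hs a11, ?_⟩ <;> nlinarith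

/-- Vectors in opposite sectors around the imaginary axis cannot cancel: the imaginary parts of `a /
d` and `b / d` have opposite signs and are comparable with the moduli. -/
theorem norm_sub_ge_of_im {a b d : ℂ} (hd : d ≠ 0) (ha : 1 / 2 * ‖a / d‖ < (a / d).im)
    (hb : (b / d).im < -(1 / 2) * ‖b / d‖) : 1 / 2 * (‖a‖ + ‖b‖) ≤ ‖a - b‖ := by
  have h1 : (a / d).im - (b / d).im ≤ ‖a / d - b / d‖ := by
    rw [← Complex.sub_im]; exact (le_abs_self _).trans (Complex.abs_im_le_norm _)
  rw [← sub_div, norm_div] at h1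
  rw [norm_div] at ha hb
  have hd' : 0 < ‖d‖ := norm_pos_iff.2 hd
  have h2 : 1 / 2 * (‖a‖ / ‖d‖) + 1 / 2 * (‖b‖ / ‖d‖) ≤ ‖a - b‖ / ‖d‖ := by linarith
  rw [le_div_iff₀ hd'] at h2
  field_simp at h2
  linarith

/-- The internal lines are uniformly transverse at `z₀` and disjoint elsewhere. -/
theorem exists_separation : ∃ c > 0, ∀ t ∈ Icc 0 G.T₁, ∀ s ∈ Icc 0 G.Tm,
    c * (‖G.line₁ t - G.z₀‖ + ‖G.linem s - G.z₀‖) ≤ ‖G.line₁ t - G.linem s‖ := by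
  obtain ⟨d, hd, hev⟩ := G.exists_coordinate
  have hT₁ := G.internal₁.length_pos
  have hTm := G.internalm.length_pos
  obtain ⟨δ, hδ, hb⟩ := mem_nhdsGT_iff_exists_Ioo_subset.1
    (inter_mem hev (Ioo_mem_nhdsGT (lt_min hT₁ hTm)))
  have hδ0 : (0 : ℝ) < δ := hδ
  have hne : ∀ t ∈ Icc 0 G.T₁, ∀ s ∈ Icc 0 G.Tm, t ≠ 0 ∨ s ≠ 0 → G.line₁ t ≠ G.linem s := by
    intro t ht s hs h0 heq
    have n1 : ∀ t ∈ Ioo 0 G.T₁, cubicPotential p (G.line₁ t) ≠ 0 :=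
      fun t => G.internal₁.stokes.potential_ne_zero
    have nm : ∀ t ∈ Ioo 0 G.Tm, cubicPotential p (G.linem t) ≠ 0 :=
      fun t => G.internalm.stokes.potential_ne_zero
    have s1 := G.internal₁.source
    have t1 := G.internal₁.target
    have sm := G.internalm.source
    have tm := G.internalm.target
    rcases eq_endpoints_or_mem_Ioo_of_mem_Icc ht with rfl | rfl | ht <;>
    rcases eq_endpoints_or_mem_Ioo_of_mem_Icc hs with rfl | rfl | hs
    · simp at h0
    · exact G.z₀_ne_zm (by rw [← s1, heq, tm])
    · exact nm s hs (by rw [← heq, s1, G.turning_z₀])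
    · exact G.z₀_ne_z₁ (by rw [← t1, heq, sm])
    · exact G.z₁_ne_zm (by rw [← t1, heq, tm])
    · exact nm s hs (by rw [← heq, t1, G.turning_z₁])
    · exact n1 t ht (by rw [heq, sm, G.turning_z₀])
    · exact n1 t ht (by rw [heq, tm, G.turning_zm])
    · exact G.internal₁.ne_internal G.internalm G.turning_z₀ G.turning_z₁ G.turning_zm
        G.z₀_ne_zm G.z₁_ne_zm ht hs heq
  -- Away from the corner `(0, 0)` the arcs are disjoint and compactness bounds the quotient; at the
  -- corner transversality takes over.
  set K : Set (ℝ × ℝ) := (Icc 0 G.T₁ ×ˢ Icc 0 G.Tm) \ (Iio (δ / 2) ×ˢ Iio (δ / 2)) with hK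
  have hKc : IsCompact K := (isCompact_Icc.prod isCompact_Icc).diff (isOpen_Iio.prod isOpen_Iio)
  have c1 : ContinuousOn (fun q : ℝ × ℝ => G.line₁ q.1) K :=
    G.internal₁.continuousOn.comp continuousOn_fst fun q hq => hq.1.1
  have cm : ContinuousOn (fun q : ℝ × ℝ => G.linem q.2) K :=
    G.internalm.continuousOn.comp continuousOn_snd fun q hq => hq.1.2
  have hd0 : ∀ q ∈ K, ‖G.line₁ q.1 - G.linem q.2‖ ≠ 0 := by
    intro q hq
    rw [norm_ne_zero_iff, sub_ne_zero]
    refine hne _ hq.1.1 _ hq.1.2 ?_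
    by_contra! h0
    exact hq.2 ⟨by simp only [mem_Iio, h0.1]; linarith, by simp only [mem_Iio, h0.2]; linarith⟩
  have hcont : ContinuousOn (fun q : ℝ × ℝ => (‖G.line₁ q.1 - G.z₀‖ + ‖G.linem q.2 - G.z₀‖) /
      ‖G.line₁ q.1 - G.linem q.2‖) K :=
    ((c1.sub continuousOn_const).norm.add (cm.sub continuousOn_const).norm).div
      (c1.sub cm).norm hd0
  obtain ⟨M, hM⟩ := hKc.bddAbove_image hcont
  -- `M` serves on `K`, and `2` matches the factor `1/2` from transversality at the corner.
  set M' := max M 2 with hM'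
  have hM2 : 2 ≤ M' := le_max_right _ _
  refine ⟨1 / M', by positivity, ?_⟩
  intro t ht s hs
  rw [div_mul_eq_mul_div, one_mul, div_le_iff₀ (by linarith)]
  by_cases hts : (t, s) ∈ K
  · have h1 := hM (mem_image_of_mem _ hts)
    have hpos : 0 < ‖G.line₁ t - G.linem s‖ := lt_of_le_of_ne (norm_nonneg _) (hd0 _ hts).symm
    simp only at h1
    rw [div_le_iff₀ hpos] at h1
    refine h1.trans ?_
    rw [mul_comm]
    exact mul_le_mul_of_nonneg_left (le_max_left _ _) hpos.le
  · have h1 : t < δ / 2 ∧ s < δ / 2 := by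
      by_contra h0
      exact hts ⟨⟨ht, hs⟩, fun h2 => h0 h2⟩
    have key : 1 / 2 * (‖G.line₁ t - G.z₀‖ + ‖G.linem s - G.z₀‖) ≤
        ‖(G.line₁ t - G.z₀) - (G.linem s - G.z₀)‖ := by
      rcases ht.1.eq_or_lt with h2 | h2
      · rw [← h2, G.internal₁.source, sub_self, norm_zero, zero_sub, norm_neg]
        linarith [norm_nonneg (G.linem s - G.z₀)]
      rcases hs.1.eq_or_lt with h3 | h3
      · rw [← h3, G.internalm.source, sub_self, norm_zero, sub_zero]
        linarith [norm_nonneg (G.line₁ t - G.z₀)]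
      exact norm_sub_ge_of_im hd (hb (show t ∈ Ioo 0 δ from ⟨h2, by linarith⟩)).1.2.2.2
        (hb (show s ∈ Ioo 0 δ from ⟨h3, by linarith⟩)).1.2.1.2
    rw [sub_sub_sub_cancel_right] at key
    nlinarith [norm_nonneg (G.line₁ t - G.linem s)]

/-- Near `z₀`, the branch `f` of the root at points of the two internal lines. -/
theorem exists_sector {f : ℂ → ℂ} (hf : IsSqrtBranch p G f) : ∃ c > 0, c ≤ 1 ∧ ∃ δ > 0,
    ∀ t ∈ Ioo 0 δ, ∀ s ∈ Ioo 0 δ, (f (G.linem s) / f (G.line₁ t)).im ≤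
      -c * ‖f (G.linem s) / f (G.line₁ t)‖ := by
  obtain ⟨d, hd, hev⟩ := G.exists_coordinate
  obtain ⟨δ, hδ, hb⟩ := mem_nhdsGT_iff_exists_Ioo_subset.1 hev
  have hδ0 : (0 : ℝ) < δ := hδ
  obtain ⟨ε₀, hε₀, h₀⟩ := G.external₀.exists_le_norm_sub G.turning_z₀ (a := δ / 2) (by linarith)
    (Or.inl (by linarith))
  obtain ⟨ε₁, hε₁, h₁⟩ := G.external₁.exists_le_norm_sub G.turning_z₀ (a := 0) le_rfl
    (Or.inr G.z₀_ne_z₁.symm)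
  obtain ⟨ε₂, hε₂, h₂⟩ := G.externalm.exists_le_norm_sub G.turning_z₀ (a := 0) le_rfl
    (Or.inr G.z₀_ne_zm.symm)
  have hroot : ∀ᶠ x in 𝓝 G.z₀, ContDiffAt ℂ 1 (cubicRoot p G.z₀) x ∧
      ‖cubicRoot p G.z₀ x - 1‖ < 1 / 64 := by
    refine (contDiffAt_cubicRoot G.deriv_z₀).and ?_
    have h1 := (contDiffAt_cubicRoot G.deriv_z₀).self_of_nhds.continuousAt.tendsto
    rw [cubicRoot_self G.deriv_z₀] at h1
    simpa [dist_eq_norm] using h1.eventually (Metric.ball_mem_nhds 1 (by norm_num : (0:ℝ) < 1 / 64))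
  obtain ⟨ε₃, hε₃, h₃⟩ := Metric.eventually_nhds_iff_ball.1 hroot
  set ε := min (min ε₀ ε₁) (min ε₂ ε₃) with hε
  have hε0 : 0 < ε := lt_min (lt_min hε₀ hε₁) (lt_min hε₂ hε₃)
  -- A half disc at `z₀` opposite to the external line: it is convex, misses every cut when `ε` is
  -- small, and contains the beginnings of both internal lines.
  set D : Set ℂ := Metric.ball G.z₀ ε ∩ {x | 0 < ((x - G.z₀) / d).re} with hD
  have hDc : IsPreconnected D := by
    apply Convex.isPreconnected
    refine (convex_ball _ _).inter ?_
    have : {x | 0 < ((x - G.z₀) / d).re} = {x | (G.z₀ / d).re < (x / d).re} := by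
      ext x; simp [sub_div]
    rw [this]
    refine convex_halfSpace_gt (f := fun x : ℂ => (x / d).re) ⟨?_, ?_⟩ _
    · intro x y; simp [add_div]
    · intro c x
      simp [mul_div_assoc]
  have hDcut : D ⊆ G.cutPlane := by
    rintro x ⟨hx1, hx2⟩ ((⟨t, ht, rfl⟩ | ⟨t, ht, rfl⟩) | ⟨t, ht, rfl⟩)
    · rw [Metric.mem_ball, dist_eq_norm] at hx1
      have ht0 : (0 : ℝ) ≤ t := ht
      rcases ht0.eq_or_lt with h | h
      · rw [← h, G.external₀.source] at hx2
        simp at hx2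
      rcases lt_or_ge t (δ / 2) with h' | h'
      · have := (hb (show t ∈ Ioo 0 δ from ⟨h, by linarith⟩)).1
        have h5 : 0 < ((G.ray₀ t - G.z₀) / d).re := hx2
        linarith
      · have := h₀ t h'
        have h4 : ε ≤ ε₀ := (min_le_left _ _).trans (min_le_left _ _)
        linarith
    · rw [Metric.mem_ball, dist_eq_norm] at hx1
      have := h₁ t ht
      have h4 : ε ≤ ε₁ := (min_le_left _ _).trans (min_le_right _ _)
      linarith
    · rw [Metric.mem_ball, dist_eq_norm] at hx1
      have := h₂ t ht
      have h4 : ε ≤ ε₂ := (min_le_right _ _).trans (min_le_left _ _)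
      linarith
  have hDroot : ∀ x ∈ D, ContDiffAt ℂ 1 (cubicRoot p G.z₀) x ∧
      ‖cubicRoot p G.z₀ x - 1‖ < 1 / 64 := fun x hx =>
    h₃ x (Metric.ball_subset_ball ((min_le_right _ _).trans (min_le_right _ _)) hx.1)
  obtain ⟨e, he⟩ : ∃ e : ℂ, e ^ 2 = d * cubicDeriv p G.z₀ :=
    IsAlgClosed.exists_pow_nat_eq _ (by norm_num)
  have he0 : e ≠ 0 := by
    rintro rfl
    have := mul_ne_zero hd G.deriv_z₀
    apply this; rw [← he]; norm_num
  have hslit : ∀ x ∈ D, (x - G.z₀) / d ∈ Complex.slitPlane := fun x hx => Or.inl hx.2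
  -- An explicit root of `V` on `D`. The branch `f` equals `g` or `-g` there, and the sign cancels
  -- in the quotients `f y / f x`.
  set g : ℂ → ℂ := fun x => e * cubicRoot p G.z₀ x * ((x - G.z₀) / d) ^ (1 / 2 : ℂ) with hg
  have hgc : ContinuousOn g D := by
    refine (continuousOn_const.mul fun x hx =>
      (hDroot x hx).1.continuousAt.continuousWithinAt).mul ?_
    exact ContinuousOn.cpow_const (by fun_prop) hslit
  have hgsq : ∀ x, g x ^ 2 = cubicPotential p x := by
    intro x
    rw [hg]
    simp only
    rw [mul_pow, mul_pow, Complex.sqrt_sq, he, cubicPotential_eq_mul_quot G.turning_z₀,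
      ← cubicRoot_sq G.deriv_z₀]
    field_simp
  have hg0 : ∀ x ∈ D, g x ≠ 0 := by
    intro x hx
    have h1 : cubicRoot p G.z₀ x ≠ 0 := by
      intro h0
      have := (hDroot x hx).2
      rw [h0] at this
      norm_num at this
    refine mul_ne_zero (mul_ne_zero he0 h1) ?_
    have := Complex.re_sqrt_pos (hslit x hx)
    intro h0
    rw [h0] at this
    simp at this
  have hquot : ∀ x ∈ D, ∀ y ∈ D, f y / f x = g y / g x := by
    rcases hDc.eq_or_eq_neg_of_sq_eq (hf.continuousOn.mono hDcut) hgc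
      (fun x hx => by simp [hf.sq_eq x (hDcut hx), hgsq]) (fun {x} hx => hg0 x hx) with h | h
    · intro x hx y hy
      rw [h hx, h hy]
    · intro x hx y hy
      rw [h hx, h hy]
      simp
  have l1 : ∀ᶠ t in 𝓝[>] (0 : ℝ), G.line₁ t ∈ Metric.ball G.z₀ ε :=
    G.internal₁.tendsto_source.eventually (Metric.ball_mem_nhds _ hε0)
  have lm : ∀ᶠ t in 𝓝[>] (0 : ℝ), G.linem t ∈ Metric.ball G.z₀ ε :=
    G.internalm.tendsto_source.eventually (Metric.ball_mem_nhds _ hε0)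
  obtain ⟨η, hη, hη'⟩ := mem_nhdsGT_iff_exists_Ioo_subset.1 (hev.and (l1.and lm))
  -- The principal quotient `b / a` satisfies the sector estimate with `1/8`; multiplication by a
  -- number within `4/64 = (1/8)/2` of `1` degrades this to `(1/8)/4 = 1/32`.
  refine ⟨1 / 32, by norm_num, by norm_num, η, hη, fun t ht s hs => ?_⟩
  have hx : G.line₁ t ∈ D := ⟨(hη' ht).2.1, (hη' ht).1.2.2.1⟩
  have hy : G.linem s ∈ D := ⟨(hη' hs).2.2, (hη' hs).1.2.1.1⟩
  have hxi := (hη' ht).1.2.2.2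
  have hyi := (hη' hs).1.2.1.2
  rw [hquot _ hx _ hy]
  set a := ((G.line₁ t - G.z₀) / d) ^ (1 / 2 : ℂ) with ha
  set b := ((G.linem s - G.z₀) / d) ^ (1 / 2 : ℂ) with hb'
  have ha2 := Complex.sqrt_sq ((G.line₁ t - G.z₀) / d)
  have hb2 := Complex.sqrt_sq ((G.linem s - G.z₀) / d)
  have ha0 := Complex.re_sqrt_pos (hslit _ hx)
  have hb0 := Complex.re_sqrt_pos (hslit _ hy)
  rw [← ha] at ha2 ha0
  rw [← hb'] at hb2 hb0
  rw [← ha2] at hxi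
  rw [← hb2] at hyi
  have him : ∀ c : ℂ, (c ^ 2).im = 2 * c.re * c.im := fun c => by
    rw [sq, Complex.mul_im]; ring
  rw [him, norm_pow] at hxi hyi
  have nre : ∀ c : ℂ, c.re ≤ ‖c‖ := fun c => (le_abs_self _).trans (Complex.abs_re_le_norm c)
  have nim : ∀ c : ℂ, |c.im| ≤ ‖c‖ := Complex.abs_im_le_norm
  have hapos : 0 < ‖a‖ := ha0.trans_le (nre a)
  have hbpos : 0 < ‖b‖ := hb0.trans_le (nre b)
  -- From `2 Re a Im a = Im a² > |a|²/2` and `Re a, Im a ≤ |a|`, both parts are at least `|a|/4`;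
  -- the same holds for `b`, with `Im b < 0`.
  have a1 : 1 / 4 * ‖a‖ ≤ a.im := by
    have : 0 < a.im := by nlinarith [sq_nonneg ‖a‖]
    have := mul_le_mul_of_nonneg_right (nre a) this.le
    nlinarith
  have a2 : 1 / 4 * ‖a‖ ≤ a.re := by
    have := mul_le_mul_of_nonneg_left ((le_abs_self _).trans (nim a)) ha0.le
    nlinarith
  have b1 : b.im ≤ -(1 / 4 * ‖b‖) := by
    have : b.im < 0 := by nlinarith [sq_nonneg ‖b‖]
    have := mul_le_mul_of_nonneg_right (nre b) (neg_pos.2 this).le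
    nlinarith
  have b2 : 1 / 4 * ‖b‖ ≤ b.re := by
    have := mul_le_mul_of_nonneg_left ((neg_le_abs _).trans (nim b)) hb0.le
    nlinarith
  have hq : (b / a).im ≤ -(1 / 8) * ‖b / a‖ := by
    rw [Complex.div_im, norm_div, Complex.normSq_eq_norm_sq, ← sub_div, ← mul_div_assoc,
      div_le_div_iff₀ (by positivity) hapos]
    have h1 : b.im * a.re ≤ -(1 / 4 * ‖b‖) * (1 / 4 * ‖a‖) := by
      have h2 := mul_le_mul_of_nonneg_right b1 ha0.le
      have h3 := mul_le_mul_of_nonneg_left a2 (show 0 ≤ 1 / 4 * ‖b‖ by positivity)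
      linarith
    have h2 : (1 / 4 * ‖b‖) * (1 / 4 * ‖a‖) ≤ b.re * a.im := by
      gcongr
    have h3 : b.im * a.re - b.re * a.im ≤ -(1 / 8) * ‖b‖ * ‖a‖ := by nlinarith
    calc (b.im * a.re - b.re * a.im) * ‖a‖ ≤ (-(1 / 8) * ‖b‖ * ‖a‖) * ‖a‖ :=
          mul_le_mul_of_nonneg_right h3 hapos.le
      _ = _ := by ring
  have hρ := norm_div_sub_one_le (η := 1 / 64) (by norm_num) (hDroot _ hy).2.le
    (hDroot _ hx).2.le
  have hfin := im_mul_le_of_norm_sub_one_le (c := 1 / 8) (by norm_num) (by norm_num) hq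
    (hρ.trans (by norm_num))
  have hgg : g (G.linem s) / g (G.line₁ t) = cubicRoot p G.z₀ (G.linem s) /
      cubicRoot p G.z₀ (G.line₁ t) * (b / a) := by
    rw [hg]
    simp only
    rw [mul_assoc, mul_assoc, mul_div_mul_left _ _ he0, mul_div_mul_comm]
  rw [hgg]
  norm_num at hfin ⊢
  linarith

end StokesGraph320

/-! ### Root arcs and the Cauchy integral of `dλ / √V`. -/

/-- An arc `γ : [0, T] → ℂ` joining two turning points, with a continuous choice `μ` of the root
`√V(γ)`, parametrised so that `√V(γ) γ' = m` is continuous up to the end points. -/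
structure IsRootArc (p : ℂ × ℂ) (z w : ℂ) (T : ℝ) (γ μ m : ℝ → ℂ) : Prop where
  length_pos : 0 < T
  continuousOn : ContinuousOn γ (Icc 0 T)
  source : γ 0 = z
  target : γ T = w
  turning_source : cubicPotential p z = 0
  turning_target : cubicPotential p w = 0
  hasDerivAt : ∀ t ∈ Ioo 0 T, HasDerivAt γ (m t / μ t) t
  continuousOn_root : ContinuousOn μ (Ioo 0 T)
  root_sq : ∀ t ∈ Ioo 0 T, μ t ^ 2 = cubicPotential p (γ t)
  root_ne_zero : ∀ t ∈ Ioo 0 T, μ t ≠ 0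
  continuousOn_speed : ContinuousOn m (Icc 0 T)
  integrable : IntervalIntegrable (fun t => (cubicPotential p (γ t))⁻¹) MeasureTheory.volume 0 T

/-- The density of `dλ / √V` on a root arc. -/
def rootDensity (p : ℂ × ℂ) (γ m : ℝ → ℂ) (t : ℝ) : ℂ := m t * (cubicPotential p (γ t))⁻¹

namespace IsRootArc

variable {p : ℂ × ℂ} {z w : ℂ} {T : ℝ} {γ μ m : ℝ → ℂ}

theorem potential_ne_zero (h : IsRootArc p z w T γ μ m) {t : ℝ} (ht : t ∈ Ioo 0 T) :
    cubicPotential p (γ t) ≠ 0 := by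
  rw [← h.root_sq t ht]; exact pow_ne_zero 2 (h.root_ne_zero t ht)

theorem root_hasDerivAt (h : IsRootArc p z w T γ μ m) {t : ℝ} (ht : t ∈ Ioo 0 T) :
    HasDerivAt μ (cubicDeriv p (γ t) * rootDensity p γ m t / 2) t := by
  have h1 := (hasDerivAt_cubicPotential p (γ t)).scomp t (h.hasDerivAt t ht)
  have h2 := (HasDerivWithinAt.of_sq ht (h.continuousOn_root t ht) h.root_sq
    (h.root_ne_zero t ht) h1.hasDerivWithinAt).hasDerivAt (Ioo_mem_nhds ht.1 ht.2)
  refine h2.congr_deriv ?_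
  have := h.root_ne_zero t ht
  rw [rootDensity, ← h.root_sq t ht, smul_eq_mul]
  field_simp

theorem tendsto_left (h : IsRootArc p z w T γ μ m) : Tendsto γ (𝓝[>] 0) (𝓝 z) := by
  have := h.continuousOn 0 ⟨le_rfl, h.length_pos.le⟩
  rw [← h.source, ← nhdsWithin_Ioo_eq_nhdsGT h.length_pos]
  exact this.mono Ioo_subset_Icc_self

theorem tendsto_right (h : IsRootArc p z w T γ μ m) : Tendsto γ (𝓝[<] T) (𝓝 w) := by
  have := h.continuousOn T ⟨h.length_pos.le, le_rfl⟩
  rw [← h.target, ← nhdsWithin_Ioo_eq_nhdsLT h.length_pos]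
  exact this.mono Ioo_subset_Icc_self

theorem tendsto_root_zero (h : IsRootArc p z w T γ μ m) {l : Filter ℝ} {x : ℂ}
    (hl : Ioo 0 T ∈ l) (hγ : Tendsto γ l (𝓝 x)) (hx : cubicPotential p x = 0) :
    Tendsto μ l (𝓝 0) := by
  have h1 := (((continuous_cubicPotential p).tendsto x).comp hγ).norm.sqrt
  rw [hx, norm_zero, Real.sqrt_zero] at h1
  rw [tendsto_zero_iff_norm_tendsto_zero]
  refine h1.congr' ?_
  filter_upwards [hl] with t ht
  rw [Function.comp_apply, ← h.root_sq t ht, norm_pow, Real.sqrt_sq (norm_nonneg _)]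

theorem tendsto_root_left (h : IsRootArc p z w T γ μ m) : Tendsto μ (𝓝[>] 0) (𝓝 0) :=
  h.tendsto_root_zero (Ioo_mem_nhdsGT h.length_pos) h.tendsto_left h.turning_source

theorem tendsto_root_right (h : IsRootArc p z w T γ μ m) : Tendsto μ (𝓝[<] T) (𝓝 0) :=
  h.tendsto_root_zero (Ioo_mem_nhdsLT h.length_pos) h.tendsto_right h.turning_target

theorem intervalIntegrable_density (h : IsRootArc p z w T γ μ m) :
    IntervalIntegrable (rootDensity p γ m) MeasureTheory.volume 0 T :=
  h.integrable.continuousOn_mul (by rw [uIcc_of_le h.length_pos.le]; exact h.continuousOn_speed)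

theorem intervalIntegrable_sub (h : IsRootArc p z w T γ μ m) {a b : ℝ} (ha : 0 ≤ a) (hab : a ≤ b)
    (hb : b ≤ T) {g : ℝ → ℂ} (hg : ContinuousOn g (Icc a b)) :
    IntervalIntegrable (fun t => rootDensity p γ m t * g t) MeasureTheory.volume a b := by
  refine IntervalIntegrable.mul_continuousOn ?_ (by rwa [uIcc_of_le hab])
  refine h.intervalIntegrable_density.mono_set ?_
  rw [uIcc_of_le hab, uIcc_of_le h.length_pos.le]
  exact Icc_subset_Icc ha hb

/-- Stated on a subinterval so that it also applies at the common end point `z`, once the part of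
the arc near `z` has been removed. -/
theorem hasDerivAt_cauchy (h : IsRootArc p z w T γ μ m) {a b : ℝ} (ha : 0 ≤ a) (hab : a ≤ b)
    (hb : b ≤ T) {x : ℂ} (hx : ∀ s ∈ Icc a b, γ s ≠ x) :
    HasDerivAt (fun x => ∫ s in a..b, rootDensity p γ m s * (x - γ s)⁻¹)
      (∫ s in a..b, rootDensity p γ m s * (-((x - γ s) ^ 2)⁻¹)) x := by
  have hγ : ContinuousOn γ (Icc a b) := h.continuousOn.mono (Icc_subset_Icc ha hb)
  obtain ⟨ε, hε, hdist⟩ : ∃ ε > 0, ∀ s ∈ Icc a b, ε ≤ ‖x - γ s‖ := by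
    have hc : ContinuousOn (fun s => ‖x - γ s‖) (Icc a b) := (continuousOn_const.sub hγ).norm
    obtain ⟨s, hs, hmin⟩ := isCompact_Icc.exists_isMinOn (nonempty_Icc.2 hab) hc
    exact ⟨_, norm_pos_iff.2 (sub_ne_zero.2 (hx s hs).symm), fun t ht => hmin ht⟩
  have hball : ∀ y ∈ Metric.ball x (ε / 2), ∀ s ∈ Icc a b, ε / 2 ≤ ‖y - γ s‖ := by
    intro y hy s hs
    have h1 := hdist s hs
    rw [Metric.mem_ball, dist_eq_norm, norm_sub_rev] at hy
    have h2 := norm_add_le (x - y) (y - γ s)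
    rw [sub_add_sub_cancel] at h2
    linarith
  have hne : ∀ y ∈ Metric.ball x (ε / 2), ∀ s ∈ Icc a b, y - γ s ≠ 0 := fun y hy s hs =>
    norm_pos_iff.1 (by linarith [hball y hy s hs])
  have hκ : IntervalIntegrable (rootDensity p γ m) MeasureTheory.volume a b := by
    simpa using h.intervalIntegrable_sub ha hab hb (g := fun _ => 1) continuousOn_const
  have hnhds : Metric.ball x (ε / 2) ∈ 𝓝 x := Metric.ball_mem_nhds x (by linarith)
  have hcont : ∀ y ∈ Metric.ball x (ε / 2), ContinuousOn (fun s => (y - γ s)⁻¹) (Icc a b) :=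
    fun y hy => (continuousOn_const.sub hγ).inv₀ (hne y hy)
  have hsub : uIoc a b ⊆ Icc a b := by rw [uIoc_of_le hab]; exact Ioc_subset_Icc_self
  refine (intervalIntegral.hasDerivAt_integral_of_dominated_loc_of_deriv_le
    (F' := fun y s => rootDensity p γ m s * (-((y - γ s) ^ 2)⁻¹))
    (bound := fun s => ‖rootDensity p γ m s‖ * ((ε / 2) ^ 2)⁻¹) hnhds ?_ ?_ ?_ ?_ ?_ ?_).2
  · filter_upwards [hnhds] with y hy
    exact (h.intervalIntegrable_sub ha hab hb (hcont y hy)).aestronglyMeasurable_restrict_uIoc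
  · exact h.intervalIntegrable_sub ha hab hb (hcont x (mem_of_mem_nhds hnhds))
  · refine (h.intervalIntegrable_sub ha hab hb ?_).aestronglyMeasurable_restrict_uIoc
    exact (((continuousOn_const.sub hγ).pow 2).inv₀
      fun s hs => pow_ne_zero 2 (hne x (mem_of_mem_nhds hnhds) s hs)).neg
  · refine Eventually.of_forall fun s hs y hy => ?_
    rw [norm_mul, norm_neg, norm_inv, norm_pow]
    have := hball y hy s (hsub hs)
    gcongr
  · exact hκ.norm.mul_const _
  · refine Eventually.of_forall fun s hs y hy => ?_
    have h1 := ((hasDerivAt_id' y).sub_const (γ s)).fun_inv (hne y hy s (hsub hs))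
    refine (h1.const_mul (rootDensity p γ m s)).congr_deriv ?_
    rw [neg_div, one_div]

/-- The differential equation of the Cauchy integral of `dλ / √V` along a root arc. -/
theorem cauchy_ode (h : IsRootArc p z w T γ μ m) {x : ℂ} (hx : ∀ s ∈ Icc 0 T, γ s ≠ x) :
    cubicDeriv p x / 2 * (∫ s in 0..T, rootDensity p γ m s * (x - γ s)⁻¹)
      + cubicPotential p x * (∫ s in 0..T, rootDensity p γ m s * (-((x - γ s) ^ 2)⁻¹))
      = 2 * (x * (∫ s in 0..T, rootDensity p γ m s)
        - ∫ s in 0..T, rootDensity p γ m s * γ s) := by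
  have hT := h.length_pos
  have hγ := h.continuousOn
  have hne : ∀ s ∈ Icc 0 T, x - γ s ≠ 0 := fun s hs => sub_ne_zero.2 (hx s hs).symm
  have ci : ContinuousOn (fun s => (x - γ s)⁻¹) (Icc 0 T) := (continuousOn_const.sub hγ).inv₀ hne
  have ci2 : ContinuousOn (fun s => -((x - γ s) ^ 2)⁻¹) (Icc 0 T) :=
    (((continuousOn_const.sub hγ).pow 2).inv₀ fun s hs => pow_ne_zero 2 (hne s hs)).neg
  have cE : ContinuousOn (fun s => cubicDeriv p (γ s) / 2 * (x - γ s)⁻¹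
      + cubicPotential p (γ s) * ((x - γ s) ^ 2)⁻¹) (Icc 0 T) := by
    refine ((((continuous_cubicDeriv p).comp_continuousOn hγ).div_const 2).mul ci).add
      (((continuous_cubicPotential p).comp_continuousOn hγ).mul ?_)
    exact ((continuousOn_const.sub hγ).pow 2).inv₀ fun s hs => pow_ne_zero 2 (hne s hs)
  have i1 := h.intervalIntegrable_sub le_rfl hT.le le_rfl ci
  have i2 := h.intervalIntegrable_sub le_rfl hT.le le_rfl ci2
  have iE := h.intervalIntegrable_sub le_rfl hT.le le_rfl cE
  have iγ := h.intervalIntegrable_sub le_rfl hT.le le_rfl hγ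
  have i0 := h.intervalIntegrable_density
  have hlim : ∀ (l : Filter ℝ) (y : ℂ), Tendsto γ l (𝓝 y) → Tendsto μ l (𝓝 0) → x - y ≠ 0 →
      Tendsto (fun s => μ s * (x - γ s)⁻¹) l (𝓝 0) := by
    intro l y h1 h2 h3
    simpa using h2.mul ((h1.const_sub x).inv₀ h3)
  -- The integrand is the derivative of `√V(γ) / (x - γ)`, which vanishes at both ends because they
  -- are turning points.
  have key : ∫ s in 0..T, rootDensity p γ m s * (cubicDeriv p (γ s) / 2 * (x - γ s)⁻¹
      + cubicPotential p (γ s) * ((x - γ s) ^ 2)⁻¹) = 0 := by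
    rw [intervalIntegral.integral_eq_sub_of_hasDerivAt_of_tendsto hT
      (f := fun s => μ s * (x - γ s)⁻¹) (fa := 0) (fb := 0) ?_ iE
      (hlim _ z h.tendsto_left h.tendsto_root_left ?_)
      (hlim _ w h.tendsto_right h.tendsto_root_right ?_), sub_zero]
    · intro s hs
      have hn := hne s (Ioo_subset_Icc_self hs)
      have hm := h.root_ne_zero s hs
      refine ((h.root_hasDerivAt hs).mul
        (((h.hasDerivAt s hs).const_sub x).fun_inv hn)).congr_deriv ?_
      rw [rootDensity, ← h.root_sq s hs]
      field_simp
    · rw [← h.source]; exact hne 0 ⟨le_rfl, hT.le⟩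
    · rw [← h.target]; exact hne T ⟨hT.le, le_rfl⟩
  rw [← add_zero (_ + _), ← key, ← intervalIntegral.integral_const_mul,
    ← intervalIntegral.integral_const_mul, ← intervalIntegral.integral_const_mul,
    ← intervalIntegral.integral_add (i1.const_mul _) (i2.const_mul _),
    ← intervalIntegral.integral_add ((i1.const_mul _).add (i2.const_mul _)) iE,
    ← intervalIntegral.integral_sub (i0.const_mul _) iγ, ← intervalIntegral.integral_const_mul]
  -- What remains is `(V'(x) + V'(y)) / 2 - (V(x) - V(y)) / (x - y) = 2 (x - y)²`, divided by `x -
  -- y`. The left side is the error of the trapezoidal rule for `V'`, so only the cubic term of `V`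
  -- contributes.
  refine intervalIntegral.integral_congr fun s hs => ?_
  rw [uIcc_of_le hT.le] at hs
  have hn := hne s hs
  field_simp
  unfold cubicPotential cubicDeriv
  ring

end IsRootArc

/-! ### The singular limit and Legendre's relation. -/

namespace IsRootArc

variable {p : ℂ × ℂ} {z : ℂ}

/-- The limit at the common end point of two root arcs of the Cauchy integral along one of them. -/
theorem tendsto_root_mul_cauchy {w w' : ℂ} {T T' : ℝ} {X μ m Y μ' m' : ℝ → ℂ}
    (hX : IsRootArc p z w T X μ m) (hY : IsRootArc p z w' T' Y μ' m')
    (hz' : cubicDeriv p z ≠ 0) (hinj : ∀ s ∈ Ioc 0 T', Y s ≠ z)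
    (hXY : ∀ t ∈ Ioc 0 T, ∀ s ∈ Icc 0 T', Y s ≠ X t)
    (hsec : ∃ c > 0, c ≤ 1 ∧ ∃ δ > 0, ∀ t ∈ Ioo 0 δ, ∀ s ∈ Ioo 0 δ,
      (μ' s / μ t).im ≤ -c * ‖μ' s / μ t‖) :
    Tendsto (fun t => μ t * ∫ s in 0..T', rootDensity p Y m' s * (X t - Y s)⁻¹) (𝓝[>] 0)
      (𝓝 (-(Real.pi * Complex.I))) := by
  have hT := hX.length_pos
  have hT' := hY.length_pos
  obtain ⟨c, hc, hc1, δ, hδ, hsec⟩ := hsec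
  -- With one constant `c₀` for both arcs, the square roots `ξ`, `η` of `X - z`, `Y - z` satisfy `η
  -- / ξ = (μ' / μ) · R(X) / R(Y)`, a quotient of roots times a number close to `1`.
  obtain ⟨c₀, hc₀⟩ : ∃ c₀ : ℂ, c₀ ^ 2 = cubicDeriv p z :=
    IsAlgClosed.exists_pow_nat_eq _ (by norm_num)
  have hc₀0 : c₀ ≠ 0 := by rintro rfl; apply hz'; rw [← hc₀]; norm_num
  set R := cubicRoot p z with hR
  have hRsq : ∀ x, R x ^ 2 * cubicDeriv p z = cubicQuot p z x := cubicRoot_sq hz'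
  -- a neighbourhood of `z` on which the root is controlled
  obtain ⟨K, U, hU, hK⟩ := (contDiffAt_cubicRoot hz').self_of_nhds.exists_lipschitzOnWith
  have hcontR : ContinuousAt R z := (contDiffAt_cubicRoot hz').self_of_nhds.continuousAt
  have hR1 : ∀ᶠ x in 𝓝 z, ‖R x - 1‖ < c / 8 := by
    have h1 := hcontR.tendsto
    rw [hR, cubicRoot_self hz'] at h1
    simpa [dist_eq_norm] using h1.eventually (Metric.ball_mem_nhds 1 (by linarith : 0 < c / 8))
  have hgood : ∀ᶠ x in 𝓝 z, x ∈ U ∧ ‖R x - 1‖ < c / 8 ∧ ContDiffAt ℂ 1 R x :=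
    (eventually_mem_set.2 hU).and (hR1.and (contDiffAt_cubicRoot hz'))
  obtain ⟨δ₁, hδ₁, hb⟩ := mem_nhdsGT_iff_exists_Ioo_subset.1
    (((hX.tendsto_left.eventually hgood).and (hY.tendsto_left.eventually hgood)).and
      (Ioo_mem_nhdsGT (lt_min hδ (lt_min hT hT'))))
  have hδ₁0 : (0 : ℝ) < δ₁ := hδ₁
  have htX : ∀ t ∈ Ioo 0 δ₁, t ∈ Ioo 0 T := fun t ht =>
    ⟨ht.1, (hb ht).2.2.trans_le ((min_le_right _ _).trans (min_le_left _ _))⟩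
  have htY : ∀ t ∈ Ioo 0 δ₁, t ∈ Ioo 0 T' := fun t ht =>
    ⟨ht.1, (hb ht).2.2.trans_le ((min_le_right _ _).trans (min_le_right _ _))⟩
  have htδ : ∀ t ∈ Ioo 0 δ₁, t ∈ Ioo 0 δ := fun t ht =>
    ⟨ht.1, (hb ht).2.2.trans_le (min_le_left _ _)⟩
  have hRlow : ∀ x, ‖R x - 1‖ < c / 8 → 1 / 2 ≤ ‖R x‖ := by
    intro x hx
    have := norm_sub_norm_le (1 : ℂ) (1 - R x)
    rw [norm_one, sub_sub_cancel, norm_sub_rev] at this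
    linarith
  have hRX : ∀ t ∈ Ioo 0 δ₁, R (X t) ≠ 0 := fun t ht =>
    norm_pos_iff.1 (by linarith [hRlow _ (hb ht).1.1.2.1])
  have hRY : ∀ t ∈ Ioo 0 δ₁, R (Y t) ≠ 0 := fun t ht =>
    norm_pos_iff.1 (by linarith [hRlow _ (hb ht).1.2.2.1])
  -- the square roots of `X - z` and `Y - z`
  set ξ : ℝ → ℂ := fun t => μ t / (c₀ * R (X t)) with hξ
  set η : ℝ → ℂ := fun s => μ' s / (c₀ * R (Y s)) with hη
  have hξsq : ∀ t ∈ Ioo 0 δ₁, ξ t ^ 2 = X t - z := by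
    intro t ht
    have h0 := hRX t ht
    rw [hξ]
    simp only
    rw [div_pow, mul_pow, hX.root_sq t (htX t ht), cubicPotential_eq_mul_quot hX.turning_source,
      ← hRsq, hc₀]
    field_simp
  have hηsq : ∀ t ∈ Ioo 0 δ₁, η t ^ 2 = Y t - z := by
    intro t ht
    have h0 := hRY t ht
    rw [hη]
    simp only
    rw [div_pow, mul_pow, hY.root_sq t (htY t ht), cubicPotential_eq_mul_quot hX.turning_source,
      ← hRsq, hc₀]
    field_simp
  have hξ0 : ∀ t ∈ Ioo 0 δ₁, ξ t ≠ 0 := fun t ht =>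
    div_ne_zero (hX.root_ne_zero t (htX t ht)) (mul_ne_zero hc₀0 (hRX t ht))
  have hη0 : ∀ t ∈ Ioo 0 δ₁, η t ≠ 0 := fun t ht =>
    div_ne_zero (hY.root_ne_zero t (htY t ht)) (mul_ne_zero hc₀0 (hRY t ht))
  have him : ∀ t ∈ Ioo 0 δ₁, ∀ s ∈ Ioo 0 δ₁, (η s / ξ t).im < 0 := by
    intro t ht s hs
    have h1 := hsec t (htδ t ht) s (htδ s hs)
    have h2 := norm_div_sub_one_le (η := c / 8) (by linarith) (hb ht).1.1.2.1.le
      (hb hs).1.2.2.1.le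
    have h3 := im_mul_le_of_norm_sub_one_le hc hc1 h1 (h2.trans (by linarith))
    have h4 : R (X t) / R (Y s) * (μ' s / μ t) = η s / ξ t := by
      rw [hξ, hη]
      have := hRX t ht
      have := hRY s hs
      have := hX.root_ne_zero t (htX t ht)
      field_simp
    rw [h4] at h3
    have h5 : 0 < ‖η s / ξ t‖ := norm_pos_iff.2 (div_ne_zero (hη0 s hs) (hξ0 t ht))
    have : 0 < c / 4 * ‖η s / ξ t‖ := by positivity
    linarith
  have hξlim : Tendsto ξ (𝓝[>] 0) (𝓝 0) := by
    have h1 := (hcontR.tendsto.comp hX.tendsto_left).const_mul c₀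
    rw [hR, cubicRoot_self hz', mul_one] at h1
    have h2 := hX.tendsto_root_left.div h1 hc₀0
    rw [zero_div] at h2
    exact h2
  have hηlim : Tendsto η (𝓝[>] 0) (𝓝 0) := by
    have h1 := (hcontR.tendsto.comp hY.tendsto_left).const_mul c₀
    rw [hR, cubicRoot_self hz', mul_one] at h1
    have h2 := hY.tendsto_root_left.div h1 hc₀0
    rw [zero_div] at h2
    exact h2
  set η' : ℝ → ℂ := fun s => rootDensity p Y m' s * (c₀ * R (Y s) / 2) with hη'
  have hRYc : ∀ s ∈ Ioo 0 δ₁, ContinuousAt (fun s => R (Y s)) s := fun s hs =>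
    (hb hs).1.2.2.2.continuousAt.comp (hY.hasDerivAt s (htY s hs)).continuousAt
  have hηder : ∀ s ∈ Ioo 0 δ₁, HasDerivAt η (η' s) s := by
    intro s hs
    have h1 : ContinuousWithinAt η (Ioo 0 δ₁) s :=
      ((hY.root_hasDerivAt (htY s hs)).continuousAt.div (continuousAt_const.mul (hRYc s hs))
        (mul_ne_zero hc₀0 (hRY s hs))).continuousWithinAt
    have h2 := (HasDerivWithinAt.of_sq hs h1 hηsq (hη0 s hs)
      ((hY.hasDerivAt s (htY s hs)).sub_const z).hasDerivWithinAt).hasDerivAt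
      (Ioo_mem_nhds hs.1 hs.2)
    refine h2.congr_deriv ?_
    have h3 := hRY s hs
    have h4 := hY.root_ne_zero s (htY s hs)
    rw [hη', hη]
    simp only
    rw [rootDensity, ← hY.root_sq s (htY s hs)]
    field_simp
  set σ := δ₁ / 2 with hσ
  have hσ0 : 0 < σ := by linarith
  have hσ1 : σ ∈ Ioo 0 δ₁ := ⟨hσ0, by linarith⟩
  have hσT : σ < T' := (htY σ hσ1).2
  have hin : ∀ s ∈ Ioc 0 σ, s ∈ Ioo 0 δ₁ := fun s hs => ⟨hs.1, hs.2.trans_lt hσ1.2⟩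
  have cRY : ContinuousOn (fun s => c₀ * R (Y s) / 2) (Icc 0 σ) := by
    refine (continuousOn_const.mul ?_).div_const 2
    intro s hs
    rcases hs.1.eq_or_lt with h | h
    · rw [← h]
      refine ContinuousAt.comp_continuousWithinAt (g := R) (by rw [hY.source]; exact hcontR) ?_
      exact (hY.continuousOn 0 ⟨le_rfl, hT'.le⟩).mono (Icc_subset_Icc_right hσT.le)
    · exact (hRYc s (hin s ⟨h, hs.2⟩)).continuousWithinAt
  have iη' : IntervalIntegrable η' MeasureTheory.volume 0 σ :=
    hY.intervalIntegrable_sub le_rfl hσ0.le hσT.le cRY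
  have cinv : ∀ t ∈ Ioo 0 δ₁, ContinuousOn (fun s => (X t - Y s)⁻¹) (Icc 0 T') := by
    intro t ht
    refine (continuousOn_const.sub hY.continuousOn).inv₀ fun s hs => ?_
    exact sub_ne_zero.2 (hXY t ⟨ht.1, (htX t ht).2.le⟩ s hs).symm
  -- the main term
  have hmain : ∀ t ∈ Ioo 0 δ₁, ∫ s in 0..σ, η' s * (2 * ξ t * (X t - Y s)⁻¹) =
      Complex.log ((1 + η σ / ξ t) / (1 - η σ / ξ t)) := by
    intro t ht
    have hslit : ∀ q : ℂ, q.im < 0 → 1 - q ≠ 0 ∧ 1 + q ≠ 0 ∧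
        (1 + q) / (1 - q) ∈ Complex.slitPlane := by
      intro q hq
      have h1 : 1 - q ≠ 0 := fun h0 => by
        have := congrArg Complex.im h0; simp at this; linarith
      have h2 : 1 + q ≠ 0 := fun h0 => by
        have := congrArg Complex.im h0; simp at this; linarith
      refine ⟨h1, h2, Or.inr ?_⟩
      have h3 : ((1 + q) / (1 - q)).im = 2 * q.im / Complex.normSq (1 - q) := by
        rw [Complex.div_im]
        simp
        ring
      rw [h3]
      exact div_ne_zero (by linarith) (by simpa using h1)
    -- In the variable `η` the integrand is `2ξ dη / (ξ² - η²)`. Since `Im (η / ξ) < 0`, the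
    -- argument of the logarithm stays in the lower half plane, off the branch cut.
    have hder : ∀ s ∈ Ioo 0 δ₁, HasDerivAt
        (fun s => Complex.log ((1 + η s / ξ t) / (1 - η s / ξ t)))
        (η' s * (2 * ξ t * (X t - Y s)⁻¹)) s := by
      intro s hs
      obtain ⟨h1, h2, h3⟩ := hslit _ (him t ht s hs)
      have hq := (hηder s hs).div_const (ξ t)
      have hd := (hq.const_add 1).fun_div (hq.const_sub 1) h1
      refine (hd.clog_real h3).congr_deriv ?_
      have hne : X t - Y s ≠ 0 :=
        sub_ne_zero.2 (hXY t ⟨ht.1, (htX t ht).2.le⟩ s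
          (Ioo_subset_Icc_self (htY s hs))).symm
      have hxy : X t - Y s = ξ t ^ 2 * ((1 - η s / ξ t) * (1 + η s / ξ t)) := by
        have h5 : X t - Y s = ξ t ^ 2 - η s ^ 2 := by rw [hξsq t ht, hηsq s hs]; ring
        rw [h5]
        have := hξ0 t ht
        field_simp
        ring
      rw [hxy]
      have := hξ0 t ht
      set q := η s / ξ t with hqdef
      field_simp
      ring
    have hl0 : Tendsto (fun s => Complex.log ((1 + η s / ξ t) / (1 - η s / ξ t))) (𝓝[>] 0)
        (𝓝 0) := by
      have h1 := hηlim.div_const (ξ t)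
      rw [zero_div] at h1
      have h2 := (h1.const_add 1).div (h1.const_sub 1) (by norm_num)
      have h3 := h2.clog (by norm_num)
      norm_num at h3
      exact h3
    have hlσ : Tendsto (fun s => Complex.log ((1 + η s / ξ t) / (1 - η s / ξ t))) (𝓝[<] σ)
        (𝓝 (Complex.log ((1 + η σ / ξ t) / (1 - η σ / ξ t)))) :=
      (hder σ hσ1).continuousAt.tendsto.mono_left nhdsWithin_le_nhds
    rw [intervalIntegral.integral_eq_sub_of_hasDerivAt_of_tendsto hσ0
      (fun s hs => hder s (hin s ⟨hs.1, hs.2.le⟩)) ?_ hl0 hlσ, sub_zero]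
    refine iη'.mul_continuousOn ?_
    rw [uIcc_of_le hσ0.le]
    exact continuousOn_const.mul ((cinv t ht).mono (Icc_subset_Icc_right hσT.le))
  -- With `σ` fixed and `ξ t → 0`, the argument tends to `-1` from below the real axis, where the
  -- principal logarithm tends to `-π i`.
  have hlog : Tendsto (fun t => Complex.log ((1 + η σ / ξ t) / (1 - η σ / ξ t))) (𝓝[>] 0)
      (𝓝 (-(Real.pi * Complex.I))) := by
    have h1 := Complex.tendsto_log_nhdsWithin_im_neg_of_re_neg_of_im_zero (z := -1)
      (by norm_num) (by norm_num)
    rw [norm_neg, norm_one, Real.log_one, Complex.ofReal_zero, zero_sub] at h1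
    refine h1.comp (tendsto_nhdsWithin_iff.2 ⟨?_, ?_⟩)
    · have h2 := hξlim.div_const (η σ)
      rw [zero_div] at h2
      have h3 := (h2.add_const 1).div (h2.sub_const 1) (by norm_num)
      norm_num at h3
      refine h3.congr' ?_
      filter_upwards [Ioo_mem_nhdsGT hδ₁0] with t ht
      have a1 := hξ0 t ht
      have a2 := hη0 σ hσ1
      have e1 : ξ t / η σ + 1 = (1 + η σ / ξ t) * (ξ t / η σ) := by field_simp
      have e2 : ξ t / η σ - 1 = (1 - η σ / ξ t) * (ξ t / η σ) := by field_simp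
      simp only [Pi.div_apply]
      rw [e1, e2, mul_div_mul_right _ _ (div_ne_zero a1 a2)]
    · filter_upwards [Ioo_mem_nhdsGT hδ₁0] with t ht
      have hq := him t ht σ hσ1
      set q := η σ / ξ t
      have h3 : ((1 + q) / (1 - q)).im = 2 * q.im / Complex.normSq (1 - q) := by
        rw [Complex.div_im]
        simp
        ring
      have h1 : 1 - q ≠ 0 := fun h0 => by
        have := congrArg Complex.im h0; simp at this; linarith
      change ((1 + q) / (1 - q)).im < 0
      rw [h3]
      exact div_neg_of_neg_of_pos (by linarith) (Complex.normSq_pos.2 h1)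
  -- the error term
  have herr : Tendsto (fun t => μ t * (∫ s in 0..σ, rootDensity p Y m' s * (X t - Y s)⁻¹)
      - ∫ s in 0..σ, η' s * (2 * ξ t * (X t - Y s)⁻¹)) (𝓝[>] 0) (𝓝 0) := by
    have hbound : ∀ᶠ t in 𝓝[>] (0 : ℝ),
        ‖μ t * (∫ s in 0..σ, rootDensity p Y m' s * (X t - Y s)⁻¹)
          - ∫ s in 0..σ, η' s * (2 * ξ t * (X t - Y s)⁻¹)‖ ≤
        ‖ξ t‖ * (4 * K * ∫ s in 0..σ, ‖η' s‖) := by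
      filter_upwards [Ioo_mem_nhdsGT hδ₁0] with t ht
      have hcs := (cinv t ht).mono (Icc_subset_Icc_right hσT.le)
      have i1 := (hY.intervalIntegrable_sub le_rfl hσ0.le hσT.le hcs).const_mul (μ t)
      have i2 : IntervalIntegrable (fun s => η' s * (2 * ξ t * (X t - Y s)⁻¹))
          MeasureTheory.volume 0 σ := by
        refine iη'.mul_continuousOn ?_
        rw [uIcc_of_le hσ0.le]
        exact continuousOn_const.mul hcs
      rw [← intervalIntegral.integral_const_mul, ← intervalIntegral.integral_sub i1 i2,
        ← mul_assoc, ← intervalIntegral.integral_const_mul]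
      refine intervalIntegral.norm_integral_le_of_norm_le hσ0.le ?_ (iη'.norm.const_mul _)
      refine Eventually.of_forall fun s hs => ?_
      have hs' := hin s hs
      have hRs := hRY s hs'
      have hne : X t - Y s ≠ 0 :=
        sub_ne_zero.2 (hXY t ⟨ht.1, (htX t ht).2.le⟩ s
          (Ioo_subset_Icc_self (htY s hs'))).symm
      have hμ : μ t = ξ t * (c₀ * R (X t)) := by
        rw [hξ]; have := hRX t ht; field_simp
      have e : μ t * (rootDensity p Y m' s * (X t - Y s)⁻¹)
          - η' s * (2 * ξ t * (X t - Y s)⁻¹) =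
          ξ t * η' s * (2 * (R (X t) - R (Y s)) * (R (Y s))⁻¹ * (X t - Y s)⁻¹) := by
        rw [hμ, hη']
        field_simp
      rw [e, norm_mul, norm_mul]
      -- The Lipschitz bound cancels the pole `1 / (X - Y)`; the prefactor `ξ t` then sends the
      -- error to zero.
      have hlip : ‖R (X t) - R (Y s)‖ ≤ K * ‖X t - Y s‖ := by
        have := hK.dist_le_mul _ (hb ht).1.1.1 _ (hb hs').1.2.1
        rwa [dist_eq_norm, dist_eq_norm] at this
      have h2 : ‖2 * (R (X t) - R (Y s)) * (R (Y s))⁻¹ * (X t - Y s)⁻¹‖ ≤ 4 * K := by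
        rw [norm_mul, norm_mul, norm_mul, norm_inv, norm_inv]
        have hpos : 0 < ‖X t - Y s‖ := norm_pos_iff.2 hne
        have hRl := hRlow _ (hb hs').1.2.2.1
        rw [← div_eq_mul_inv, ← div_eq_mul_inv, div_div, div_le_iff₀ (by positivity)]
        have h4 : (K : ℝ) * ‖X t - Y s‖ ≤ 2 * ‖R (Y s)‖ * (K * ‖X t - Y s‖) := by
          have : 0 ≤ (K : ℝ) * ‖X t - Y s‖ := by positivity
          nlinarith
        have h5 : ‖(2 : ℂ)‖ = 2 := by simp
        rw [h5]
        linarith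
      calc ‖ξ t‖ * ‖η' s‖ * ‖2 * (R (X t) - R (Y s)) * (R (Y s))⁻¹ * (X t - Y s)⁻¹‖
          ≤ ‖ξ t‖ * ‖η' s‖ * (4 * K) := by gcongr
        _ = ‖ξ t‖ * (4 * K) * ‖η' s‖ := by ring
    refine squeeze_zero_norm' hbound ?_
    simpa using hξlim.norm.mul_const (4 * (K : ℝ) * ∫ s in 0..σ, ‖η' s‖)
  -- the far part
  have hfar : Tendsto (fun t => μ t * ∫ s in σ..T', rootDensity p Y m' s * (X t - Y s)⁻¹)
      (𝓝[>] 0) (𝓝 0) := by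
    have h1 := (hY.hasDerivAt_cauchy hσ0.le hσT.le le_rfl (x := z)
      fun s hs => hinj s ⟨hσ0.trans_le hs.1, hs.2⟩).continuousAt.tendsto.comp hX.tendsto_left
    simpa using hX.tendsto_root_left.mul h1
  have hsum := (herr.add hlog).add hfar
  rw [zero_add, add_zero] at hsum
  refine hsum.congr' ?_
  filter_upwards [Ioo_mem_nhdsGT hδ₁0] with t ht
  rw [hmain t ht, sub_add_cancel, ← mul_add, intervalIntegral.integral_add_adjacent_intervals]
  · exact hY.intervalIntegrable_sub le_rfl hσ0.le hσT.le
      ((cinv t ht).mono (Icc_subset_Icc_right hσT.le))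
  · exact hY.intervalIntegrable_sub hσ0.le hσT.le le_rfl
      ((cinv t ht).mono (Icc_subset_Icc_left hσ0.le))

/-- Legendre's relation for the periods along two root arcs with a common end point. -/
theorem legendre {w w' : ℂ} {T T' : ℝ} {X μ m Y μ' m' : ℝ → ℂ}
    (hX : IsRootArc p z w T X μ m) (hY : IsRootArc p z w' T' Y μ' m')
    (hz' : cubicDeriv p z ≠ 0) (hinj : ∀ s ∈ Ioc 0 T', Y s ≠ z)
    (hXY : ∀ t ∈ Ioc 0 T, ∀ s ∈ Icc 0 T', Y s ≠ X t)
    (hsec : ∃ c > 0, c ≤ 1 ∧ ∃ δ > 0, ∀ t ∈ Ioo 0 δ, ∀ s ∈ Ioo 0 δ,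
      (μ' s / μ t).im ≤ -c * ‖μ' s / μ t‖) :
    2 * ((∫ t in 0..T, rootDensity p X m t * X t) * (∫ s in 0..T', rootDensity p Y m' s)
      - (∫ t in 0..T, rootDensity p X m t) * (∫ s in 0..T', rootDensity p Y m' s * Y s))
      = Real.pi * Complex.I := by
  have hT := hX.length_pos
  have hT' := hY.length_pos
  set ω := ∫ s in 0..T', rootDensity p Y m' s
  set η := ∫ s in 0..T', rootDensity p Y m' s * Y s
  have i1 := hX.intervalIntegrable_sub le_rfl hT.le le_rfl hX.continuousOn
  have i0 := hX.intervalIntegrable_density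
  -- By the equation of the Cauchy integral `C`, the integrand is the derivative of `√V(X) C(X)`.
  -- The boundary values are `0` at `w`, where the root vanishes and `C` is regular, and `-π i` at
  -- `z`.
  have key : ∫ t in 0..T, 2 * ω * (rootDensity p X m t * X t) - 2 * η * rootDensity p X m t
      = 0 - -(Real.pi * Complex.I) := by
    refine intervalIntegral.integral_eq_sub_of_hasDerivAt_of_tendsto hT
      (f := fun t => μ t * ∫ s in 0..T', rootDensity p Y m' s * (X t - Y s)⁻¹) ?_
      ((i1.const_mul _).sub (i0.const_mul _))
      (hX.tendsto_root_mul_cauchy hY hz' hinj hXY hsec) ?_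
    · intro t ht
      have hne := hXY t (Ioo_subset_Ioc_self ht)
      have h1 := (hY.hasDerivAt_cauchy le_rfl hT'.le le_rfl hne).scomp t (hX.hasDerivAt t ht)
      have h2 := hY.cauchy_ode hne
      refine ((hX.root_hasDerivAt ht).mul h1).congr_deriv ?_
      have hμ := hX.root_ne_zero t ht
      have hV := hX.potential_ne_zero ht
      have h3 : m t = rootDensity p X m t * cubicPotential p (X t) := by
        rw [rootDensity]; field_simp
      simp only [smul_eq_mul, Function.comp_apply]
      have h4 : ∀ a : ℂ, μ t * (m t / μ t * a) = m t * a := fun a => by field_simp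
      rw [h4]
      conv_lhs => rw [h3]
      linear_combination rootDensity p X m t * h2
    · have h1 := (hY.hasDerivAt_cauchy le_rfl hT'.le le_rfl (x := w) (by
        rw [← hX.target]; exact hXY T ⟨hT, le_rfl⟩)).continuousAt.tendsto.comp hX.tendsto_right
      simpa using hX.tendsto_root_right.mul h1
  rw [intervalIntegral.integral_sub (i1.const_mul _) (i0.const_mul _),
    intervalIntegral.integral_const_mul, intervalIntegral.integral_const_mul] at key
  linear_combination key

end IsRootArc

/-! ### Affine transport of the internal lines. -/

/-- The derivative of the affine motion of an arc whose end points move from `z, w` to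
`ζ p, ζ' p`. -/
def moveScale (z w : ℂ) (ζ ζ' : ℂ × ℂ → ℂ) (p : ℂ × ℂ) : ℂ := (ζ' p - ζ p) / (w - z)

/-- The displacement of the initial point, up to scale. -/
def moveShift (z w : ℂ) (ζ ζ' : ℂ × ℂ → ℂ) (p : ℂ × ℂ) : ℂ := ζ p / moveScale z w ζ ζ' p - z

/-- The part of `√(V(φ x; p) / V(x; p₀))` which depends on `x`. -/
def moveRoot (z w : ℂ) (γ : ℝ → ℂ) (y : ℂ) (t : ℝ) : ℂ :=
  (1 + y * (3 / (γ t + z + w))) ^ (1 / 2 : ℂ)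

/-- The speed of the moved arc. -/
def moveSpeed (z w : ℂ) (γ : ℝ → ℂ) (s : ℂ) (ζ ζ' : ℂ × ℂ → ℂ) (p : ℂ × ℂ) (t : ℝ) : ℂ :=
  s * (moveScale z w ζ ζ' p ^ (1 / 2 : ℂ)) ^ 5 * moveRoot z w γ (moveShift z w ζ ζ' p) t

/-- The quotient of the root on the moved arc by the root on the original arc. -/
def moveFactor (z w : ℂ) (γ : ℝ → ℂ) (ζ ζ' : ℂ × ℂ → ℂ) (p : ℂ × ℂ) (t : ℝ) : ℂ :=
  (moveScale z w ζ ζ' p ^ (1 / 2 : ℂ)) ^ 3 * moveRoot z w γ (moveShift z w ζ ζ' p) t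

/-- An internal Stokes line, with a continuous branch of the root on it, whose end points depend
holomorphically on the parameters. -/
structure IsMovingLine (p₀ : ℂ × ℂ) (z w : ℂ) (T : ℝ) (γ : ℝ → ℂ) (f : ℂ → ℂ) (s : ℂ)
    (ζ ζ' : ℂ × ℂ → ℂ) : Prop where
  line : IsInternalStokesLine p₀ z w T γ
  turning_source : cubicPotential p₀ z = 0
  turning_target : cubicPotential p₀ w = 0
  ne : z ≠ w
  simple_source : cubicDeriv p₀ z ≠ 0
  simple_target : cubicDeriv p₀ w ≠ 0
  continuousOn_root : ContinuousOn (fun t => f (γ t)) (Ioo 0 T)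
  root_sq : ∀ t ∈ Ioo 0 T, f (γ t) ^ 2 = cubicPotential p₀ (γ t)
  root_mul_deriv : ∀ t ∈ Ioo 0 T, f (γ t) * deriv γ t = s
  analytic_source : AnalyticAt ℂ ζ p₀
  analytic_target : AnalyticAt ℂ ζ' p₀
  value_source : ζ p₀ = z
  value_target : ζ' p₀ = w
  eventually_source : ∀ᶠ p in 𝓝 p₀, cubicPotential p (ζ p) = 0
  eventually_target : ∀ᶠ p in 𝓝 p₀, cubicPotential p (ζ' p) = 0

namespace IsMovingLine

variable {p₀ : ℂ × ℂ} {z w : ℂ} {T : ℝ} {γ : ℝ → ℂ} {f : ℂ → ℂ} {s : ℂ} {ζ ζ' : ℂ × ℂ → ℂ}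

/-- The zero of this factor is the third turning point `-z-w`: it differs from the ends because they
are simple zeros, and from interior points because `V` does not vanish there. -/
theorem third_ne_zero (h : IsMovingLine p₀ z w T γ f s ζ ζ') {t : ℝ} (ht : t ∈ Icc 0 T) :
    γ t + z + w ≠ 0 := by
  have hc := cubic_coeff_of_roots h.turning_source h.turning_target h.ne
  have h1 := h.simple_source
  have h2 := h.simple_target
  rw [cubicDeriv_eq_of_coeff hc.1] at h1 h2
  intro h0
  rcases eq_endpoints_or_mem_Ioo_of_mem_Icc ht with rfl | rfl | ht
  · rw [h.line.source] at h0
    apply h1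
    linear_combination 4 * (z - w) * h0
  · rw [h.line.target] at h0
    apply h2
    linear_combination 4 * (w - z) * h0
  · apply h.line.stokes.potential_ne_zero ht
    rw [cubicPotential_eq_of_coeff hc, h0, mul_zero]

theorem continuousOn_shape (h : IsMovingLine p₀ z w T γ f s ζ ζ') :
    ContinuousOn (fun t => 3 / (γ t + z + w)) (Icc 0 T) :=
  continuousOn_const.div ((h.line.continuousOn.add continuousOn_const).add continuousOn_const)
    fun _ ht => h.third_ne_zero ht

theorem exists_bound (h : IsMovingLine p₀ z w T γ f s ζ ζ') :
    ∃ M > 0, ∀ t ∈ Icc 0 T, ‖3 / (γ t + z + w)‖ ≤ M := by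
  obtain ⟨M, hM⟩ := isCompact_Icc.exists_bound_of_continuousOn h.continuousOn_shape
  exact ⟨max M 1, by positivity, fun t ht => (hM t ht).trans (le_max_left _ _)⟩

theorem exists_root_bound (h : IsMovingLine p₀ z w T γ f s ζ ζ') {η : ℝ} (hη : 0 < η) :
    ∃ ε > 0, ∀ y : ℂ, ‖y‖ < ε → ∀ t ∈ Icc 0 T,
      1 + y * (3 / (γ t + z + w)) ∈ Complex.slitPlane ∧ ‖moveRoot z w γ y t - 1‖ < η := by
  obtain ⟨M, hM0, hM⟩ := h.exists_bound
  have hone : (1 : ℂ) ∈ Complex.slitPlane := by simp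
  have h1 : Tendsto (fun v : ℂ => v ^ (1 / 2 : ℂ)) (𝓝 1) (𝓝 1) := by
    have := (continuousAt_cpow_const (b := 1 / 2) hone).tendsto
    rwa [Complex.one_cpow] at this
  have h2 : ∀ᶠ v in 𝓝 (1 : ℂ), v ∈ Complex.slitPlane ∧ ‖v ^ (1 / 2 : ℂ) - 1‖ < η := by
    refine (eventually_mem_set.2 (Complex.isOpen_slitPlane.mem_nhds hone)).and ?_
    simpa [dist_eq_norm] using h1.eventually (Metric.ball_mem_nhds 1 hη)
  obtain ⟨r, hr, hball⟩ := Metric.eventually_nhds_iff_ball.1 h2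
  refine ⟨r / M, div_pos hr hM0, fun y hy t ht => hball _ ?_⟩
  rw [Metric.mem_ball, dist_eq_norm, add_sub_cancel_left, norm_mul]
  rw [lt_div_iff₀ hM0] at hy
  exact (mul_le_mul_of_nonneg_left (hM t ht) (norm_nonneg _)).trans_lt hy

theorem scale_self (h : IsMovingLine p₀ z w T γ f s ζ ζ') : moveScale z w ζ ζ' p₀ = 1 := by
  rw [moveScale, h.value_source, h.value_target, div_self (sub_ne_zero.2 h.ne.symm)]

theorem shift_self (h : IsMovingLine p₀ z w T γ f s ζ ζ') : moveShift z w ζ ζ' p₀ = 0 := by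
  rw [moveShift, h.scale_self, h.value_source, div_one, sub_self]

theorem analytic_scale {p : ℂ × ℂ} (h1 : AnalyticAt ℂ ζ p) (h2 : AnalyticAt ℂ ζ' p) :
    AnalyticAt ℂ (moveScale z w ζ ζ') p := (h2.sub h1).div_const

theorem analytic_shift {p : ℂ × ℂ} (h1 : AnalyticAt ℂ ζ p) (h2 : AnalyticAt ℂ ζ' p)
    (h0 : moveScale z w ζ ζ' p ≠ 0) : AnalyticAt ℂ (moveShift z w ζ ζ') p :=
  (h1.div (analytic_scale h1 h2) h0).sub analyticAt_const

/-- The parameters `p` for which the motion of the line is controlled with precision `η`. -/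
structure IsGood (z w : ℂ) (T : ℝ) (γ : ℝ → ℂ) (ζ ζ' : ℂ × ℂ → ℂ) (ε η : ℝ) (p : ℂ × ℂ) :
    Prop where
  turning_source : cubicPotential p (ζ p) = 0
  turning_target : cubicPotential p (ζ' p) = 0
  analytic_source : AnalyticAt ℂ ζ p
  analytic_target : AnalyticAt ℂ ζ' p
  scale_mem : moveScale z w ζ ζ' p ∈ Complex.slitPlane
  scale_sub : ‖moveScale z w ζ ζ' p - 1‖ < η
  shift_lt : ‖moveShift z w ζ ζ' p‖ < ε
  mem_slitPlane : ∀ y : ℂ, ‖y‖ < ε → ∀ t ∈ Icc 0 T,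
    1 + y * (3 / (γ t + z + w)) ∈ Complex.slitPlane
  factor_sub : ∀ t ∈ Icc 0 T, ‖moveFactor z w γ ζ ζ' p t - 1‖ < η

theorem eventually_isGood (h : IsMovingLine p₀ z w T γ f s ζ ζ') {η : ℝ} (hη : 0 < η) :
    ∃ ε > 0, ∀ᶠ p in 𝓝 p₀, IsGood z w T γ ζ ζ' ε η p := by
  -- If both factors are within `θ ≤ 1` of `1`, the product is within `θ² + 2θ ≤ 3θ ≤ η`.
  set θ := min (η / 3) 1 with hθ
  have hθ0 : 0 < θ := lt_min (by linarith) one_pos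
  have hθ1 : θ ≤ 1 := min_le_right _ _
  have hθ2 : θ ≤ η / 3 := min_le_left _ _
  obtain ⟨ε, hε, hroot⟩ := h.exists_root_bound hθ0
  have hone : (1 : ℂ) ∈ Complex.slitPlane := by simp
  have a1 := analytic_scale (z := z) (w := w) h.analytic_source h.analytic_target
  have hk0 : moveScale z w ζ ζ' p₀ ≠ 0 := by rw [h.scale_self]; exact one_ne_zero
  have a2 := analytic_shift h.analytic_source h.analytic_target hk0
  have t1 : Tendsto (moveScale z w ζ ζ') (𝓝 p₀) (𝓝 1) := by
    simpa [h.scale_self] using a1.continuousAt.tendsto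
  have t2 : Tendsto (moveShift z w ζ ζ') (𝓝 p₀) (𝓝 0) := by
    simpa [h.shift_self] using a2.continuousAt.tendsto
  have t3 : Tendsto (fun p => (moveScale z w ζ ζ' p ^ (1 / 2 : ℂ)) ^ 3) (𝓝 p₀) (𝓝 1) := by
    have := ((continuousAt_cpow_const (b := 1 / 2) hone).tendsto.comp t1).pow 3
    rw [Complex.one_cpow, one_pow] at this
    exact this
  have e3 : ∀ᶠ p in 𝓝 p₀, ‖(moveScale z w ζ ζ' p ^ (1 / 2 : ℂ)) ^ 3 - 1‖ < θ := by
    simpa [dist_eq_norm] using t3.eventually (Metric.ball_mem_nhds 1 hθ0)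
  refine ⟨ε, hε, ?_⟩
  filter_upwards [h.eventually_source, h.eventually_target,
    h.analytic_source.eventually_analyticAt, h.analytic_target.eventually_analyticAt,
    t1.eventually (Complex.isOpen_slitPlane.mem_nhds hone),
    t1.eventually (Metric.ball_mem_nhds 1 hη),
    t2.eventually (Metric.ball_mem_nhds 0 hε), e3] with p h1 h2 h3 h4 h5 h6 h7 h8
  rw [dist_eq_norm] at h6
  rw [dist_zero_right] at h7
  refine ⟨h1, h2, h3, h4, h5, h6, h7, fun y hy t ht => (hroot y hy t ht).1, fun t ht => ?_⟩
  have h9 := (hroot _ h7 t ht).2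
  rw [moveFactor]
  set a := (moveScale z w ζ ζ' p ^ (1 / 2 : ℂ)) ^ 3
  set b := moveRoot z w γ (moveShift z w ζ ζ' p) t
  have e : a * b - 1 = (a - 1) * (b - 1) + (a - 1) + (b - 1) := by ring
  rw [e]
  calc ‖(a - 1) * (b - 1) + (a - 1) + (b - 1)‖ ≤ ‖a - 1‖ * ‖b - 1‖ + ‖a - 1‖ + ‖b - 1‖ := by
        refine (norm_add_le _ _).trans (add_le_add_left ((norm_add_le _ _).trans ?_) _)
        rw [norm_mul]
    _ < η := by nlinarith [norm_nonneg (a - 1), norm_nonneg (b - 1)]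

namespace IsGood

variable {ε η : ℝ} {p : ℂ × ℂ}

theorem scale_ne_zero (g : IsGood z w T γ ζ ζ' ε η p) : moveScale z w ζ ζ' p ≠ 0 :=
  Complex.slitPlane_ne_zero g.scale_mem

theorem ends_ne (g : IsGood z w T γ ζ ζ' ε η p) : ζ p ≠ ζ' p := fun h => by
  apply g.scale_ne_zero
  rw [moveScale, h, sub_self, zero_div]

theorem factor_ne_zero (g : IsGood z w T γ ζ ζ' ε η p) {t : ℝ} (ht : t ∈ Icc 0 T) :
    moveFactor z w γ ζ ζ' p t ≠ 0 := by
  refine mul_ne_zero (pow_ne_zero 3 ?_) ?_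
  · intro h0
    have := Complex.sqrt_sq (moveScale z w ζ ζ' p)
    rw [h0] at this
    exact g.scale_ne_zero (by rw [← this]; norm_num)
  · intro h0
    have := Complex.sqrt_sq (1 + moveShift z w ζ ζ' p * (3 / (γ t + z + w)))
    rw [← moveRoot, h0] at this
    exact Complex.slitPlane_ne_zero (g.mem_slitPlane _ g.shift_lt t ht) (by rw [← this]; norm_num)

theorem factor_sq (p : ℂ × ℂ) (t : ℝ) : moveFactor z w γ ζ ζ' p t ^ 2 =
    moveScale z w ζ ζ' p ^ 3 * (1 + moveShift z w ζ ζ' p * (3 / (γ t + z + w))) := by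
  rw [moveFactor, mul_pow, ← pow_mul, mul_comm 3 2, pow_mul, Complex.sqrt_sq, moveRoot,
    Complex.sqrt_sq]

theorem affineMove_eq (x : ℂ) : affineMove z w (ζ p) (ζ' p) x =
    ζ p + (x - z) * moveScale z w ζ ζ' p := rfl

/-- The affine map carries two turning points to turning points, so two linear factors are merely
scaled by `k`. The third becomes `k (x + z + w + 3y)`, with `k` the scale and `y` the shift; all
dependence of the ratio on `x` lies there. -/
theorem potential_move (h : IsMovingLine p₀ z w T γ f s ζ ζ') (g : IsGood z w T γ ζ ζ' ε η p)
    {t : ℝ} (ht : t ∈ Icc 0 T) :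
    cubicPotential p (affineMove z w (ζ p) (ζ' p) (γ t)) = cubicPotential p₀ (γ t) *
      (moveScale z w ζ ζ' p ^ 3 * (1 + moveShift z w ζ ζ' p * (3 / (γ t + z + w)))) := by
  have hk := g.scale_ne_zero
  have h1 : ζ' p = ζ p + (w - z) * moveScale z w ζ ζ' p := by
    rw [moveScale, mul_div_cancel₀ _ (sub_ne_zero.2 h.ne.symm)]; ring
  have hu := h.third_ne_zero ht
  rw [cubicPotential_eq_of_coeff
    (cubic_coeff_of_roots g.turning_source g.turning_target g.ends_ne),
    cubicPotential_eq_of_coeff (cubic_coeff_of_roots h.turning_source h.turning_target h.ne),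
    affineMove_eq, moveShift]
  set k := moveScale z w ζ ζ' p
  rw [h1]
  field_simp
  ring

/-- `moveFactor` is a square root of the ratio within distance `1` of `1`; having positive real
part, it is the principal one. -/
theorem continuedSqrt_eq (h : IsMovingLine p₀ z w T γ f s ζ ζ') (hη : η ≤ 1)
    (g : IsGood z w T γ ζ ζ' ε η p) {t : ℝ} (ht : t ∈ Ioo 0 T) :
    continuedSqrt p₀ p f (affineMove z w (ζ p) (ζ' p)) (γ t) =
      f (γ t) * moveFactor z w γ ζ ζ' p t := by
  have ht' := Ioo_subset_Icc_self ht
  rw [continuedSqrt, g.potential_move h ht',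
    mul_div_cancel_left₀ _ (h.line.stokes.potential_ne_zero ht), ← factor_sq]
  rw [Complex.sqrt_eq_of_sq_eq rfl]
  have h1 := g.factor_sub t ht'
  have h2 := (Complex.abs_re_le_norm (moveFactor z w γ ζ ζ' p t - 1)).trans_lt h1
  rw [Complex.sub_re, Complex.one_re, abs_lt] at h2
  linarith

theorem continuousOn_moveRoot (h : IsMovingLine p₀ z w T γ f s ζ ζ')
    (g : IsGood z w T γ ζ ζ' ε η p) {y : ℂ} (hy : ‖y‖ < ε) :
    ContinuousOn (moveRoot z w γ y) (Icc 0 T) :=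
  ContinuousOn.cpow_const (continuousOn_const.add (continuousOn_const.mul h.continuousOn_shape))
    fun t ht => g.mem_slitPlane y hy t ht

theorem move_hasDerivAt (h : IsMovingLine p₀ z w T γ f s ζ ζ') (p : ℂ × ℂ)
    {t : ℝ} (ht : t ∈ Ioo 0 T) :
    HasDerivAt (fun t => affineMove z w (ζ p) (ζ' p) (γ t))
      (deriv γ t * moveScale z w ζ ζ' p) t :=
  ((((h.line.stokes.differentiableAt t ht).hasDerivAt.sub_const z).mul_const
    (moveScale z w ζ ζ' p)).const_add (ζ p))

/-- The root and the velocity are singular or zero at the ends, but their product on the original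
line is the constant `s`. After the motion it gains `k^{3/2}` from the root and `k` from the
velocity, besides the regular factor `moveRoot`. -/
theorem factor_mul_deriv (h : IsMovingLine p₀ z w T γ f s ζ ζ') (p : ℂ × ℂ)
    {t : ℝ} (ht : t ∈ Ioo 0 T) :
    f (γ t) * moveFactor z w γ ζ ζ' p t * (deriv γ t * moveScale z w ζ ζ' p) =
      moveSpeed z w γ s ζ ζ' p t := by
  rw [moveSpeed, moveFactor, ← h.root_mul_deriv t ht]
  have hk := Complex.sqrt_sq (moveScale z w ζ ζ' p)
  set a := moveScale z w ζ ζ' p ^ (1 / 2 : ℂ)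
  linear_combination
    -(f (γ t) * a ^ 3 * moveRoot z w γ (moveShift z w ζ ζ' p) t * deriv γ t) * hk

theorem isRootArc (h : IsMovingLine p₀ z w T γ f s ζ ζ') (g : IsGood z w T γ ζ ζ' ε η p) :
    IsRootArc p (ζ p) (ζ' p) T (fun t => affineMove z w (ζ p) (ζ' p) (γ t))
      (fun t => f (γ t) * moveFactor z w γ ζ ζ' p t) (moveSpeed z w γ s ζ ζ' p) where
  length_pos := h.line.length_pos
  continuousOn := by
    unfold affineMove
    exact continuousOn_const.add ((h.line.continuousOn.sub continuousOn_const).mul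
      continuousOn_const)
  source := by rw [h.line.source, affineMove]; ring
  target := by
    rw [h.line.target, affineMove, mul_div_cancel₀ _ (sub_ne_zero.2 h.ne.symm)]; ring
  turning_source := g.turning_source
  turning_target := g.turning_target
  hasDerivAt t ht := by
    refine (move_hasDerivAt h p ht).congr_deriv ?_
    rw [← factor_mul_deriv h p ht, mul_div_cancel_left₀]
    refine mul_ne_zero (fun h0 => ?_) (g.factor_ne_zero (Ioo_subset_Icc_self ht))
    have := h.root_sq t ht
    rw [h0] at this
    exact h.line.stokes.potential_ne_zero ht (by rw [← this]; norm_num)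
  continuousOn_root := h.continuousOn_root.mul (continuousOn_const.mul
    ((continuousOn_moveRoot h g g.shift_lt).mono Ioo_subset_Icc_self))
  root_sq t ht := by
    rw [mul_pow, h.root_sq t ht, factor_sq, g.potential_move h (Ioo_subset_Icc_self ht)]
  root_ne_zero t ht := by
    refine mul_ne_zero (fun h0 => ?_) (g.factor_ne_zero (Ioo_subset_Icc_self ht))
    have := h.root_sq t ht
    rw [h0] at this
    exact h.line.stokes.potential_ne_zero ht (by rw [← this]; norm_num)
  continuousOn_speed := continuousOn_const.mul (continuousOn_moveRoot h g g.shift_lt)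
  integrable := by
    have h1 := h.line.intervalIntegrable_inv h.turning_source h.simple_source h.turning_target
      h.simple_target
    have h2 : ContinuousOn (fun t => (moveFactor z w γ ζ ζ' p t ^ 2)⁻¹) (uIcc 0 T) := by
      rw [uIcc_of_le h.line.length_pos.le]
      exact ((continuousOn_const.mul (continuousOn_moveRoot h g g.shift_lt)).pow 2).inv₀
        fun t ht => pow_ne_zero 2 (g.factor_ne_zero ht)
    refine (h1.mul_continuousOn h2).congr_uIoo fun t ht => ?_
    rw [uIoo_of_le h.line.length_pos.le] at ht
    simp only
    rw [g.potential_move h (Ioo_subset_Icc_self ht), ← factor_sq, mul_inv]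

end IsGood

end IsMovingLine

/-! ### Holomorphy and derivatives of the periods. -/

/-- The derivative of a holomorphic function along a complex line. -/
theorem AnalyticAt.hasDerivAt_line {E E' : Type*} [NormedAddCommGroup E] [NormedSpace ℂ E]
    [NormedAddCommGroup E'] [NormedSpace ℂ E'] {F : E → E'} {p : E} (hF : AnalyticAt ℂ F p)
    (v : E) : HasDerivAt (fun τ : ℂ => F (p + τ • v)) (fderiv ℂ F p v) 0 := by
  have hline : HasDerivAt (fun τ : ℂ => p + τ • v) v 0 := by
    simpa using ((hasDerivAt_id (0 : ℂ)).smul_const v).const_add p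
  have h1 : HasFDerivAt F (fderiv ℂ F p) (p + (0 : ℂ) • v) := by
    rw [zero_smul, add_zero]; exact hF.differentiableAt.hasFDerivAt
  exact h1.comp_hasDerivAt (0 : ℂ) hline

namespace IsMovingLine

variable {p₀ : ℂ × ℂ} {z w : ℂ} {T : ℝ} {γ : ℝ → ℂ} {f : ℂ → ℂ} {s : ℂ} {ζ ζ' : ℂ × ℂ → ℂ}

namespace IsGood

variable {ε η : ℝ} {p : ℂ × ℂ}

/-- On the way back both the sheet and the direction of travel change sign, so the two halves of the
cycle contribute equally. -/
theorem sqrtPeriod_eq (h : IsMovingLine p₀ z w T γ f s ζ ζ') (hη : η ≤ 1)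
    (g : IsGood z w T γ ζ ζ' ε η p) :
    sqrtPeriod p₀ p f T γ (affineMove z w (ζ p) (ζ' p)) =
      2 * ∫ t in 0..T, moveSpeed z w γ s ζ ζ' p t := by
  have hT := h.line.length_pos
  set φ := affineMove z w (ζ p) (ζ' p) with hφ
  set m := moveSpeed z w γ s ζ ζ' p with hm
  have hmc : ContinuousOn m (Icc 0 T) :=
    continuousOn_const.mul (continuousOn_moveRoot h g g.shift_lt)
  have i1 : IntervalIntegrable m MeasureTheory.volume 0 T :=
    ContinuousOn.intervalIntegrable (by rwa [uIcc_of_le hT.le])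
  have i2 : IntervalIntegrable (fun t => m (2 * T - t)) MeasureTheory.volume T (2 * T) := by
    have := i1.comp_sub_left (2 * T)
    rw [show 2 * T - 0 = 2 * T by ring, show 2 * T - T = T by ring] at this
    exact this.symm
  have e1 : EqOn m (fun t => cycleSheet p₀ p f T γ φ t * deriv (cyclePoint T γ φ) t)
      (uIoo 0 T) := by
    intro t ht
    rw [uIoo_of_le hT.le] at ht
    have hd : deriv (cyclePoint T γ φ) t = deriv γ t * moveScale z w ζ ζ' p := by
      refine HasDerivAt.deriv ((move_hasDerivAt h p ht).congr_of_eventuallyEq ?_)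
      filter_upwards [Iio_mem_nhds ht.2] with x hx
      rw [cyclePoint, if_pos (le_of_lt hx)]
    simp only
    rw [hd, cycleSheet, if_pos ht.2.le, g.continuedSqrt_eq h hη ht, factor_mul_deriv h p ht]
  have e2 : EqOn (fun t => m (2 * T - t))
      (fun t => cycleSheet p₀ p f T γ φ t * deriv (cyclePoint T γ φ) t) (uIoo T (2 * T)) := by
    intro t ht
    rw [uIoo_of_le (by linarith)] at ht
    have ht' : 2 * T - t ∈ Ioo 0 T := ⟨by linarith [ht.2], by linarith [ht.1]⟩
    have hd : deriv (cyclePoint T γ φ) t = -(deriv γ (2 * T - t) * moveScale z w ζ ζ' p) := by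
      have h1 := (move_hasDerivAt h p ht').scomp t ((hasDerivAt_id' t).const_sub (2 * T))
      rw [neg_one_smul] at h1
      refine HasDerivAt.deriv (h1.congr_of_eventuallyEq ?_)
      filter_upwards [Ioi_mem_nhds ht.1] with x hx
      rw [cyclePoint, if_neg (not_le_of_gt hx)]
      rfl
    simp only
    rw [hd, cycleSheet, if_neg (not_le_of_gt ht.1), g.continuedSqrt_eq h hη ht', neg_mul_neg,
      factor_mul_deriv h p ht']
  rw [sqrtPeriod, ← intervalIntegral.integral_add_adjacent_intervals (i1.congr_uIoo e1)
    (i2.congr_uIoo e2), ← intervalIntegral.integral_congr_uIoo e1,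
    ← intervalIntegral.integral_congr_uIoo e2, intervalIntegral.integral_comp_sub_left,
    show 2 * T - 2 * T = 0 by ring, show 2 * T - T = T by ring]
  ring

/-- Differentiation of the integral over the moving arc, in the variable `y`. -/
theorem hasDerivAt_integral (h : IsMovingLine p₀ z w T γ f s ζ ζ')
    (g : IsGood z w T γ ζ ζ' ε η p) {y : ℂ} (hy : ‖y‖ < ε) :
    HasDerivAt (fun y => ∫ t in 0..T, moveRoot z w γ y t)
      (∫ t in 0..T, 3 / (γ t + z + w) / (2 * moveRoot z w γ y t)) y := by
  have hT := h.line.length_pos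
  obtain ⟨M, hM0, hM⟩ := h.exists_bound
  -- This keeps the closed ball inside the disc of radius `ε`, so the derivative is jointly
  -- continuous on a compact set and a constant dominates it.
  set r := (ε - ‖y‖) / 2 with hr
  have hr0 : 0 < r := by rw [hr]; linarith
  have hnhds : Metric.closedBall y r ∈ 𝓝 y := Metric.closedBall_mem_nhds y hr0
  have hball : ∀ x ∈ Metric.closedBall y r, ‖x‖ < ε := by
    intro x hx
    rw [Metric.mem_closedBall, dist_eq_norm] at hx
    have := norm_add_le (x - y) y
    rw [sub_add_cancel] at this
    rw [hr] at hx
    linarith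
  have hne : ∀ x, ‖x‖ < ε → ∀ t ∈ Icc 0 T, moveRoot z w γ x t ≠ 0 := by
    intro x hx t ht h0
    have h1 := Complex.re_sqrt_pos (g.mem_slitPlane x hx t ht)
    rw [← moveRoot, h0] at h1
    simp at h1
  have hsub : uIoc 0 T ⊆ Icc 0 T := by rw [uIoc_of_le hT.le]; exact Ioc_subset_Icc_self
  have hjoint : ContinuousOn (fun q : ℂ × ℝ => 3 / (γ q.2 + z + w) / (2 * moveRoot z w γ q.1 q.2))
      (Metric.closedBall y r ×ˢ Icc 0 T) := by
    have hD : ContinuousOn (fun q : ℂ × ℝ => 3 / (γ q.2 + z + w))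
        (Metric.closedBall y r ×ˢ Icc 0 T) :=
      h.continuousOn_shape.comp continuousOn_snd fun q hq => hq.2
    refine hD.div (continuousOn_const.mul ?_) ?_
    · exact ContinuousOn.cpow_const (continuousOn_const.add (continuousOn_fst.mul hD))
        fun q hq => g.mem_slitPlane _ (hball _ hq.1) _ hq.2
    · intro q hq
      exact mul_ne_zero two_ne_zero (hne _ (hball _ hq.1) _ hq.2)
  obtain ⟨C, hC⟩ := ((isCompact_closedBall y r).prod isCompact_Icc).exists_bound_of_continuousOn
    hjoint
  have hint : ∀ x, ‖x‖ < ε → IntervalIntegrable (moveRoot z w γ x) MeasureTheory.volume 0 T :=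
    fun x hx => ContinuousOn.intervalIntegrable (by
      rw [uIcc_of_le hT.le]; exact continuousOn_moveRoot h g hx)
  refine (intervalIntegral.hasDerivAt_integral_of_dominated_loc_of_deriv_le
    (F' := fun y t => 3 / (γ t + z + w) / (2 * moveRoot z w γ y t))
    (bound := fun _ => C) hnhds ?_ (hint y hy) ?_ ?_ intervalIntegrable_const ?_).2
  · filter_upwards [hnhds] with x hx
    exact (hint x (hball x hx)).aestronglyMeasurable_restrict_uIoc
  · have : IntervalIntegrable (fun t => 3 / (γ t + z + w) / (2 * moveRoot z w γ y t))
        MeasureTheory.volume 0 T := by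
      apply ContinuousOn.intervalIntegrable
      rw [uIcc_of_le hT.le]
      exact h.continuousOn_shape.div (continuousOn_const.mul (continuousOn_moveRoot h g hy))
        fun t ht => mul_ne_zero two_ne_zero (hne y hy t ht)
    exact this.aestronglyMeasurable_restrict_uIoc
  · exact Eventually.of_forall fun t ht x hx => hC (x, t) ⟨hx, hsub ht⟩
  · refine Eventually.of_forall fun t ht x hx => ?_
    have hs := g.mem_slitPlane x (hball x hx) t (hsub ht)
    have h1 := ((hasDerivAt_id' x).mul_const (3 / (γ t + z + w))).const_add 1
    have h2 := h1.cpow_const (c := 1 / 2) hs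
    refine h2.congr_deriv ?_
    have h3 : (1 + x * (3 / (γ t + z + w))) ^ (1 / 2 - 1 : ℂ) = (moveRoot z w γ x t)⁻¹ := by
      rw [moveRoot, ← Complex.cpow_neg]; norm_num
    rw [h3]
    have := hne x (hball x hx) t (hsub ht)
    have := h.third_ne_zero (hsub ht)
    field_simp

theorem analyticAt_integral (h : IsMovingLine p₀ z w T γ f s ζ ζ')
    (g : IsGood z w T γ ζ ζ' ε η p) {y : ℂ} (hy : ‖y‖ < ε) :
    AnalyticAt ℂ (fun y => ∫ t in 0..T, moveRoot z w γ y t) y := by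
  have h1 : DifferentiableOn ℂ (fun y => ∫ t in 0..T, moveRoot z w γ y t) (Metric.ball 0 ε) :=
    fun x hx =>
      (hasDerivAt_integral h g (by simpa using hx)).differentiableAt.differentiableWithinAt
  exact h1.analyticAt (Metric.isOpen_ball.mem_nhds (by simpa using hy))

theorem integral_moveSpeed (p : ℂ × ℂ) : 2 * (∫ t in 0..T, moveSpeed z w γ s ζ ζ' p t) =
    2 * s * (moveScale z w ζ ζ' p ^ (1 / 2 : ℂ)) ^ 5 *
      ∫ t in 0..T, moveRoot z w γ (moveShift z w ζ ζ' p) t := by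
  unfold moveSpeed
  rw [intervalIntegral.integral_const_mul]
  ring

/-- The period is `2s k^{5/2}` times a function of the shift `y` alone, holomorphic on a disc; and
`k`, `y` are holomorphic in the turning points. -/
theorem analyticAt_period (h : IsMovingLine p₀ z w T γ f s ζ ζ')
    (g : IsGood z w T γ ζ ζ' ε η p) :
    AnalyticAt ℂ (fun p => 2 * ∫ t in 0..T, moveSpeed z w γ s ζ ζ' p t) p := by
  have h1 := analytic_scale (z := z) (w := w) g.analytic_source g.analytic_target
  have h2 := analytic_shift g.analytic_source g.analytic_target g.scale_ne_zero
  have h3 := AnalyticAt.fun_comp (analyticAt_integral h g g.shift_lt) h2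
  have h4 : AnalyticAt ℂ (fun p => moveScale z w ζ ζ' p ^ (1 / 2 : ℂ)) p :=
    h1.cpow analyticAt_const g.scale_mem
  simp only [integral_moveSpeed]
  exact (analyticAt_const.mul (h4.pow 5)).mul h3

/-- The derivative of the period: the variation of the arc does not contribute. -/
theorem period_hasDerivAt_line (h : IsMovingLine p₀ z w T γ f s ζ ζ')
    (g : IsGood z w T γ ζ ζ' ε η p)
    (hev : ∀ᶠ q in 𝓝 p, IsGood z w T γ ζ ζ' ε η q) (v : ℂ × ℂ) :
    HasDerivAt (fun τ : ℂ => 2 * ∫ t in 0..T, moveSpeed z w γ s ζ ζ' (p + τ • v) t)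
      (∫ t in 0..T, rootDensity p (fun t => affineMove z w (ζ p) (ζ' p) (γ t))
        (moveSpeed z w γ s ζ ζ' p) t *
        (-2 * v.1 * affineMove z w (ζ p) (ζ' p) (γ t) - 28 * v.2)) 0 := by
  have hT := h.line.length_pos
  have hA := g.isRootArc h
  have hline : HasDerivAt (fun τ : ℂ => p + τ • v) v 0 := by
    simpa using ((hasDerivAt_id (0 : ℂ)).smul_const v).const_add p
  have hp0 : p + (0 : ℂ) • v = p := by simp
  have ak := analytic_scale (z := z) (w := w) g.analytic_source g.analytic_target
  have ay := analytic_shift g.analytic_source g.analytic_target g.scale_ne_zero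
  have aκ : AnalyticAt ℂ (fun p => moveScale z w ζ ζ' p ^ (1 / 2 : ℂ)) p :=
    ak.cpow analyticAt_const g.scale_mem
  have hdζ := g.analytic_source.hasDerivAt_line v
  have hdκ := aκ.hasDerivAt_line v
  have hdy := ay.hasDerivAt_line v
  set dζ := fderiv ℂ ζ p v
  set dκ := fderiv ℂ (fun p => moveScale z w ζ ζ' p ^ (1 / 2 : ℂ)) p v
  set dy := fderiv ℂ (moveShift z w ζ ζ') p v
  set k := moveScale z w ζ ζ' p with hk
  set κ := k ^ (1 / 2 : ℂ) with hκ
  set y := moveShift z w ζ ζ' p with hy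
  have hκ2 : κ ^ 2 = k := Complex.sqrt_sq k
  have hk0 : k ≠ 0 := g.scale_ne_zero
  have hκ0 : κ ≠ 0 := fun h0 => hk0 (by rw [← hκ2, h0]; norm_num)
  set S := moveRoot z w γ y with hS
  set D : ℝ → ℂ := fun t => 3 / (γ t + z + w) with hD
  have hS2 : ∀ t, S t ^ 2 = 1 + y * D t := fun t => Complex.sqrt_sq _
  have hSc : ContinuousOn S (Icc 0 T) := continuousOn_moveRoot h g g.shift_lt
  have hS0 : ∀ t ∈ Icc 0 T, S t ≠ 0 := fun t ht h0 => by
    apply Complex.slitPlane_ne_zero (g.mem_slitPlane y g.shift_lt t ht)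
    have := hS2 t
    rw [h0] at this
    rw [← this]; norm_num
  -- the derivative in the form obtained from the formula for the period
  have hdk : HasDerivAt (fun τ : ℂ => moveScale z w ζ ζ' (p + τ • v)) (2 * κ * dκ) 0 := by
    have h1 := hdκ.fun_pow 2
    simp only [Complex.sqrt_sq, hp0] at h1
    refine h1.congr_deriv ?_
    rw [← hk, ← hκ]
    norm_num
  have hΨ := hasDerivAt_integral h g g.shift_lt
  rw [← hy] at hΨ
  have hΨ' : HasDerivAt
      (fun τ : ℂ => ∫ t in 0..T, moveRoot z w γ (moveShift z w ζ ζ' (p + τ • v)) t)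
      ((∫ t in 0..T, D t / (2 * S t)) * dy) 0 := by
    refine HasDerivAt.comp (h₂ := fun y => ∫ t in 0..T, moveRoot z w γ y t) (0 : ℂ) ?_ hdy
    rw [hp0]
    exact hΨ
  have h1 := ((hdκ.fun_pow 5).const_mul (2 * s)).fun_mul hΨ'
  simp only [hp0] at h1
  simp only [integral_moveSpeed]
  refine h1.congr_deriv ?_
  rw [← hκ, ← hy]
  have iS : IntervalIntegrable S MeasureTheory.volume 0 T :=
    ContinuousOn.intervalIntegrable (by rwa [uIcc_of_le hT.le])
  have iD : IntervalIntegrable (fun t => D t / (2 * S t)) MeasureTheory.volume 0 T := by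
    apply ContinuousOn.intervalIntegrable
    rw [uIcc_of_le hT.le]
    exact h.continuousOn_shape.div (continuousOn_const.mul hSc)
      fun t ht => mul_ne_zero two_ne_zero (hS0 t ht)
  set φ := affineMove z w (ζ p) (ζ' p) with hφ
  set m := moveSpeed z w γ s ζ ζ' p with hm
  set N : ℝ → ℂ := rootDensity p (fun t => φ (γ t)) m with hN
  have iN : IntervalIntegrable (fun t => N t * (-2 * v.1 * φ (γ t) - 28 * v.2))
      MeasureTheory.volume 0 T :=
    hA.intervalIntegrable_sub le_rfl hT.le le_rfl
      ((continuousOn_const.mul hA.continuousOn).sub continuousOn_const)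
  have iL := (iS.const_mul (2 * s * (5 * κ ^ 4 * dκ))).add (iD.const_mul (2 * s * κ ^ 5 * dy))
  -- the difference is the integral of a derivative
  have key : ∫ t in 0..T, ((2 * s * (5 * κ ^ 4 * dκ)) * S t
      + (2 * s * κ ^ 5 * dy) * (D t / (2 * S t)))
      - N t * (-2 * v.1 * φ (γ t) - 28 * v.2) = 0 - 0 := by
    have hlim : ∀ (l : Filter ℝ) (x : ℂ), Tendsto γ l (𝓝 x) →
        Tendsto (fun t => f (γ t) * moveFactor z w γ ζ ζ' p t) l (𝓝 0) →
        Tendsto (fun t => 2 * (f (γ t) * moveFactor z w γ ζ ζ' p t *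
          (dζ + (γ t - z) * (2 * κ * dκ)))) l (𝓝 0) := by
      intro l x h1 h2
      simpa using (h2.mul (((h1.sub_const z).mul_const (2 * κ * dκ)).const_add dζ)).const_mul 2
    -- The primitive is `2 √V` times the velocity, in `τ`, of the moving point of the arc; it
    -- vanishes at both ends along with `√V`.
    refine intervalIntegral.integral_eq_sub_of_hasDerivAt_of_tendsto hT
      (f := fun t => 2 * (f (γ t) * moveFactor z w γ ζ ζ' p t *
          (dζ + (γ t - z) * (2 * κ * dκ)))) ?_ (iL.sub iN)
      (hlim _ z h.line.tendsto_source hA.tendsto_root_left) ?_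
    · intro t ht
      have ht' := Ioo_subset_Icc_self ht
      -- the variation of the potential along the moving arc
      have hvar : -2 * v.1 * φ (γ t) - 28 * v.2 +
          cubicDeriv p (φ (γ t)) * (dζ + (γ t - z) * (2 * κ * dκ)) =
          cubicPotential p₀ (γ t) * (6 * κ ^ 5 * dκ * (1 + y * D t) + κ ^ 6 * (dy * D t)) := by
        have hφτ : HasDerivAt (fun τ : ℂ => affineMove z w (ζ (p + τ • v)) (ζ' (p + τ • v)) (γ t))
            (dζ + (γ t - z) * (2 * κ * dκ)) 0 := hdζ.add (hdk.const_mul (γ t - z))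
        have hl1 : HasDerivAt (fun τ : ℂ => (p + τ • v).1) v.1 0 := hline.fst
        have hl2 : HasDerivAt (fun τ : ℂ => (p + τ • v).2) v.2 0 := hline.snd
        have hV : HasDerivAt (fun τ : ℂ => cubicPotential (p + τ • v)
            (affineMove z w (ζ (p + τ • v)) (ζ' (p + τ • v)) (γ t)))
            (-2 * v.1 * φ (γ t) - 28 * v.2 +
              cubicDeriv p (φ (γ t)) * (dζ + (γ t - z) * (2 * κ * dκ))) 0 := by
          have := (((hφτ.fun_pow 3).const_mul 4).fun_sub ((hl1.const_mul 2).fun_mul hφτ)).fun_sub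
            (hl2.const_mul 28)
          refine this.congr_deriv ?_
          rw [hp0, ← hφ]
          unfold cubicDeriv
          push_cast
          ring
        -- The same derivative, computed from the product formula `potential_move`, which holds for
        -- all small `τ`; uniqueness of derivatives equates the two.
        have hR := ((((hdk.fun_pow 3).fun_mul ((hdy.mul_const (D t)).const_add 1))).const_mul
          (cubicPotential p₀ (γ t)))
        have hgood : ∀ᶠ τ : ℂ in 𝓝 0, IsGood z w T γ ζ ζ' ε η (p + τ • v) := by
          have : Tendsto (fun τ : ℂ => p + τ • v) (𝓝 0) (𝓝 p) := by
            simpa using hline.continuousAt.tendsto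
          exact this.eventually hev
        have hR' := hR.congr_of_eventuallyEq (f₁ := fun τ : ℂ => cubicPotential (p + τ • v)
            (affineMove z w (ζ (p + τ • v)) (ζ' (p + τ • v)) (γ t))) (by
          filter_upwards [hgood] with τ gτ
          exact gτ.potential_move h ht')
        rw [hV.unique hR', hp0, ← hk, ← hy, ← hκ2]
        push_cast
        ring
      have hμ := hA.root_hasDerivAt ht
      have hγ := (h.line.stokes.differentiableAt t ht).hasDerivAt
      have hE := (hμ.fun_mul (((hγ.sub_const z).mul_const (2 * κ * dκ)).const_add dζ)).const_mul 2
      refine hE.congr_deriv ?_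
      have hfm := factor_mul_deriv (ζ := ζ) (ζ' := ζ') h p ht
      rw [← hk] at hfm
      have hS0' := hS0 t ht'
      have hNt : N t * cubicPotential p₀ (γ t) * (κ ^ 6 * S t ^ 2) = s * κ ^ 5 * S t := by
        have hpm := g.potential_move h ht'
        rw [← hk, ← hy] at hpm
        have e : κ ^ 6 * S t ^ 2 = k ^ 3 * (1 + y * (3 / (γ t + z + w))) := by
          rw [hS2, ← hκ2]; ring
        rw [mul_assoc, e, ← hpm, hN, rootDensity, mul_assoc,
          inv_mul_cancel₀ (hA.potential_ne_zero ht),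
          mul_one]
        rfl
      have hmt : m t = s * κ ^ 5 * S t := rfl
      have hfm' : f (γ t) * moveFactor z w γ ζ ζ' p t * deriv γ t = s * κ ^ 3 * S t := by
        have e : f (γ t) * moveFactor z w γ ζ ζ' p t * deriv γ t * k = s * κ ^ 3 * S t * k := by
          rw [mul_assoc _ (deriv γ t), hfm, ← hm, hmt, ← hκ2]; ring
        exact mul_right_cancel₀ hk0 e
      have hN1 : N t * cubicPotential p₀ (γ t) * κ * S t = s := by
        have : κ ^ 5 * S t ≠ 0 := mul_ne_zero (pow_ne_zero 5 hκ0) hS0'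
        apply mul_right_cancel₀ this
        linear_combination hNt
      have hDS : D t / (2 * S t) * S t = D t / 2 := by field_simp
      have hNV : N t * (-2 * v.1 * φ (γ t) - 28 * v.2 +
          cubicDeriv p (φ (γ t)) * (dζ + (γ t - z) * (2 * κ * dκ))) =
          6 * s * κ ^ 4 * dκ * S t + 2 * s * κ ^ 5 * dy * (D t / (2 * S t)) := by
        rw [hvar, ← hS2]
        apply mul_right_cancel₀ hS0'
        linear_combination (6 * κ ^ 4 * dκ * S t ^ 2 + κ ^ 5 * dy * D t) * hN1 -
          2 * s * κ ^ 5 * dy * hDS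
      rw [← hN]
      linear_combination hNV + 4 * κ * dκ * hfm'
    · have hr : Tendsto γ (𝓝[<] T) (𝓝 w) := by
        have := h.line.continuousOn T ⟨hT.le, le_rfl⟩
        rw [← h.line.target, ← nhdsWithin_Ioo_eq_nhdsLT hT]
        exact this.mono Ioo_subset_Icc_self
      exact hlim _ w hr hA.tendsto_root_right
  rw [intervalIntegral.integral_sub iL iN, intervalIntegral.integral_add (iS.const_mul _)
    (iD.const_mul _), intervalIntegral.integral_const_mul, intervalIntegral.integral_const_mul]
    at key
  push_cast
  linear_combination key

end IsGood

end IsMovingLine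

/-! ### The inverse function theorem and the holomorphy of turning points. -/

theorem ContinuousLinearMap.det_prod (A : ℂ × ℂ →L[ℂ] ℂ × ℂ) :
    A.det = (A (1, 0)).1 * (A (0, 1)).2 - (A (0, 1)).1 * (A (1, 0)).2 := by
  rw [ContinuousLinearMap.det, ← LinearMap.det_toMatrix (Module.Basis.finTwoProd ℂ),
    Matrix.det_fin_two]
  simp [LinearMap.toMatrix_apply]

/-- The inverse function theorem for holomorphic maps of `ℂ²`. -/
theorem isLocallyBiholomorphicAt_of_det {F : ℂ × ℂ → ℂ × ℂ} {p : ℂ × ℂ} (hF : AnalyticAt ℂ F p)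
    (hdet : (fderiv ℂ F p).det ≠ 0) : IsLocallyBiholomorphicAt F p := by
  have hev : ∀ᶠ q in 𝓝 p, AnalyticAt ℂ F q ∧ (fderiv ℂ F q).det ≠ 0 := by
    refine hF.eventually_analyticAt.and ?_
    have : ContinuousAt (fun q => (fderiv ℂ F q).det) p := by
      have h1 := hF.fderiv.continuousAt
      simp only [ContinuousLinearMap.det_prod]
      have h2 : ∀ v, ContinuousAt (fun q => fderiv ℂ F q v) p := fun v =>
        h1.clm_apply continuousAt_const
      exact ((h2 _).fst.mul (h2 _).snd).sub ((h2 _).fst.mul (h2 _).snd)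
    exact this.eventually_ne hdet
  -- The local inverse is restricted to `U` so that the derivative is invertible at every source
  -- point, making the inverse analytic on the whole target.
  obtain ⟨U, hU, hUo, hpU⟩ := eventually_nhds_iff.1 hev
  have hder : ∀ q, ∀ hq : (fderiv ℂ F q).det ≠ 0,
      ((fderiv ℂ F q).toContinuousLinearEquivOfDetNeZero hq : ℂ × ℂ →L[ℂ] ℂ × ℂ) =
        fderiv ℂ F q := fun q hq =>
    ContinuousLinearMap.coe_toContinuousLinearEquivOfDetNeZero _ hq
  have hstrict : HasStrictFDerivAt F ((fderiv ℂ F p).toContinuousLinearEquivOfDetNeZero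
      hdet : ℂ × ℂ →L[ℂ] ℂ × ℂ) p := by
    rw [hder p hdet]; exact hF.hasStrictFDerivAt
  set e₀ := hstrict.toOpenPartialHomeomorph F
  set e := e₀.restrOpen U hUo
  have hsrc : e.source = e₀.source ∩ U := OpenPartialHomeomorph.restrOpen_source _ _ _
  refine ⟨e, ?_, fun q _ => rfl, ?_, ?_⟩
  · rw [hsrc]; exact ⟨hstrict.mem_toOpenPartialHomeomorph_source, hpU⟩
  · intro q hq
    rw [hsrc] at hq
    exact (hU q hq.2).1
  · intro y hy
    have hq := e.map_target hy
    have hqU : e.symm y ∈ U := by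
      rw [hsrc] at hq; exact hq.2
    have := e.analyticAt_symm' (i := (fderiv ℂ F (e.symm y)).toContinuousLinearEquivOfDetNeZero
      (hU _ hqU).2) hq (hU _ hqU).1 (by rw [hder _ (hU _ hqU).2]; rfl)
    rwa [e.right_inv hy] at this

/-- The coefficients `(a, b)` of the cubic potential with roots `z, w, -z-w`. -/
def cubicCoeff (q : ℂ × ℂ) : ℂ × ℂ :=
  (2 * (q.1 ^ 2 + q.1 * q.2 + q.2 ^ 2), -(q.1 * q.2 * (q.1 + q.2)) / 7)

theorem analyticAt_cubicCoeff (q : ℂ × ℂ) : AnalyticAt ℂ cubicCoeff q := by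
  have h1 : AnalyticAt ℂ (fun q : ℂ × ℂ => q.1) q := analyticAt_fst
  have h2 : AnalyticAt ℂ (fun q : ℂ × ℂ => q.2) q := analyticAt_snd
  exact (analyticAt_const.mul (((h1.pow 2).add (h1.mul h2)).add (h2.pow 2))).prod
    (((h1.mul h2).mul (h1.add h2)).neg.div_const)

/-- Up to a constant this is the Vandermonde product of the roots `z, w, -z-w`: the coefficients are
local coordinates exactly where the roots are distinct. -/
theorem det_fderiv_cubicCoeff (q : ℂ × ℂ) : (fderiv ℂ cubicCoeff q).det =
    -(2 / 7) * (2 * q.1 + q.2) * (q.1 + 2 * q.2) * (q.1 - q.2) := by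
  have key : ∀ v : ℂ × ℂ, fderiv ℂ cubicCoeff q v =
      (2 * (2 * q.1 * v.1 + q.1 * v.2 + v.1 * q.2 + 2 * q.2 * v.2),
        -(v.1 * q.2 * (q.1 + q.2) + q.1 * v.2 * (q.1 + q.2) + q.1 * q.2 * (v.1 + v.2)) / 7) := by
    intro v
    have hline : HasDerivAt (fun τ : ℂ => q + τ • v) v 0 := by
      simpa using ((hasDerivAt_id (0 : ℂ)).smul_const v).const_add q
    refine ((analyticAt_cubicCoeff q).hasDerivAt_line v).unique ?_
    have hl1 : HasDerivAt (fun τ : ℂ => (q + τ • v).1) v.1 0 := hline.fst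
    have hl2 : HasDerivAt (fun τ : ℂ => (q + τ • v).2) v.2 0 := hline.snd
    refine HasDerivAt.prodMk ?_ ?_
    · refine ((((hl1.fun_pow 2).fun_add (hl1.fun_mul hl2)).fun_add
        (hl2.fun_pow 2)).const_mul 2).congr_deriv ?_
      simp
      ring
    · refine ((((hl1.fun_mul hl2).fun_mul (hl1.fun_add hl2)).fun_neg).div_const 7).congr_deriv ?_
      simp
      ring
  rw [ContinuousLinearMap.det_prod, key, key]
  simp
  ring

/-- Two continuous branches of distinct simple turning points are holomorphic. -/
theorem IsTurningPointBranch.analyticAt {p₀ : ℂ × ℂ} {z w : ℂ} {ζ ζ' : ℂ × ℂ → ℂ}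
    (h : IsTurningPointBranch p₀ z ζ) (h' : IsTurningPointBranch p₀ w ζ') (hzw : z ≠ w)
    (h1 : 2 * z + w ≠ 0) (h2 : z + 2 * w ≠ 0) : AnalyticAt ℂ ζ p₀ ∧ AnalyticAt ℂ ζ' p₀ := by
  have hdet : (fderiv ℂ cubicCoeff (z, w)).det ≠ 0 := by
    rw [det_fderiv_cubicCoeff]
    exact mul_ne_zero (mul_ne_zero (mul_ne_zero (by norm_num) h1) h2) (sub_ne_zero.2 hzw)
  obtain ⟨e, hmem, heq, -, han⟩ := isLocallyBiholomorphicAt_of_det (analyticAt_cubicCoeff _) hdet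
  have hlim : Tendsto (fun p => (ζ p, ζ' p)) (𝓝 p₀) (𝓝 (z, w)) := by
    have := h.continuousAt.tendsto.prodMk_nhds h'.continuousAt.tendsto
    rwa [h.value, h'.value] at this
  have hne : ∀ᶠ p in 𝓝 p₀, ζ p ≠ ζ' p := by
    have h3 := (h.continuousAt.sub h'.continuousAt).eventually_ne (y := 0)
      (by rw [Pi.sub_apply, h.value, h'.value]; exact sub_ne_zero.2 hzw)
    filter_upwards [h3] with p hp
    exact sub_ne_zero.1 hp
  -- Continuity keeps the pair of branches in the domain of injectivity of the coefficient map, so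
  -- it must be the holomorphic local inverse.
  have hinv : ∀ᶠ p in 𝓝 p₀, e.symm p = (ζ p, ζ' p) := by
    filter_upwards [h.turning, h'.turning, hne, hlim.eventually (e.open_source.mem_nhds hmem)]
      with p hz hw hzw hp
    have hc := cubic_coeff_of_roots hz hw hzw
    have h4 : e (ζ p, ζ' p) = p := by
      rw [heq hp, cubicCoeff]
      exact Prod.ext hc.1.symm hc.2.symm
    have h5 := e.left_inv hp
    rwa [h4] at h5
  have hp₀ : p₀ ∈ e.target := by
    have hc := cubic_coeff_of_roots h.turning.self_of_nhds h'.turning.self_of_nhds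
      hne.self_of_nhds
    have h6 : e (z, w) = p₀ := by
      rw [heq hmem, cubicCoeff, ← h.value, ← h'.value]
      exact Prod.ext hc.1.symm hc.2.symm
    rw [← h6]; exact e.map_source hmem
  have ha := (han p₀ hp₀).congr hinv
  exact ⟨analyticAt_fst.comp ha, analyticAt_snd.comp ha⟩

/-- The branch of the root along an internal line of the Stokes graph. -/
theorem StokesGraph320.exists_isMovingLine {p₀ : ℂ × ℂ} (G : StokesGraph320 p₀) {f : ℂ → ℂ}
    (hf : IsSqrtBranch p₀ G f) {z w : ℂ} {T : ℝ} {γ : ℝ → ℂ} {ζ ζ' : ℂ × ℂ → ℂ}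
    (hγ : IsInternalStokesLine p₀ z w T γ) (hz : cubicPotential p₀ z = 0)
    (hw : cubicPotential p₀ w = 0) (hzw : z ≠ w) (hz' : cubicDeriv p₀ z ≠ 0)
    (hw' : cubicDeriv p₀ w ≠ 0) (h : IsTurningPointBranch p₀ z ζ)
    (h' : IsTurningPointBranch p₀ w ζ') : ∃ s, IsMovingLine p₀ z w T γ f s ζ ζ' := by
  have hc := cubic_coeff_of_roots hz hw hzw
  have hcut : ∀ t ∈ Ioo 0 T, γ t ∈ G.cutPlane := fun t ht =>
    G.mem_cutPlane_of_isInternalStokesLine hγ hz hw ht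
  have hcont : ContinuousOn (fun t => f (γ t)) (Ioo 0 T) := hf.continuousOn.comp
    (hγ.continuousOn.mono Ioo_subset_Icc_self) hcut
  have ha := h.analyticAt h' hzw
    (fun h0 => hz' (by rw [cubicDeriv_eq_of_coeff hc.1]; linear_combination 4 * (z - w) * h0))
    (fun h0 => hw' (by rw [cubicDeriv_eq_of_coeff hc.1]; linear_combination 4 * (w - z) * h0))
  -- The product `f(γ) γ'` is continuous with square `-1`, hence constantly `i` or constantly `-i`.
  have hs : ∃ s, ∀ t ∈ Ioo 0 T, f (γ t) * deriv γ t = s := by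
    rcases isPreconnected_Ioo.eq_or_eq_neg_of_sq_eq (hcont.mul hγ.stokes.continuousOn_deriv)
      (continuousOn_const (c := Complex.I)) (fun t ht => by
        simp only [Pi.pow_apply]
        rw [Pi.mul_apply, mul_pow, hf.sq_eq _ (hcut t ht), hγ.stokes.potential_mul_sq t ht,
          Complex.I_sq])
      (fun {t} _ => Complex.I_ne_zero) with h | h
    · exact ⟨_, fun t ht => h ht⟩
    · exact ⟨_, fun t ht => h ht⟩
  obtain ⟨s, hs⟩ := hs
  exact ⟨s, hγ, hz, hw, hzw, hz', hw', hcont, fun t ht => hf.sq_eq _ (hcut t ht), hs, ha.1, ha.2,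
    h.value, h'.value, h.turning, h'.turning⟩

/-! ### The Jacobian of the periods and the conclusion. -/

/-- The partial derivatives of a holomorphic function on `ℂ²`. -/
theorem deriv_partial {F : ℂ × ℂ → ℂ} {a b : ℂ} (hF : DifferentiableAt ℂ F (a, b)) :
    deriv (fun x => F (x, b)) a = fderiv ℂ F (a, b) (1, 0) ∧
    deriv (fun y => F (a, y)) b = fderiv ℂ F (a, b) (0, 1) := by
  constructor
  · have h1 : HasDerivAt (fun x : ℂ => (x, b)) (1, 0) a :=
      (hasDerivAt_id' a).prodMk (hasDerivAt_const a b)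
    exact (hF.hasFDerivAt.comp_hasDerivAt a h1).deriv
  · have h1 : HasDerivAt (fun y : ℂ => (a, y)) (0, 1) b :=
      (hasDerivAt_const b a).prodMk (hasDerivAt_id' b)
    exact (hF.hasFDerivAt.comp_hasDerivAt b h1).deriv

/-- The Jacobian determinant of `bsbMap χ χ'`. -/
theorem det_fderiv_bsbMap {χ χ' : ℂ × ℂ → ℂ} {p : ℂ × ℂ} (h : DifferentiableAt ℂ χ p)
    (h' : DifferentiableAt ℂ χ' p) : DifferentiableAt ℂ (bsbMap χ χ') p ∧
    (fderiv ℂ (bsbMap χ χ') p).det = Complex.exp (χ p) * Complex.exp (χ' p) *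
      (fderiv ℂ χ p (1, 0) * fderiv ℂ χ' p (0, 1) -
        fderiv ℂ χ' p (1, 0) * fderiv ℂ χ p (0, 1)) := by
  have h1 : HasFDerivAt (bsbMap χ χ') _ p :=
    (h.hasFDerivAt.cexp.neg.sub_const 1).prodMk (h'.hasFDerivAt.cexp.neg.sub_const 1)
  refine ⟨h1.differentiableAt, ?_⟩
  rw [h1.fderiv, ContinuousLinearMap.det_prod]
  simp
  ring

namespace IsMovingLine

variable {p₀ : ℂ × ℂ} {z w : ℂ} {T : ℝ} {γ : ℝ → ℂ} {f : ℂ → ℂ} {s : ℂ} {ζ ζ' : ℂ × ℂ → ℂ}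
  {ε η : ℝ} {p : ℂ × ℂ}

theorem IsGood.fderiv_period (h : IsMovingLine p₀ z w T γ f s ζ ζ')
    (g : IsGood z w T γ ζ ζ' ε η p) (hev : ∀ᶠ q in 𝓝 p, IsGood z w T γ ζ ζ' ε η q) (v : ℂ × ℂ) :
    fderiv ℂ (fun p => 2 * ∫ t in 0..T, moveSpeed z w γ s ζ ζ' p t) p v =
      -2 * v.1 * (∫ t in 0..T, rootDensity p (fun t => affineMove z w (ζ p) (ζ' p) (γ t))
        (moveSpeed z w γ s ζ ζ' p) t * affineMove z w (ζ p) (ζ' p) (γ t))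
      - 28 * v.2 * ∫ t in 0..T, rootDensity p (fun t => affineMove z w (ζ p) (ζ' p) (γ t))
        (moveSpeed z w γ s ζ ζ' p) t := by
  have hT := h.line.length_pos
  have hA := g.isRootArc h
  have h1 := period_hasDerivAt_line h g hev v
  rw [((g.analyticAt_period h).hasDerivAt_line v).unique h1]
  have i1 := hA.intervalIntegrable_sub le_rfl hT.le le_rfl hA.continuousOn
  have i0 := hA.intervalIntegrable_density
  rw [← intervalIntegral.integral_const_mul, ← intervalIntegral.integral_const_mul,
    ← intervalIntegral.integral_sub (i1.const_mul _) (i0.const_mul _)]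
  refine intervalIntegral.integral_congr fun t _ => ?_
  ring

end IsMovingLine

/-- The Jacobian of the two periods, at parameters for which both lines move with high
precision. -/
theorem jacobian_periods {p₀ p : ℂ × ℂ} {z w w' s s' : ℂ} {T T' c c' ε ε' η : ℝ} {γ γ' : ℝ → ℂ}
    {f : ℂ → ℂ} {ζ ζ₁ ζ₂ : ℂ × ℂ → ℂ}
    (h : IsMovingLine p₀ z w T γ f s ζ ζ₁) (h' : IsMovingLine p₀ z w' T' γ' f s' ζ ζ₂)
    (hc : 0 < c) (hc1 : c ≤ 1) (hη : η ≤ c / 8) (hη' : η < c')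
    (hsep : ∀ t ∈ Icc 0 T, ∀ x ∈ Icc 0 T',
      c' * (‖γ t - z‖ + ‖γ' x - z‖) ≤ ‖γ t - γ' x‖)
    (hsec : ∃ δ > 0, ∀ t ∈ Ioo 0 δ, ∀ x ∈ Ioo 0 δ, (f (γ' x) / f (γ t)).im ≤
      -c * ‖f (γ' x) / f (γ t)‖)
    (g : ∀ᶠ q in 𝓝 p, IsMovingLine.IsGood z w T γ ζ ζ₁ ε η q)
    (g' : ∀ᶠ q in 𝓝 p, IsMovingLine.IsGood z w' T' γ' ζ ζ₂ ε' η q)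
    (hp : cubicDeriv p (ζ p) ≠ 0) :
    fderiv ℂ (fun p => 2 * ∫ t in 0..T', moveSpeed z w' γ' s' ζ ζ₂ p t) p (1, 0) *
      fderiv ℂ (fun p => 2 * ∫ t in 0..T, moveSpeed z w γ s ζ ζ₁ p t) p (0, 1) -
    fderiv ℂ (fun p => 2 * ∫ t in 0..T, moveSpeed z w γ s ζ ζ₁ p t) p (1, 0) *
      fderiv ℂ (fun p => 2 * ∫ t in 0..T', moveSpeed z w' γ' s' ζ ζ₂ p t) p (0, 1) =
      -28 * (Real.pi : ℂ) * Complex.I := by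
  have gp := g.self_of_nhds
  have gp' := g'.self_of_nhds
  have hT := h.line.length_pos
  have hT' := h'.line.length_pos
  have hk' := gp'.scale_ne_zero
  have nγ : ∀ t ∈ Ioc 0 T, γ t ≠ z := by
    intro t ht h0
    rcases ht.2.eq_or_lt with h1 | h1
    · rw [h1, h.line.target] at h0; exact h.ne h0.symm
    · exact h.line.stokes.potential_ne_zero ⟨ht.1, h1⟩ (by rw [h0, h.turning_source])
  have nγ' : ∀ t ∈ Ioc 0 T', γ' t ≠ z := by
    intro t ht h0
    rcases ht.2.eq_or_lt with h1 | h1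
    · rw [h1, h'.line.target] at h0; exact h'.ne h0.symm
    · exact h'.line.stokes.potential_ne_zero ⟨ht.1, h1⟩ (by rw [h0, h'.turning_source])
  obtain ⟨δ, hδ, hsec⟩ := hsec
  have key := (gp.isRootArc h).legendre (gp'.isRootArc h') hp
    (by
      intro x hx h0
      rw [affineMove] at h0
      have h1 : (γ' x - z) * moveScale z w' ζ ζ₂ p = 0 := by
        rw [moveScale]; linear_combination h0
      rcases mul_eq_zero.1 h1 with h2 | h2
      · exact nγ' x hx (sub_eq_zero.1 h2)
      · exact hk' h2)
    (by
      intro t ht x hx h0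
      -- Both motions send `z` to `ζ p`, so a meeting of the moved arcs forces `γ t - γ' x` to be at
      -- most `η` times the sum of the distances to `z`. The separation constant `c' > η` forbids
      -- this, even near `z`.
      have h1 : γ t - γ' x = (γ' x - z) * (moveScale z w' ζ ζ₂ p - 1)
          - (γ t - z) * (moveScale z w ζ ζ₁ p - 1) := by
        rw [affineMove, affineMove] at h0
        rw [moveScale, moveScale]
        linear_combination -h0
      have h2 := hsep t (Ioc_subset_Icc_self ht) x hx
      have h3 : ‖γ t - γ' x‖ ≤ ‖γ' x - z‖ * η + ‖γ t - z‖ * η := by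
        rw [h1]
        refine (norm_sub_le _ _).trans ?_
        rw [norm_mul, norm_mul]
        have a1 := gp.scale_sub.le
        have a2 := gp'.scale_sub.le
        gcongr
      have h4 : 0 < ‖γ t - z‖ := norm_pos_iff.2 (sub_ne_zero.2 (nγ t ht))
      have h5 : 0 ≤ ‖γ' x - z‖ := norm_nonneg _
      nlinarith)
    (by
      -- The factors on the two arcs are within `η ≤ c/8` of `1`, so their quotient is within `c/2`
      -- of `1`, and the sector estimate survives with `c/4`.
      refine ⟨c / 4, by linarith, by linarith, min δ (min T T'), lt_min hδ (lt_min hT hT'), ?_⟩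
      intro t ht x hx
      have ht1 : t ∈ Ioo 0 δ := ⟨ht.1, ht.2.trans_le (min_le_left _ _)⟩
      have hx1 : x ∈ Ioo 0 δ := ⟨hx.1, hx.2.trans_le (min_le_left _ _)⟩
      have ht2 : t ∈ Icc 0 T :=
        ⟨ht.1.le, (ht.2.trans_le ((min_le_right _ _).trans (min_le_left _ _))).le⟩
      have hx2 : x ∈ Icc 0 T' :=
        ⟨hx.1.le, (hx.2.trans_le ((min_le_right _ _).trans (min_le_right _ _))).le⟩
      have h1 := norm_div_sub_one_le (η := η) (by linarith) (gp'.factor_sub x hx2).le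
        (gp.factor_sub t ht2).le
      have h2 := im_mul_le_of_norm_sub_one_le hc hc1 (hsec t ht1 x hx1) (h1.trans (by linarith))
      rw [mul_comm, ← mul_div_mul_comm] at h2
      exact h2)
  rw [gp.fderiv_period h g, gp.fderiv_period h g, gp'.fderiv_period h' g',
    gp'.fderiv_period h' g']
  linear_combination -28 * key

end

theorem mainTheorem3 (a₀ b₀ : ℂ) (G : StokesGraph320 (a₀, b₀)) (f : ℂ → ℂ)
    (hf : IsSqrtBranch (a₀, b₀) G f) (ζ₀ ζ₁ ζm : ℂ × ℂ → ℂ)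
    (h₀ : IsTurningPointBranch (a₀, b₀) G.z₀ ζ₀)
    (h₁ : IsTurningPointBranch (a₀, b₀) G.z₁ ζ₁)
    (hm : IsTurningPointBranch (a₀, b₀) G.zm ζm)
    (χ₂ χm₂ : ℂ × ℂ → ℂ) (hχ₂ : χ₂ = chi₂ (a₀, b₀) G f ζ₀ ζm)
    (hχm₂ : χm₂ = chim₂ (a₀, b₀) G f ζ₀ ζ₁) :
    ∃ N : Set (ℂ × ℂ), IsOpen N ∧ (a₀, b₀) ∈ N ∧
      AnalyticOnNhd ℂ χ₂ N ∧ AnalyticOnNhd ℂ χm₂ N ∧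
      (∀ a b : ℂ, (a, b) ∈ N →
        deriv (fun x => χ₂ (x, b)) a * deriv (fun y => χm₂ (a, y)) b
          - deriv (fun x => χm₂ (x, b)) a * deriv (fun y => χ₂ (a, y)) b
          = -28 * (Real.pi : ℂ) * Complex.I) ∧
      (∀ p ∈ N, IsLocallyBiholomorphicAt (bsbMap χ₂ χm₂) p) ∧
      (∀ p ∈ N, bsbMap χ₂ χm₂ p = 0 → IsSimpleZero (bsbMap χ₂ χm₂) p) := by
  obtain ⟨c, hc, hc1, hsec⟩ := G.exists_sector hf
  obtain ⟨c', hc', hsep⟩ := G.exists_separation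
  obtain ⟨s, hL⟩ := G.exists_isMovingLine hf G.internal₁ G.turning_z₀ G.turning_z₁ G.z₀_ne_z₁
    G.deriv_z₀ G.deriv_z₁ h₀ h₁
  obtain ⟨s', hL'⟩ := G.exists_isMovingLine hf G.internalm G.turning_z₀ G.turning_zm G.z₀_ne_zm
    G.deriv_z₀ G.deriv_zm h₀ hm
  -- One precision for both lines: `c/8` preserves the sector at `z₀`, and `c'/2` keeps the moved
  -- arcs disjoint away from their common end.
  set η := min (c / 8) (c' / 2) with hη
  have hη0 : 0 < η := lt_min (by linarith) (by linarith)
  have hη1 : η ≤ c / 8 := min_le_left _ _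
  have hη2 : η < c' := (min_le_right _ _).trans_lt (by linarith)
  obtain ⟨ε, hε, hg⟩ := hL.eventually_isGood hη0
  obtain ⟨ε', hε', hg'⟩ := hL'.eventually_isGood hη0
  have hd : ∀ᶠ p in 𝓝 (a₀, b₀), cubicDeriv p (ζ₀ p) ≠ 0 := by
    have h1 : ContinuousAt (fun p : ℂ × ℂ => cubicDeriv p (ζ₀ p)) (a₀, b₀) := by
      unfold cubicDeriv
      exact (continuousAt_const.mul (h₀.continuousAt.pow 2)).sub
        (continuousAt_const.mul continuousAt_fst)
    refine h1.eventually_ne ?_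
    rw [h₀.value]
    exact G.deriv_z₀
  obtain ⟨N, hN, hNo, hpN⟩ := eventually_nhds_iff.1 (hd.and (hg.and hg'))
  have hev : ∀ p ∈ N, ∀ᶠ q in 𝓝 p, IsMovingLine.IsGood G.z₀ G.z₁ G.T₁ G.line₁ ζ₀ ζ₁ ε η q :=
    fun p hp => by filter_upwards [hNo.mem_nhds hp] with q hq using (hN q hq).2.1
  have hev' : ∀ p ∈ N, ∀ᶠ q in 𝓝 p, IsMovingLine.IsGood G.z₀ G.zm G.Tm G.linem ζ₀ ζm ε' η q :=
    fun p hp => by filter_upwards [hNo.mem_nhds hp] with q hq using (hN q hq).2.2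
  have e₁ : ∀ p ∈ N, χm₂ =ᶠ[𝓝 p]
      fun p => 2 * ∫ t in 0..G.T₁, moveSpeed G.z₀ G.z₁ G.line₁ s ζ₀ ζ₁ p t := fun p hp => by
    filter_upwards [hev p hp] with q hq
    rw [hχm₂, chim₂, hq.sqrtPeriod_eq hL (by linarith)]
  have em : ∀ p ∈ N, χ₂ =ᶠ[𝓝 p]
      fun p => 2 * ∫ t in 0..G.Tm, moveSpeed G.z₀ G.zm G.linem s' ζ₀ ζm p t := fun p hp => by
    filter_upwards [hev' p hp] with q hq
    rw [hχ₂, chi₂, hq.sqrtPeriod_eq hL' (by linarith)]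
  have a₁ : AnalyticOnNhd ℂ χm₂ N := fun p hp =>
    ((hN p hp).2.1.analyticAt_period hL).congr (e₁ p hp).symm
  have am : AnalyticOnNhd ℂ χ₂ N := fun p hp =>
    ((hN p hp).2.2.analyticAt_period hL').congr (em p hp).symm
  have hJ : ∀ p ∈ N, fderiv ℂ χ₂ p (1, 0) * fderiv ℂ χm₂ p (0, 1)
      - fderiv ℂ χm₂ p (1, 0) * fderiv ℂ χ₂ p (0, 1) = -28 * (Real.pi : ℂ) * Complex.I := by
    intro p hp
    rw [(e₁ p hp).fderiv_eq, (em p hp).fderiv_eq]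
    exact jacobian_periods hL hL' hc hc1 hη1 hη2 hsep hsec (hev p hp) (hev' p hp) (hN p hp).1
  have hdet : ∀ p ∈ N, (fderiv ℂ (bsbMap χ₂ χm₂) p).det ≠ 0 := by
    intro p hp
    rw [(det_fderiv_bsbMap (am p hp).differentiableAt (a₁ p hp).differentiableAt).2, hJ p hp]
    refine mul_ne_zero (mul_ne_zero (Complex.exp_ne_zero _) (Complex.exp_ne_zero _))
      (mul_ne_zero (mul_ne_zero (by norm_num) ?_) Complex.I_ne_zero)
    exact_mod_cast Real.pi_ne_zero
  refine ⟨N, hNo, hpN, am, a₁, ?_, ?_, ?_⟩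
  · intro a b hab
    have h2 := deriv_partial (am _ hab).differentiableAt
    have h3 := deriv_partial (a₁ _ hab).differentiableAt
    rw [h2.1, h2.2, h3.1, h3.2]
    exact hJ _ hab
  · intro p hp
    refine isLocallyBiholomorphicAt_of_det ?_ (hdet p hp)
    exact (((am p hp).cexp.neg).sub analyticAt_const).prod
      (((a₁ p hp).cexp.neg).sub analyticAt_const)
  · intro p hp h0
    exact ⟨h0, (det_fderiv_bsbMap (am p hp).differentiableAt (a₁ p hp).differentiableAt).1,
      hdet p hp⟩
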